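/- Let $k$ be a commutative ring and let $A$, $B$ be associative unital $k$-algebras such that $A$ is projective as a $k$-module. *Strong homotopy modules.* A strong homotopy $A$-module over $B$ is a $\mathbf Z$-graded right $B$-module $X$ with graded $B$-linear maps $m_n : A^{\otimes_k (n-1)}\otimes_k X\to X$, $n\ge 1$, of degree $2-n$ such that for all $n\ge 1$ $$0=\sum_{i=1}^{n-2}(-1)^{i-1}m_{n-1}(a_1,\dots,a_ia_{i+1},\dots,a_{n-1},x)+\sum_{j=1}^{n}(-1)^{n-j}m_{n-j+1}(a_1,\dots,a_{n-j},m_j(a_{n-j+1},\dots,a_{n-1},x)).$$ A morphism $f:X\to Y$ is a sequence of graded $B$-linear maps $f_n:A^{\otimes (n-1)}\otimes X\to Y$, $n\ge1$, of degree $1-n$ such that for all $n \geq 1$ $$\sum_{j=1}^{n}m_{n-j+1}(a_1,\dots,a_{n-j},f_{j}(a_{n-j+1},\dots,a_{n-1},x))=\sum_{i=1}^{n-2}(-1)^{i-1}f_{n-1}(\dots,a_ia_{i+1},\dots,x)+\sum_{j=1}^{n}(-1)^{n-j}f_{n-j+1}(a_1,\dots,a_{n-j},m_j(a_{n-j+1},\dots,a_{n-1},x)).$$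 Composition is $(g\circ f)_n(a_1,\dots,a_{n-1},x)=\sum_{j=1}^n g_{n-j+1}(a_1,\dots,a_{n-j},f_j(a_{n-j+1},\dots,a_{n-1},x))$. The morphism $f$ is nullhomotopic if there are graded $B$-linear maps $h_n:A^{\otimes(n-1)}\otimes X\to Y$ of degree $-n$ with $$\begin{aligned}f_n(a_1,\dots,a_{n-1},x)={}&\sum_{j=1}^{n}(-1)^{n-j}m_{n-j+1}(a_1,\dots,a_{n-j},h_j(a_{n-j+1},\dots,a_{n-1},x))+\sum_{i=1}^{n-2}(-1)^{i-1}h_{n-1}(\dots,a_ia_{i+1},\dots,x)\\&+\sum_{j=1}^{n}(-1)^{n-j}h_{n-j+1}(a_1,\dots,a_{n-j},m_j(a_{n-j+1},\dots,a_{n-1},x)),\end{aligned}$$ and two morphisms are homotopic if their difference is nullhomotopic. The morphism $f$ is a quasi-isomorphism if $f_1:(X,m_1)\to(Y,m_1)$ is a quasi-isomorphism of complexes. The derived category $\mathcal D\,\mathrm{Sh}(A,B)$ is the localization of the resulting homotopy category at the quasi-isomorphisms; $\mathcal D\,\mathrm{Bimod}(A,B)$ is the derived category of complexes of $A$-$B$-bimodules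 (on which $k$ acts centrally). *The functors.* $R$ sends a complex $Y$ of $A$-$B$-bimodules to its underlying graded $B$-module with $m_1=d$, $m_2(a,y)=ay$ and $m_n=0$ for $n\ge3$. It preserves quasi-isomorphisms, hence induces $R:\mathcal D\,\mathrm{Bimod}(A,B)\to\mathcal D\,\mathrm{Sh}(A,B)$. For a strong homotopy module $X$ let $LX$ be the complex of $A$-$B$-bimodules with underlying graded bimodule $A\otimes_k T(A[1])\otimes_k X$, where $T(A[1])=\bigoplus_{n\ge0}A[1]^{\otimes n}$, and differential $$\begin{aligned}d(a_0,\dots,a_{n-1},x)={}&-(a_0a_1,a_2,\dots,a_{n-1},x)+\sum_{i=1}^{n-2}(-1)^{i-1}(a_0,\dots,a_ia_{i+1},\dots,a_{n-1},x)\\&+\sum_{j=1}^{n}(-1)^{n-j}(a_0,\dots,a_{n-j},m_j(a_{n-j+1},\dots,a_{n-1},x)),\end{aligned}$$ the first term being absent for $n=1$. Let $\eta_X:X\to RLX$ be the morphism with components $(a_1,\dots,a_{i-1},x)\mapsto 1\otimes(a_1,\dots,a_{i-1})\otimes x$. The module $X$ is called $H$-unital if $\eta_X$ is a quasi-isomorphism.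 **Proposition 6.4.** $L$ is left adjoint to $R$ with unit $\eta$. It induces a functor $L:\mathcal D\,\mathrm{Sh}(A,B)\to\mathcal D\,\mathrm{Bimod}(A,B)$ left adjoint to $R:\mathcal D\,\mathrm{Bimod}(A,B)\to\mathcal D\,\mathrm{Sh}(A,B)$, with unit induced by $\eta$. The functor $R:\mathcal D\,\mathrm{Bimod}(A,B)\to\mathcal D\,\mathrm{Sh}(A,B)$ is fully faithful, and its essential image consists exactly of the $H$-unital strong homotopy modules. Hence $R$ is an equivalence from $\mathcal D\,\mathrm{Bimod}(A,B)$ onto the full subcategory of $\mathcal D\,\mathrm{Sh}(A,B)$ formed by the $H$-unital strong homotopy modules, and its inverse is the restriction of the functor induced by $L$. -/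

import Mathlib

open CategoryTheory TensorProduct DirectSum

universe w u

noncomputable section

namespace ShAct

set_option linter.unusedSectionVars false

section Words

variable {A : Type*}

/-- `merge i (a₀, …, aₙ) = (a₀, …, aᵢ * aᵢ₊₁, …, aₙ)` (indices start at `0`). -/
def merge [Mul A] : ℕ → List A → List A
  | 0, a :: b :: l => (a * b) :: l
  | i + 1, a :: l => a :: merge i l
  | _, l => l

/-- A function on finite sequences in `A` which is `k`-multilinear on the sequences of each
given length. -/
structure IsMultilinear (k : Type*) [CommRing k] [AddCommGroup A] [Module k A]
    {H : Type*} [AddCommGroup H] [Module k H] (φ : List A → H) : Prop where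
  add : ∀ (u v : List A) (a b : A), φ (u ++ (a + b) :: v) = φ (u ++ a :: v) + φ (u ++ b :: v)
  smul : ∀ (u v : List A) (c : k) (a : A), φ (u ++ (c • a) :: v) = c • φ (u ++ a :: v)

section Calculus

variable [Ring A] {M N P Q : Type*} [AddCommGroup M] [AddCommGroup N] [AddCommGroup P]
  [AddCommGroup Q]

/-- `barD f (a₁, …, aₙ) = ∑ (-1)^(i-1) f (a₁, …, aᵢ aᵢ₊₁, …, aₙ)`. -/
def barD (f : List A → M) (l : List A) : M :=
  ∑ i ∈ Finset.range (l.length - 1), (-1 : ℤ) ^ i • f (merge i l)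

/-- `conv g f (a₁, …, aₙ) = ∑ g (a₁, …, aⱼ) ∘ f (aⱼ₊₁, …, aₙ)`. -/
def conv (g : List A → N →+ P) (f : List A → M →+ N) (l : List A) : M →+ P :=
  ∑ j ∈ Finset.range (l.length + 1), (g (l.take j)).comp (f (l.drop j))

/-- `sgn g (a₁, …, aₙ) = (-1)^n g (a₁, …, aₙ)`. -/
def sgn (g : List A → M) (l : List A) : M := (-1 : ℤ) ^ l.length • g l

/-- `pre a g (a₁, …, aₙ) = g (a, a₁, …, aₙ)`. -/
def pre (a : A) (g : List A → M) (l : List A) : M := g (a :: l)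

theorem merge_length (i : ℕ) (l : List A) (h : i < l.length - 1) :
    (merge i l).length + 1 = l.length := by
  induction i generalizing l with
  | zero =>
    rcases l with _ | ⟨a, _ | ⟨b, l⟩⟩
    · simp at h
    · simp at h
    · simp [merge]
  | succ i ih =>
    rcases l with _ | ⟨a, l⟩
    · simp at h
    · simp only [merge, List.length_cons] at h ⊢
      rw [ih l (by omega)]

theorem barD_nil (f : List A → M) : barD f [] = 0 := by simp [barD]

theorem barD_single (f : List A → M) (a : A) : barD f [a] = 0 := by simp [barD]

theorem barD_cons (f : List A → M) (a b : A) (l : List A) :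
    barD f (a :: b :: l) = f ((a * b) :: l) - barD (pre a f) (b :: l) := by
  simp only [barD, List.length_cons, Nat.add_sub_cancel]
  rw [Finset.sum_range_succ']
  simp [merge, pow_succ, pre, sub_eq_add_neg, add_comm]

theorem conv_nil (g : List A → N →+ P) (f : List A → M →+ N) :
    conv g f [] = (g []).comp (f []) := by simp [conv]

theorem conv_cons (g : List A → N →+ P) (f : List A → M →+ N) (a : A) (l : List A) :
    conv g f (a :: l) = (g []).comp (f (a :: l)) + conv (pre a g) f l := by
  simp only [conv, List.length_cons]
  rw [Finset.sum_range_succ']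
  simp [pre, add_comm]

theorem pre_conv (g : List A → N →+ P) (f : List A → M →+ N) (a : A) :
    pre a (conv g f) = (fun l => (g []).comp (pre a f l)) + conv (pre a g) f := by
  funext l
  simp [pre, conv_cons]

theorem pre_sgn (g : List A → M) (a : A) : pre a (sgn g) = - sgn (pre a g) := by
  funext l; simp [pre, sgn, pow_succ]

theorem barD_add (f g : List A → M) (l : List A) : barD (f + g) l = barD f l + barD g l := by
  simp [barD, Finset.sum_add_distrib]

theorem barD_neg (f : List A → M) (l : List A) : barD (-f) l = - barD f l := by
  simp [barD]

theorem barD_map (F : M →+ N) (f : List A → M) (l : List A) :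
    barD (fun t => F (f t)) l = F (barD f l) := by
  simp [barD, map_sum, map_zsmul]

theorem barD_comp (F : N →+ P) (f : List A → M →+ N) (l : List A) :
    barD (fun t => F.comp (f t)) l = F.comp (barD f l) :=
  barD_map (AddMonoidHom.compHom F) f l

theorem conv_add_left (g g' : List A → N →+ P) (f : List A → M →+ N) (l : List A) :
    conv (g + g') f l = conv g f l + conv g' f l := by
  simp [conv, Finset.sum_add_distrib, AddMonoidHom.add_comp]

theorem conv_neg_left (g : List A → N →+ P) (f : List A → M →+ N) (l : List A) :
    conv (-g) f l = - conv g f l := by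
  have h := conv_add_left (-g) g f l
  have h0 : conv (-g + g) f l = 0 := by
    rw [neg_add_cancel]; simp only [conv, Pi.zero_apply]
    exact Finset.sum_eq_zero fun j _ => AddMonoidHom.zero_comp _
  rw [h0] at h
  exact eq_neg_of_add_eq_zero_left h.symm

theorem conv_add_right (g : List A → N →+ P) (f f' : List A → M →+ N) (l : List A) :
    conv g (f + f') l = conv g f l + conv g f' l := by
  simp [conv, Finset.sum_add_distrib, AddMonoidHom.comp_add]

theorem conv_comp_left (F : P →+ Q) (g : List A → N →+ P) (f : List A → M →+ N) (l : List A) :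
    conv (fun t => F.comp (g t)) f l = F.comp (conv g f l) := by
  simp only [conv, AddMonoidHom.comp_assoc]
  exact (map_sum (AddMonoidHom.compHom F) _ _).symm

theorem conv_assoc (h : List A → P →+ Q) (g : List A → N →+ P) (f : List A → M →+ N)
    (l : List A) : conv (conv h g) f l = conv h (conv g f) l := by
  induction l generalizing h with
  | nil => simp [conv_nil, AddMonoidHom.comp_assoc]
  | cons a l ih =>
    rw [conv_cons, pre_conv, conv_add_left, ih, conv_nil]
    rw [conv_cons h (conv g f), conv_cons g f, AddMonoidHom.comp_add]
    rw [conv_comp_left]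
    simp only [AddMonoidHom.comp_assoc]
    rw [add_assoc]

theorem sgn_conv (g : List A → N →+ P) (f : List A → M →+ N) (l : List A) :
    sgn (conv g f) l = conv (sgn g) (sgn f) l := by
  simp only [sgn, conv, Finset.smul_sum]
  refine Finset.sum_congr rfl fun j hj => ?_
  have hj' : j ≤ l.length := by simpa [Nat.lt_succ_iff] using hj
  have : l.length = (l.take j).length + (l.drop j).length := by simp [hj']
  conv_lhs => rw [this, pow_add, mul_smul]
  ext x
  simp

/-- The graded Leibniz rule. -/
theorem barD_conv (g : List A → N →+ P) (f : List A → M →+ N) (l : List A) :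
    barD (conv g f) l = conv (barD g) f l + conv (sgn g) (barD f) l := by
  induction l generalizing g with
  | nil => simp [barD_nil, conv_nil]
  | cons a l ih =>
    rcases l with _ | ⟨b, l⟩
    · simp [conv_cons, conv_nil, barD_nil, barD_single, pre]
    · rw [barD_cons, pre_conv, barD_add, barD_comp, ih]
      rw [conv_cons g f, conv_cons (barD g) f, conv_cons (sgn g) (barD f)]
      rw [barD_nil, barD_cons, pre_sgn, conv_neg_left]
      have e1 : conv (pre a (barD g)) f (b :: l)
          = conv (pre (a * b) g) f l - conv (barD (pre a g)) f (b :: l) := by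
        rw [conv_cons, conv_cons (barD (pre a g))]
        have e2 : pre b (pre a (barD g)) = pre (a * b) g + -(pre b (barD (pre a g))) := by
          funext t; simp [pre, barD_cons, sub_eq_add_neg]
        rw [e2, conv_add_left, conv_neg_left]
        simp [pre, barD_nil, barD_single, sub_eq_add_neg]
      rw [e1]
      simp [sgn, sub_eq_add_neg, AddMonoidHom.comp_add, AddMonoidHom.comp_neg]
      abel

theorem barD_barD (f : List A → M) (l : List A) : barD (barD f) l = 0 := by
  induction l generalizing f with
  | nil => simp [barD_nil]
  | cons a l ih =>
    rcases l with _ | ⟨b, _ | ⟨c, l⟩⟩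
    · simp [barD_single]
    · simp [barD_cons, barD_single]
    · rw [barD_cons]
      have key : ∀ t, pre b (pre a (barD f)) t
          = (pre (a * b) f) t - pre b (barD (pre a f)) t := by
        intro t; simp [pre, barD_cons]
      rw [barD_cons (pre a (barD f)) b c l]
      have h1 := ih (pre a f)
      rw [barD_cons] at h1
      have h2 : pre b (pre a (barD f)) = pre (a*b) f + -(pre b (barD (pre a f))) := by
        funext t; rw [key]; simp [sub_eq_add_neg]
      rw [h2, barD_add, barD_neg]
      rw [sub_eq_zero] at h1
      rw [← h1, barD_cons f]
      simp [pre, barD_cons, mul_assoc]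
      abel

theorem sgn_sgn (f : List A → M) : sgn (sgn f) = f := by
  funext l; simp only [sgn, smul_smul, ← mul_pow]; simp

theorem barD_sgn (f : List A → M) (l : List A) : barD (sgn f) l = - sgn (barD f) l := by
  simp only [barD, sgn, Finset.smul_sum, ← Finset.sum_neg_distrib]
  refine Finset.sum_congr rfl fun i hi => ?_
  have h := merge_length i l (by simpa using hi)
  rw [← h, pow_succ, smul_comm]
  simp

end Calculus
end Words

section TensorWords

variable (k : Type*) {A : Type*} [CommRing k] [Ring A] [Algebra k A]
  {H : Type*} [AddCommGroup H] [Module k H]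

/-- The element `a₁ ⊗ ⋯ ⊗ aₙ` of the tensor algebra `T(A)`. -/
def word (l : List A) : TensorAlgebra k A := (l.map (TensorAlgebra.ι k)).prod

theorem word_nil : word k ([] : List A) = 1 := by simp [word]

theorem word_cons (a : A) (l : List A) : word k (a :: l) = TensorAlgebra.ι k a * word k l := by
  simp [word]

theorem word_append (u v : List A) : word k (u ++ v) = word k u * word k v := by
  simp [word]

theorem isMultilinear_word : IsMultilinear k (word k : List A → TensorAlgebra k A) where
  add u v a b := by simp [word_append, word_cons, mul_add, add_mul]
  smul u v c a := by simp [word_append, word_cons]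

theorem span_word : Submodule.span k (Set.range (word k : List A → TensorAlgebra k A)) = ⊤ := by
  refine eq_top_iff.2 fun x _ => ?_
  induction x using TensorAlgebra.induction with
  | algebraMap r =>
    rw [Algebra.algebraMap_eq_smul_one, ← word_nil k (A := A)]
    exact Submodule.smul_mem _ _ (Submodule.subset_span ⟨_, rfl⟩)
  | ι a => exact Submodule.subset_span ⟨[a], by simp [word]⟩
  | mul x y hx hy =>
    have h := Submodule.mul_mem_mul (hx trivial) (hy trivial)
    rw [Submodule.span_mul_span] at h
    refine Submodule.span_mono ?_ h
    rintro _ ⟨_, ⟨u, rfl⟩, _, ⟨v, rfl⟩, rfl⟩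
    exact ⟨u ++ v, word_append k u v⟩
  | add x y hx hy => exact Submodule.add_mem _ (hx trivial) (hy trivial)

variable {k}

theorem words_ext {f g : TensorAlgebra k A →ₗ[k] H} (h : ∀ l, f (word k l) = g (word k l)) :
    f = g :=
  LinearMap.ext_on_range (span_word k) h

variable (k A H) in
/-- The `k`-module of multilinear functions on finite sequences. -/
def multi : Submodule k (List A → H) where
  carrier := {φ | IsMultilinear k φ}
  add_mem' {φ ψ} h h' :=
    ⟨fun u v a b => by simp only [Pi.add_apply, h.add, h'.add]; abel,
     fun u v c a => by simp [h.smul, h'.smul]⟩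
  zero_mem' := ⟨fun _ _ _ _ => by simp, fun _ _ _ _ => by simp⟩
  smul_mem' c φ h :=
    ⟨fun u v a b => by simp [h.add], fun u v c a => by simp [h.smul, smul_comm c]⟩

theorem isMultilinear_pre {φ : List A → H} (h : IsMultilinear k φ) (a : A) :
    IsMultilinear k (pre a φ) :=
  ⟨fun u v b c => h.add (a :: u) v b c, fun u v c b => h.smul (a :: u) v c b⟩

variable (k A H) in
/-- The operation `φ ↦ φ(a, -)` on multilinear functions. -/
def multiPre : A →ₗ[k] Module.End k (multi k A H) where
  toFun a :=
    { toFun := fun φ => ⟨pre a φ.1, isMultilinear_pre φ.2 a⟩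
      map_add' := fun _ _ => rfl
      map_smul' := fun _ _ => rfl }
  map_add' a b := by ext φ l; exact φ.2.add [] l a b
  map_smul' c a := by ext φ l; exact φ.2.smul [] l c a

/-- The linear map on `T(A)` with prescribed multilinear values on words. -/
def ofWords (φ : List A → H) (h : IsMultilinear k φ) : TensorAlgebra k A →ₗ[k] H where
  toFun c := ((TensorAlgebra.lift k
    ((MulOpposite.opLinearEquiv k).toLinearMap ∘ₗ multiPre k A H) c).unop ⟨φ, h⟩).1 []
  map_add' c c' := by simp
  map_smul' r c := by simp

theorem ofWords_word (φ : List A → H) (h : IsMultilinear k φ) (l : List A) :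
    ofWords φ h (word k l) = φ l := by
  induction l generalizing φ with
  | nil => simp [ofWords, word_nil]
  | cons a l ih =>
    have := ih (pre a φ) (isMultilinear_pre h a)
    simp only [pre] at this
    rw [← this]
    simp [ofWords, word_cons]
    rfl

end TensorWords

section Modules

variable (k : Type u) (A B : Type u) [CommRing k] [Ring A] [Algebra k A] [Ring B] [Algebra k B]

/-- A `ℤ`-graded right `B`-module (with its `k`-module structure coming from that of `B`). -/
structure GrMod where
  /-- the homogeneous components -/
  X : ℤ → Type u
  [acg : ∀ p, AddCommGroup (X p)]
  [modk : ∀ p, Module k (X p)]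
  [modB : ∀ p, Module Bᵐᵒᵖ (X p)]
  [tower : ∀ p, IsScalarTower k Bᵐᵒᵖ (X p)]

attribute [instance] GrMod.acg GrMod.modk GrMod.modB GrMod.tower

variable {k B}

/-- The total module `⨁ Xᵖ`. -/
abbrev GrMod.Tot (X : GrMod k B) : Type u := ⨁ p, X.X p

/-- The inclusion of the degree `p` component. -/
abbrev GrMod.inc (X : GrMod k B) (p : ℤ) : X.X p →ₗ[Bᵐᵒᵖ] X.Tot :=
  DirectSum.lof Bᵐᵒᵖ ℤ X.X p

/-- The projection to the degree `p` component. -/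
abbrev GrMod.proj (X : GrMod k B) (p : ℤ) : X.Tot →ₗ[Bᵐᵒᵖ] X.X p :=
  DirectSum.component Bᵐᵒᵖ ℤ X.X p

/-- The submodule of homogeneous elements of degree `p` of the total module. -/
def GrMod.deg (X : GrMod k B) (p : ℤ) : Submodule Bᵐᵒᵖ X.Tot := LinearMap.range (X.inc p)

theorem GrMod.inc_mem (X : GrMod k B) (p : ℤ) (x : X.X p) : X.inc p x ∈ X.deg p := ⟨x, rfl⟩

theorem GrMod.inc_proj (X : GrMod k B) (p : ℤ) (t : X.Tot) (h : t ∈ X.deg p) :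
    X.inc p (X.proj p t) = t := by
  obtain ⟨x, rfl⟩ := h
  simp [GrMod.inc, GrMod.proj, DirectSum.component.lof_self]

theorem GrMod.proj_inc (X : GrMod k B) (p : ℤ) (x : X.X p) : X.proj p (X.inc p x) = x :=
  DirectSum.component.lof_self ..

theorem GrMod.hom_ext (X : GrMod k B) {M : Type*} [AddCommGroup M] {f g : X.Tot →+ M}
    (h : ∀ p x, f (X.inc p x) = g (X.inc p x)) : f = g :=
  DirectSum.addHom_ext h

/-- A sequence of graded `B`-linear morphisms `fₙ₊₁ : A^{⊗n} ⊗ X → Y`, `n ≥ 0`, in the form of one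
`k`-linear map `T(A) → Hom_B(X, Y)`; the value on `a₁ ⊗ ⋯ ⊗ aₙ ∈ T(A)` is
`fₙ₊₁(a₁, …, aₙ, -)`. It is a graded morphism of degree `e` on `T(A[1]) ⊗ X` if each `fₙ₊₁` is
homogeneous of degree `e - n`. -/
abbrev Seq (X Y : GrMod k B) : Type u := TensorAlgebra k A →ₗ[k] (X.Tot →ₗ[Bᵐᵒᵖ] Y.Tot)

variable {A}

/-- `fₙ₊₁` is homogeneous of degree `e - n` for all `n ≥ 0`. -/
def Seq.IsHomogeneous {X Y : GrMod k B} (f : Seq A X Y) (e : ℤ) : Prop :=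
  ∀ (l : List A) (p : ℤ) (x : X.X p), f (word k l) (X.inc p x) ∈ Y.deg (p + e - l.length)

/-- The additive maps underlying a sequence. -/
def Seq.fn {X Y : GrMod k B} (f : Seq A X Y) (l : List A) : X.Tot →+ Y.Tot :=
  (f (word k l)).toAddMonoidHom

theorem Seq.ext_fn {X Y : GrMod k B} {f g : Seq A X Y} (h : ∀ l, f.fn l = g.fn l) : f = g :=
  words_ext fun l => LinearMap.toAddMonoidHom_injective (h l)

theorem isMultilinear_seq {X Y : GrMod k B} (f : Seq A X Y) :
    IsMultilinear k (fun l => f (word k l)) where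
  add u v a b := by rw [(isMultilinear_word k).add, map_add]
  smul u v c a := by rw [(isMultilinear_word k).smul, map_smul]

variable (k A B) in
/-- A strong homotopy `A`-module over `B`: a `ℤ`-graded `B`-module `X` with graded morphisms
`mₙ₊₁ : A^{⊗n} ⊗ X → X` of degree `1 - n`, `n ≥ 0`, satisfying Stasheff's identities. -/
structure ShMod extends GrMod k B where
  m : Seq A toGrMod toGrMod
  deg_m : m.IsHomogeneous 1
  rel : ∀ l : List A,
    ∑ i ∈ Finset.range (l.length - 1), (-1 : ℤ) ^ i • m (word k (merge i l)) +
    ∑ j ∈ Finset.range (l.length + 1),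
      (-1 : ℤ) ^ j • (m (word k (l.take j)) ∘ₗ m (word k (l.drop j))) = 0

/-- A morphism `f : X → Y` of strong homotopy modules: graded morphisms
`fₙ₊₁ : A^{⊗n} ⊗ X → Y` of degree `-n`, `n ≥ 0`, compatible with the actions. -/
@[ext]
structure ShHom (X Y : ShMod k A B) where
  f : Seq A X.toGrMod Y.toGrMod
  deg_f : f.IsHomogeneous 0
  rel : ∀ l : List A,
    ∑ j ∈ Finset.range (l.length + 1), Y.m (word k (l.take j)) ∘ₗ f (word k (l.drop j)) =
    ∑ i ∈ Finset.range (l.length - 1), (-1 : ℤ) ^ i • f (word k (merge i l)) +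
    ∑ j ∈ Finset.range (l.length + 1),
      (-1 : ℤ) ^ j • (f (word k (l.take j)) ∘ₗ X.m (word k (l.drop j)))

/-- `h` is a homotopy from `f` to `0`: graded morphisms `hₙ₊₁ : A^{⊗n} ⊗ X → Y` of degree
`-n - 1`, `n ≥ 0`, whose differential is `f`. -/
structure IsNullHomotopy {X Y : ShMod k A B} (f : Seq A X.toGrMod Y.toGrMod)
    (h : Seq A X.toGrMod Y.toGrMod) : Prop where
  deg_h : h.IsHomogeneous (-1)
  eq : ∀ l : List A, f (word k l) =
    ∑ j ∈ Finset.range (l.length + 1),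
      (-1 : ℤ) ^ j • (Y.m (word k (l.take j)) ∘ₗ h (word k (l.drop j))) +
    ∑ i ∈ Finset.range (l.length - 1), (-1 : ℤ) ^ i • h (word k (merge i l)) +
    ∑ j ∈ Finset.range (l.length + 1),
      (-1 : ℤ) ^ j • (h (word k (l.take j)) ∘ₗ X.m (word k (l.drop j)))

section Calculus

variable {X Y Z : GrMod k B}

theorem conv_fn (g : Seq A Y Z) (f : Seq A X Y) (l : List A) :
    conv g.fn f.fn l = (∑ j ∈ Finset.range (l.length + 1),
      g (word k (l.take j)) ∘ₗ f (word k (l.drop j))).toAddMonoidHom := by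
  refine AddMonoidHom.ext fun x => ?_
  simp [conv, Seq.fn, LinearMap.sum_apply]

theorem conv_sgn_fn (g : Seq A Y Z) (f : Seq A X Y) (l : List A) :
    conv (sgn g.fn) f.fn l = (∑ j ∈ Finset.range (l.length + 1),
      (-1 : ℤ) ^ j • (g (word k (l.take j)) ∘ₗ f (word k (l.drop j)))).toAddMonoidHom := by
  refine AddMonoidHom.ext fun x => ?_
  simp only [conv, sgn, AddMonoidHom.finsetSum_apply, LinearMap.toAddMonoidHom_coe,
    LinearMap.sum_apply]
  refine Finset.sum_congr rfl fun j hj => ?_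
  have : (l.take j).length = j := by
    simpa [Nat.lt_succ_iff] using hj
  rw [this]
  simp [Seq.fn]

theorem barD_fn (f : Seq A X Y) (l : List A) :
    barD f.fn l = (∑ i ∈ Finset.range (l.length - 1),
      (-1 : ℤ) ^ i • f (word k (merge i l))).toAddMonoidHom := by
  refine AddMonoidHom.ext fun x => ?_
  simp [barD, Seq.fn, LinearMap.sum_apply]

/-- The condition `rel` of `ShMod` in terms of `barD` and `conv`. -/
theorem ShMod.rel_iff (m : Seq A X X) (l : List A) :
    (∑ i ∈ Finset.range (l.length - 1), (-1 : ℤ) ^ i • m (word k (merge i l)) +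
    ∑ j ∈ Finset.range (l.length + 1),
      (-1 : ℤ) ^ j • (m (word k (l.take j)) ∘ₗ m (word k (l.drop j))) = 0) ↔
    barD m.fn l + conv (sgn m.fn) m.fn l = 0 := by
  rw [barD_fn, conv_sgn_fn, ← LinearMap.toAddMonoidHom_injective.eq_iff]
  rfl

/-- The condition `rel` of `ShHom` in terms of `barD` and `conv`. -/
theorem ShHom.rel_iff (mX : Seq A X X) (mY : Seq A Y Y) (f : Seq A X Y) (l : List A) :
    (∑ j ∈ Finset.range (l.length + 1), mY (word k (l.take j)) ∘ₗ f (word k (l.drop j)) =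
    ∑ i ∈ Finset.range (l.length - 1), (-1 : ℤ) ^ i • f (word k (merge i l)) +
    ∑ j ∈ Finset.range (l.length + 1),
      (-1 : ℤ) ^ j • (f (word k (l.take j)) ∘ₗ mX (word k (l.drop j)))) ↔
    conv mY.fn f.fn l = barD f.fn l + conv (sgn f.fn) mX.fn l := by
  rw [barD_fn, conv_sgn_fn, conv_fn, ← LinearMap.toAddMonoidHom_injective.eq_iff]
  rfl

theorem isMultilinear_conv {G F H : Type*} [AddCommGroup G] [Module k G] [AddCommGroup F]
    [Module k F] [AddCommGroup H] [Module k H] (β : G →ₗ[k] F →ₗ[k] H)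
    {g : List A → G} (hg : IsMultilinear k g) {f : List A → F} (hf : IsMultilinear k f) :
    IsMultilinear k (fun l => ∑ j ∈ Finset.range (l.length + 1),
      β (g (l.take j)) (f (l.drop j))) := by
  have hcons : ∀ (g : List A → G) (a : A) (l : List A),
      (∑ j ∈ Finset.range ((a :: l).length + 1), β (g ((a :: l).take j)) (f ((a :: l).drop j)))
      = ∑ j ∈ Finset.range (l.length + 1), β (pre a g (l.take j)) (f (l.drop j))
        + β (g []) (f (a :: l)) := by
    intro g a l
    rw [List.length_cons, Finset.sum_range_succ']
    simp [pre]
  constructor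
  · intro u v a b
    induction u generalizing g with
    | nil =>
      simp only [List.nil_append]
      rw [hcons, hcons, hcons]
      have h1 := hf.add [] v a b
      have h2 : pre (a + b) g = pre a g + pre b g := by
        funext t; exact hg.add [] t a b
      simp only [List.nil_append] at h1
      simp only [h1, h2, Pi.add_apply, map_add, LinearMap.add_apply, Finset.sum_add_distrib]
      abel
    | cons c u ih =>
      simp only [List.cons_append]
      rw [hcons, hcons, hcons]
      have h1 := hf.add (c :: u) v a b
      simp only [List.cons_append] at h1
      rw [ih (isMultilinear_pre hg c), h1, map_add]
      abel
  · intro u v r a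
    induction u generalizing g with
    | nil =>
      simp only [List.nil_append]
      rw [hcons, hcons]
      have h1 := hf.smul [] v r a
      have h2 : pre (r • a) g = r • pre a g := by
        funext t; exact hg.smul [] t r a
      simp only [List.nil_append] at h1
      simp only [h1, h2, Pi.smul_apply, map_smul, LinearMap.smul_apply, smul_add, Finset.smul_sum]
    | cons c u ih =>
      simp only [List.cons_append]
      rw [hcons, hcons]
      have h1 := hf.smul (c :: u) v r a
      simp only [List.cons_append] at h1
      rw [ih (isMultilinear_pre hg c), h1, smul_add, map_smul]

theorem isMultilinear_barD {H : Type*} [AddCommGroup H] [Module k H]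
    {f : List A → H} (hf : IsMultilinear k f) : IsMultilinear k (barD f) := by
  constructor
  · intro u v a b
    induction u generalizing f with
    | nil =>
      rcases v with _ | ⟨c, v⟩
      · simp [barD_single]
      · have h2 : pre (a + b) f = pre a f + pre b f := by
          funext t; exact hf.add [] t a b
        have h3 := hf.add [] v (a * c) (b * c)
        simp only [List.nil_append] at h3
        simp only [List.nil_append, barD_cons, h2, barD_add, add_mul, h3]
        abel
    | cons c u ih =>
      have h1 := ih (isMultilinear_pre hf c)
      rcases u with _ | ⟨d, u⟩
      · have h3 := hf.add [] v (c * a) (c * b)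
        simp only [List.nil_append] at h3 h1
        simp only [List.nil_append, List.cons_append, barD_cons, mul_add, h1, h3]
        abel
      · have h3 := hf.add ((c * d) :: u) v a b
        simp only [List.cons_append] at h3 h1
        simp only [List.cons_append, barD_cons _ c d, h1, h3]
        abel
  · intro u v r a
    induction u generalizing f with
    | nil =>
      rcases v with _ | ⟨c, v⟩
      · simp [barD_single]
      · have h2 : barD (pre (r • a) f) (c :: v) = r • barD (pre a f) (c :: v) := by
          have : pre (r • a) f = fun t => DistribSMul.toAddMonoidHom H r (pre a f t) := by
            funext t; exact hf.smul [] t r a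
          rw [this, barD_map]; rfl
        have h3 := hf.smul [] v r (a * c)
        simp only [List.nil_append] at h3
        simp only [List.nil_append, barD_cons, h2, smul_mul_assoc, h3, smul_sub]
    | cons c u ih =>
      have h1 := ih (isMultilinear_pre hf c)
      rcases u with _ | ⟨d, u⟩
      · have h3 := hf.smul [] v r (c * a)
        simp only [List.nil_append] at h3 h1
        simp only [List.nil_append, List.cons_append, barD_cons, mul_smul_comm, h1, h3, smul_sub]
      · have h3 := hf.smul ((c * d) :: u) v r a
        simp only [List.cons_append] at h3 h1
        simp only [List.cons_append, barD_cons _ c d, h1, h3, smul_sub]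

theorem isMultilinear_sgn {H : Type*} [AddCommGroup H] [Module k H]
    {f : List A → H} (hf : IsMultilinear k f) : IsMultilinear k (sgn f) where
  add u v a b := by simp [sgn, hf.add]
  smul u v c a := by simp [sgn, hf.smul, smul_comm c]

variable (X Y Z) in
/-- Composition of `B`-linear maps as a `k`-bilinear map. -/
def compBilin : (Y.Tot →ₗ[Bᵐᵒᵖ] Z.Tot) →ₗ[k] (X.Tot →ₗ[Bᵐᵒᵖ] Y.Tot) →ₗ[k]
    (X.Tot →ₗ[Bᵐᵒᵖ] Z.Tot) :=
  LinearMap.mk₂ k (fun g f => g ∘ₗ f) (fun _ _ _ => LinearMap.add_comp ..)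
    (fun _ _ _ => LinearMap.smul_comp ..) (fun _ _ _ => LinearMap.comp_add ..)
    (fun c g f => LinearMap.ext fun x => by
      simp only [LinearMap.comp_apply, LinearMap.smul_apply, LinearMap.map_smul_of_tower])

theorem isMultilinear_convSeq (g : Seq A Y Z) (f : Seq A X Y) :
    IsMultilinear k (fun l : List A => ∑ j ∈ Finset.range (l.length + 1),
      g (word k (l.take j)) ∘ₗ f (word k (l.drop j))) :=
  isMultilinear_conv (compBilin X Y Z) (isMultilinear_seq g) (isMultilinear_seq f)

/-- The composition of sequences:
`(a₁, …, aₙ) ↦ ∑ g(a₁, …, aⱼ, -) ∘ f(aⱼ₊₁, …, aₙ, -)`. -/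
def Seq.comp (g : Seq A Y Z) (f : Seq A X Y) : Seq A X Z :=
  ofWords (fun l => ∑ j ∈ Finset.range (l.length + 1),
      g (word k (l.take j)) ∘ₗ f (word k (l.drop j)))
    (isMultilinear_convSeq g f)

theorem Seq.comp_fn (g : Seq A Y Z) (f : Seq A X Y) : (g.comp f).fn = conv g.fn f.fn := by
  funext l
  rw [conv_fn, Seq.fn, Seq.comp, ofWords_word]

end Calculus


section Strict

variable {X Y Z : GrMod k B}

/-- The sequence `(F, 0, 0, …)`. -/
def strictFn {H : Type*} [Zero H] (F : H) : List A → H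
  | [] => F
  | _ :: _ => 0

theorem isMultilinear_strictFn {H : Type*} [AddCommGroup H] [Module k H] (F : H) :
    IsMultilinear k (strictFn F : List A → H) where
  add u v a b := by rcases u with _ | ⟨c, u⟩ <;> simp [strictFn]
  smul u v c a := by rcases u with _ | ⟨c, u⟩ <;> simp [strictFn]

/-- The sequence `(F, 0, 0, …)`. -/
def Seq.strict (F : X.Tot →ₗ[Bᵐᵒᵖ] Y.Tot) : Seq A X Y :=
  ofWords (strictFn F) (isMultilinear_strictFn F)

theorem Seq.strict_fn (F : X.Tot →ₗ[Bᵐᵒᵖ] Y.Tot) :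
    (Seq.strict F : Seq A X Y).fn = strictFn F.toAddMonoidHom := by
  funext l
  rw [Seq.fn, Seq.strict, ofWords_word]
  rcases l with _ | ⟨a, l⟩ <;> rfl

theorem pre_strictFn {H : Type*} [AddCommGroup H] (F : H) (a : A) :
    pre a (strictFn F) = 0 := rfl

theorem barD_zero {H : Type*} [AddCommGroup H] (l : List A) : barD (0 : List A → H) l = 0 := by
  simp [barD]

theorem barD_strictFn {H : Type*} [AddCommGroup H] (F : H) (l : List A) :
    barD (strictFn F) l = 0 := by
  rcases l with _ | ⟨a, _ | ⟨b, l⟩⟩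
  · exact barD_nil _
  · exact barD_single _ _
  · rw [barD_cons, pre_strictFn, barD_zero]; simp [strictFn]

theorem conv_zero_left {M N P : Type*} [AddCommGroup M] [AddCommGroup N] [AddCommGroup P]
    (f : List A → M →+ N) (l : List A) : conv (0 : List A → N →+ P) f l = 0 := by
  simp [conv]

theorem conv_strict_left {M N P : Type*} [AddCommGroup M] [AddCommGroup N] [AddCommGroup P]
    (F : N →+ P) (f : List A → M →+ N) (l : List A) :
    conv (strictFn F) f l = F.comp (f l) := by
  rcases l with _ | ⟨a, l⟩
  · rw [conv_nil]; rfl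
  · rw [conv_cons, pre_strictFn, conv_zero_left, add_zero]; rfl

theorem conv_strict_right {M N P : Type*} [AddCommGroup M] [AddCommGroup N] [AddCommGroup P]
    (g : List A → N →+ P) (F : M →+ N) (l : List A) :
    conv g (strictFn F) l = (g l).comp F := by
  induction l generalizing g with
  | nil => rw [conv_nil]; rfl
  | cons a l ih =>
    rw [conv_cons, ih]
    simp [strictFn, pre]

theorem sgn_strictFn {H : Type*} [AddCommGroup H] (F : H) :
    sgn (strictFn F : List A → H) = strictFn F := by
  funext l
  rcases l with _ | ⟨a, l⟩ <;> simp [sgn, strictFn]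

theorem Seq.IsHomogeneous.mem {f : Seq A X Y} {e : ℤ} (h : f.IsHomogeneous e) (l : List A)
    {p q : ℤ} {t : X.Tot} (ht : t ∈ X.deg p) (hq : p + e = q + l.length) :
    f (word k l) t ∈ Y.deg q := by
  obtain ⟨x, rfl⟩ := ht
  obtain rfl : q = p + e - l.length := by omega
  exact h l p x

theorem Seq.IsHomogeneous.comp {g : Seq A Y Z} {f : Seq A X Y} {e e' : ℤ}
    (hg : g.IsHomogeneous e) (hf : f.IsHomogeneous e') : (g.comp f).IsHomogeneous (e + e') := by
  intro l p x
  rw [Seq.comp, ofWords_word, LinearMap.sum_apply]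
  refine Submodule.sum_mem _ fun j hj => ?_
  have hj' : j ≤ l.length := by simpa [Nat.lt_succ_iff] using hj
  refine hg.mem _ (hf _ p x) ?_
  simp only [List.length_take, List.length_drop, min_eq_left hj', Nat.cast_sub hj']
  omega

theorem Seq.strict_homogeneous {F : X.Tot →ₗ[Bᵐᵒᵖ] Y.Tot} {e : ℤ}
    (h : ∀ p x, F (X.inc p x) ∈ Y.deg (p + e)) : (Seq.strict F : Seq A X Y).IsHomogeneous e := by
  intro l p x
  rw [Seq.strict, ofWords_word]
  rcases l with _ | ⟨a, l⟩
  · simpa [strictFn] using h p x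
  · exact Submodule.zero_mem _

end Strict

section Cat

theorem ShMod.rel' (X : ShMod k A B) (l : List A) :
    barD X.m.fn l + conv (sgn X.m.fn) X.m.fn l = 0 :=
  (ShMod.rel_iff _ _).1 (X.rel l)

theorem ShHom.rel' {X Y : ShMod k A B} (f : ShHom X Y) (l : List A) :
    conv Y.m.fn f.f.fn l = barD f.f.fn l + conv (sgn f.f.fn) X.m.fn l :=
  (ShHom.rel_iff _ _ _ _).1 (f.rel l)

/-- The identity morphism `(id, 0, 0, …)`. -/
def ShHom.id (X : ShMod k A B) : ShHom X X where
  f := Seq.strict LinearMap.id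
  deg_f := Seq.strict_homogeneous fun p x => by simpa using X.inc_mem p x
  rel l := by
    rw [ShHom.rel_iff, Seq.strict_fn, sgn_strictFn, conv_strict_left, conv_strict_right,
      barD_strictFn, zero_add]
    rfl

/-- The composition of morphisms of strong homotopy modules. -/
def ShHom.comp {X Y Z : ShMod k A B} (g : ShHom Y Z) (f : ShHom X Y) : ShHom X Z where
  f := g.f.comp f.f
  deg_f := g.deg_f.comp f.deg_f
  rel l := by
    rw [ShHom.rel_iff, Seq.comp_fn]
    have e1 : conv Z.m.fn g.f.fn = barD g.f.fn + conv (sgn g.f.fn) Y.m.fn :=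
      funext fun l => g.rel' l
    have e2 : conv Y.m.fn f.f.fn = barD f.f.fn + conv (sgn f.f.fn) X.m.fn :=
      funext fun l => f.rel' l
    have e3 : sgn (conv g.f.fn f.f.fn) = conv (sgn g.f.fn) (sgn f.f.fn) :=
      funext fun l => sgn_conv _ _ _
    rw [← conv_assoc, e1, conv_add_left, conv_assoc, e2, conv_add_right, barD_conv, e3,
      conv_assoc, add_assoc]

instance : Category (ShMod k A B) where
  Hom X Y := ShHom X Y
  id X := ShHom.id X
  comp f g := ShHom.comp g f
  id_comp f := ShHom.ext <| Seq.ext_fn fun l => by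
    change (Seq.comp f.f (Seq.strict LinearMap.id)).fn l = _
    rw [Seq.comp_fn, Seq.strict_fn, conv_strict_right]; rfl
  comp_id f := ShHom.ext <| Seq.ext_fn fun l => by
    change (Seq.comp (Seq.strict LinearMap.id) f.f).fn l = _
    rw [Seq.comp_fn, Seq.strict_fn, conv_strict_left]; rfl
  assoc f g h := ShHom.ext <| Seq.ext_fn fun l => by
    change (Seq.comp h.f (Seq.comp g.f f.f)).fn l = (Seq.comp (Seq.comp h.f g.f) f.f).fn l
    rw [Seq.comp_fn, Seq.comp_fn, Seq.comp_fn, Seq.comp_fn]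
    exact (conv_assoc _ _ _ _).symm

theorem ShMod.hom_ext {X Y : ShMod k A B} {f g : X ⟶ Y} (h : ∀ l, f.f.fn l = g.f.fn l) : f = g :=
  ShHom.ext (Seq.ext_fn h)

theorem ShMod.comp_fn {X Y Z : ShMod k A B} (f : X ⟶ Y) (g : Y ⟶ Z) :
    (f ≫ g).f.fn = conv g.f.fn f.f.fn := Seq.comp_fn _ _

theorem ShMod.id_fn (X : ShMod k A B) :
    (𝟙 X : X ⟶ X).f.fn = strictFn (AddMonoidHom.id X.Tot) := Seq.strict_fn _

variable (k A B) in
/-- Two morphisms are homotopic if their difference is nullhomotopic. -/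
def homotopic : HomRel (ShMod k A B) := fun _ _ f g => ∃ h, IsNullHomotopy (f.f - g.f) h

variable (k A B) in
/-- The homotopy category of strong homotopy modules. -/
abbrev HShMod : Type (u + 1) := CategoryTheory.Quotient (homotopic k A B)

theorem Seq.nil_proj_mem {X Y : GrMod k B} {f : Seq A X Y} {e : ℤ} (h : f.IsHomogeneous e)
    {p q : ℤ} (hq : p + e = q) (x : X.X p) :
    Y.inc q (Y.proj q (f (word k []) (X.inc p x))) = f (word k []) (X.inc p x) :=
  Y.inc_proj q _ (h.mem [] (X.inc_mem p x) (by simpa using hq))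

/-- The component `Xᵖ → Y^q` of `f₁`. -/
def Seq.comp₁ {X Y : GrMod k B} (f : Seq A X Y) (p q : ℤ) : X.X p →ₗ[Bᵐᵒᵖ] Y.X q :=
  Y.proj q ∘ₗ f (word k []) ∘ₗ X.inc p

theorem Seq.inc_comp₁ {X Y : GrMod k B} {f : Seq A X Y} {e : ℤ} (h : f.IsHomogeneous e)
    {p q : ℤ} (hq : p + e = q) (x : X.X p) :
    Y.inc q (f.comp₁ p q x) = f (word k []) (X.inc p x) :=
  Y.inc_proj q _ (h.mem [] (X.inc_mem p x) (by simpa using hq))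

theorem ShMod.m_m (X : ShMod k A B) (t : X.Tot) : X.m (word k []) (X.m (word k []) t) = 0 := by
  have h := X.rel []
  simp at h
  exact LinearMap.congr_fun h t

theorem ShMod.m_f {X Y : ShMod k A B} (f : X ⟶ Y) (t : X.Tot) :
    Y.m (word k []) (f.f (word k []) t) = f.f (word k []) (X.m (word k []) t) := by
  have h := f.rel []
  simp at h
  exact LinearMap.congr_fun h t

theorem GrMod.inc_injective (X : GrMod k B) (p : ℤ) : Function.Injective (X.inc p) :=
  Function.LeftInverse.injective (X.proj_inc p)

/-- The complex of right `B`-modules `(X, m₁)` underlying a strong homotopy module. -/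
def ShMod.cx (X : ShMod k A B) : CochainComplex (ModuleCat.{u} Bᵐᵒᵖ) ℤ where
  X p := ModuleCat.of Bᵐᵒᵖ (X.X p)
  d p q := if p + 1 = q then ModuleCat.ofHom (X.m.comp₁ p q) else 0
  shape p q h := if_neg h
  d_comp_d' p q r h h' := by
    have h : p + 1 = q := h
    have h' : q + 1 = r := h'
    rw [if_pos h, if_pos h']
    ext x
    apply X.inc_injective r
    simp [Seq.inc_comp₁ X.deg_m h', Seq.inc_comp₁ X.deg_m h, X.m_m]

/-- The morphism of complexes `f₁`. -/
def ShMod.cxMap {X Y : ShMod k A B} (f : X ⟶ Y) : X.cx ⟶ Y.cx where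
  f p := ModuleCat.ofHom (f.f.comp₁ p p)
  comm' p q h := by
    have h : p + 1 = q := h
    simp only [ShMod.cx, if_pos h]
    ext x
    apply Y.inc_injective q
    simp [Seq.inc_comp₁ X.deg_m h, Seq.inc_comp₁ Y.deg_m h,
      Seq.inc_comp₁ f.deg_f (add_zero p), Seq.inc_comp₁ f.deg_f (add_zero q), ShMod.m_f]

/-- `f` is a quasi-isomorphism if `f₁` is a quasi-isomorphism of complexes. -/
def ShMod.IsQis {X Y : ShMod k A B} (f : X ⟶ Y) : Prop := QuasiIso (ShMod.cxMap f)

variable (k A B) in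
/-- The class of quasi-isomorphisms in the homotopy category: the homotopy classes of
quasi-isomorphisms of strong homotopy modules. -/
def HShMod.qis : MorphismProperty (HShMod k A B) := fun X Y φ =>
  ∃ f : X.as ⟶ Y.as, ShMod.IsQis f ∧ (CategoryTheory.Quotient.functor (homotopic k A B)).map f = φ

variable (k A B) in
/-- The derived category of strong homotopy modules: the localization of the homotopy category
with respect to the quasi-isomorphisms. -/
abbrev DShMod : Type (u + 1) := (HShMod.qis k A B).Localization

variable (k A B) in
/-- The canonical functor from strong homotopy modules to their derived category. -/
def DShMod.Q : ShMod k A B ⥤ DShMod k A B :=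
  CategoryTheory.Quotient.functor (homotopic k A B) ⋙ (HShMod.qis k A B).Q

theorem DShMod.isIso_Q {X Y : ShMod k A B} (f : X ⟶ Y) (h : ShMod.IsQis f) :
    IsIso ((DShMod.Q k A B).map f) :=
  MorphismProperty.Q_inverts (HShMod.qis k A B) _ ⟨f, h, rfl⟩

end Cat

section Restriction

variable (k A B) in
/-- Complexes of `A`-`B`-bimodules (over `k`), i.e. of left modules over `A ⊗ Bᵒᵖ`. -/
abbrev BimodCx : Type (u + 1) := CochainComplex (ModuleCat.{u} (A ⊗[k] Bᵐᵒᵖ)) ℤ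

variable (k A B) in
/-- The ring morphism `Bᵒᵖ → A ⊗ Bᵒᵖ`, `b ↦ 1 ⊗ b`. -/
abbrev inclB : Bᵐᵒᵖ →+* A ⊗[k] Bᵐᵒᵖ :=
  (Algebra.TensorProduct.includeRight : Bᵐᵒᵖ →ₐ[k] A ⊗[k] Bᵐᵒᵖ).toRingHom

/-- The graded right `B`-module underlying a complex of `A`-`B`-bimodules. -/
def grUnderlying (Y : BimodCx k A B) : GrMod k B where
  X p := Y.X p
  acg p := inferInstance
  modk p := Module.compHom (Y.X p) (algebraMap k (A ⊗[k] Bᵐᵒᵖ))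
  modB p := Module.compHom (Y.X p) (inclB k A B)
  tower p :=
    letI := Module.compHom (Y.X p) (algebraMap k (A ⊗[k] Bᵐᵒᵖ))
    letI := Module.compHom (Y.X p) (inclB k A B)
    ⟨fun c b (y : Y.X p) => by
      change (inclB k A B (c • b)) • y = (algebraMap k (A ⊗[k] Bᵐᵒᵖ) c) • (inclB k A B b) • y
      rw [smul_smul, ← Algebra.smul_def]
      congr 1
      exact map_smul (Algebra.TensorProduct.includeRight : Bᵐᵒᵖ →ₐ[k] A ⊗[k] Bᵐᵒᵖ) c b⟩

theorem smulB_def (Y : BimodCx k A B) (p : ℤ) (b : Bᵐᵒᵖ) (y : (grUnderlying Y).X p) :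
    b • y = ((1 : A) ⊗ₜ[k] b • (id y : Y.X p) : Y.X p) := rfl

theorem smulk_def (Y : BimodCx k A B) (p : ℤ) (c : k) (y : (grUnderlying Y).X p) :
    c • y = (algebraMap k (A ⊗[k] Bᵐᵒᵖ) c • (id y : Y.X p) : Y.X p) := rfl

/-- A morphism of bimodules as a morphism of right `B`-modules. -/
def resLin {Y Z : BimodCx k A B} {p q : ℤ} (g : Y.X p ⟶ Z.X q) :
    (grUnderlying Y).X p →ₗ[Bᵐᵒᵖ] (grUnderlying Z).X q where
  toFun y := g.hom y
  map_add' := map_add g.hom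
  map_smul' _ _ := map_smul g.hom _ _

section BimodLemmas

variable {M : Type*} [AddCommGroup M] [Module (A ⊗[k] Bᵐᵒᵖ) M]

theorem smul_comm_AB (a : A) (b : Bᵐᵒᵖ) (y : M) :
    (a ⊗ₜ[k] (1 : Bᵐᵒᵖ)) • ((1 : A) ⊗ₜ[k] b) • y = ((1 : A) ⊗ₜ[k] b) • (a ⊗ₜ[k] (1 : Bᵐᵒᵖ)) • y := by
  simp only [smul_smul, Algebra.TensorProduct.tmul_mul_tmul, mul_one, one_mul]

theorem add_smul_A (a a' : A) (y : M) : ((a + a') ⊗ₜ[k] (1 : Bᵐᵒᵖ)) • y =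
    (a ⊗ₜ[k] (1 : Bᵐᵒᵖ)) • y + (a' ⊗ₜ[k] (1 : Bᵐᵒᵖ)) • y := by
  rw [TensorProduct.add_tmul, add_smul]

theorem smul_smul_A (c : k) (a : A) (y : M) : ((c • a) ⊗ₜ[k] (1 : Bᵐᵒᵖ)) • y =
    algebraMap k (A ⊗[k] Bᵐᵒᵖ) c • (a ⊗ₜ[k] (1 : Bᵐᵒᵖ)) • y := by
  rw [smul_smul, ← Algebra.smul_def, TensorProduct.smul_tmul']

theorem mul_smul_A (a a' : A) (y : M) : ((a * a') ⊗ₜ[k] (1 : Bᵐᵒᵖ)) • y =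
    (a ⊗ₜ[k] (1 : Bᵐᵒᵖ)) • (a' ⊗ₜ[k] (1 : Bᵐᵒᵖ)) • y := by
  rw [smul_smul, Algebra.TensorProduct.tmul_mul_tmul, mul_one]

end BimodLemmas

/-- The left multiplication by `a` on the components of a complex of bimodules. -/
def actLin (Y : BimodCx k A B) (p : ℤ) :
    A →ₗ[k] ((grUnderlying Y).X p →ₗ[Bᵐᵒᵖ] (grUnderlying Y).X p) where
  toFun a :=
    { toFun := fun y => ((a ⊗ₜ[k] (1 : Bᵐᵒᵖ)) • (id y : Y.X p) : Y.X p)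
      map_add' := fun y z => smul_add (A := Y.X p) _ y z
      map_smul' := smul_comm_AB (M := Y.X p) a }
  map_add' a a' := LinearMap.ext fun y => add_smul_A (M := Y.X p) a a' y
  map_smul' c a := LinearMap.ext fun y => smul_smul_A (M := Y.X p) c a y

/-- The differential on the total module. -/
def totD (Y : BimodCx k A B) : (grUnderlying Y).Tot →ₗ[Bᵐᵒᵖ] (grUnderlying Y).Tot :=
  DirectSum.toModule Bᵐᵒᵖ ℤ _ fun p => (grUnderlying Y).inc (p + 1) ∘ₗ resLin (Y.d p (p + 1))

/-- The left multiplication by `a` on the total module. -/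
def totAct (Y : BimodCx k A B) (a : A) : (grUnderlying Y).Tot →ₗ[Bᵐᵒᵖ] (grUnderlying Y).Tot :=
  DirectSum.toModule Bᵐᵒᵖ ℤ _ fun p => (grUnderlying Y).inc p ∘ₗ actLin Y p a

/-- A morphism of complexes on total modules. -/
def totMap {Y Z : BimodCx k A B} (g : Y ⟶ Z) :
    (grUnderlying Y).Tot →ₗ[Bᵐᵒᵖ] (grUnderlying Z).Tot :=
  DirectSum.toModule Bᵐᵒᵖ ℤ _ fun p => (grUnderlying Z).inc p ∘ₗ resLin (g.f p)

theorem totD_inc (Y : BimodCx k A B) (p : ℤ) (y : (grUnderlying Y).X p) :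
    totD Y ((grUnderlying Y).inc p y) =
      (grUnderlying Y).inc (p + 1) (resLin (Y.d p (p + 1)) y) := by
  simp only [totD, GrMod.inc, DirectSum.toModule_lof, LinearMap.comp_apply]

theorem totAct_inc (Y : BimodCx k A B) (a : A) (p : ℤ) (y : (grUnderlying Y).X p) :
    totAct Y a ((grUnderlying Y).inc p y) = (grUnderlying Y).inc p (actLin Y p a y) := by
  simp only [totAct, GrMod.inc, DirectSum.toModule_lof, LinearMap.comp_apply]

theorem totMap_inc {Y Z : BimodCx k A B} (g : Y ⟶ Z) (p : ℤ) (y : (grUnderlying Y).X p) :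
    totMap g ((grUnderlying Y).inc p y) = (grUnderlying Z).inc p (resLin (g.f p) y) := by
  simp only [totMap, GrMod.inc, DirectSum.toModule_lof, LinearMap.comp_apply]

theorem GrMod.lin_ext {X Y : GrMod k B} {f g : X.Tot →ₗ[Bᵐᵒᵖ] Y.Tot}
    (h : ∀ p x, f (X.inc p x) = g (X.inc p x)) : f = g :=
  LinearMap.toAddMonoidHom_injective (X.hom_ext h)

/-- The action `m₁ = d`, `m₂(a, y) = a y`, `mₙ = 0` for `n ≥ 3`. -/
def actFn (Y : BimodCx k A B) : List A → ((grUnderlying Y).Tot →ₗ[Bᵐᵒᵖ] (grUnderlying Y).Tot)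
  | [] => totD Y
  | [a] => totAct Y a
  | _ :: _ :: _ => 0

theorem isMultilinear_actFn (Y : BimodCx k A B) : IsMultilinear k (actFn Y) where
  add u v a b := by
    rcases u with _ | ⟨c, _ | ⟨d, u⟩⟩ <;> rcases v with _ | ⟨e, v⟩ <;> simp [actFn]
    refine GrMod.lin_ext fun p y => ?_
    simp only [LinearMap.add_apply, totAct_inc, map_add]
  smul u v r a := by
    rcases u with _ | ⟨c, _ | ⟨d, u⟩⟩ <;> rcases v with _ | ⟨e, v⟩ <;> simp [actFn]
    refine GrMod.lin_ext fun p y => ?_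
    simp only [LinearMap.smul_apply, totAct_inc, map_smul, LinearMap.map_smul_of_tower]

/-- The strict action as a sequence. -/
def actSeq (Y : BimodCx k A B) : Seq A (grUnderlying Y) (grUnderlying Y) :=
  ofWords (actFn Y) (isMultilinear_actFn Y)

theorem actSeq_word (Y : BimodCx k A B) (l : List A) : actSeq Y (word k l) = actFn Y l :=
  ofWords_word _ _ _

theorem actSeq_nil (Y : BimodCx k A B) : (actSeq Y).fn [] = (totD Y).toAddMonoidHom := by
  simp only [Seq.fn, actSeq_word, actFn]

theorem pre_actSeq (Y : BimodCx k A B) (a : A) :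
    pre a (actSeq Y).fn = strictFn (totAct Y a).toAddMonoidHom := by
  funext l
  rcases l with _ | ⟨b, l⟩
  · simp only [pre, Seq.fn, actSeq_word, actFn, strictFn]
  · simp only [pre, Seq.fn, actSeq_word, actFn, strictFn]; rfl

theorem totD_totD (Y : BimodCx k A B) (t) : totD Y (totD Y t) = 0 := by
  suffices totD Y ∘ₗ totD Y = 0 from LinearMap.congr_fun this t
  refine GrMod.lin_ext fun p y => ?_
  rw [LinearMap.comp_apply, totD_inc, totD_inc]
  have : resLin (Y.d (p + 1) (p + 1 + 1)) (resLin (Y.d p (p + 1)) y) = 0 := by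
    change (Y.d p (p + 1) ≫ Y.d (p + 1) (p + 1 + 1)).hom y = 0
    rw [Y.d_comp_d]; rfl
  rw [this, map_zero, LinearMap.zero_apply]

theorem totD_totAct (Y : BimodCx k A B) (a : A) (t) :
    totD Y (totAct Y a t) = totAct Y a (totD Y t) := by
  suffices totD Y ∘ₗ totAct Y a = totAct Y a ∘ₗ totD Y from LinearMap.congr_fun this t
  refine GrMod.lin_ext fun p y => ?_
  rw [LinearMap.comp_apply, LinearMap.comp_apply, totD_inc, totAct_inc, totD_inc, totAct_inc]
  congr 1
  exact map_smul (Y.d p (p + 1)).hom _ _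

theorem totAct_mul (Y : BimodCx k A B) (a b : A) (t) :
    totAct Y (a * b) t = totAct Y a (totAct Y b t) := by
  suffices totAct Y (a * b) = totAct Y a ∘ₗ totAct Y b from LinearMap.congr_fun this t
  refine GrMod.lin_ext fun p y => ?_
  rw [LinearMap.comp_apply, totAct_inc, totAct_inc, totAct_inc]
  congr 1
  exact mul_smul_A (M := Y.X p) a b y

theorem totMap_totD {Y Z : BimodCx k A B} (g : Y ⟶ Z) (t) :
    totMap g (totD Y t) = totD Z (totMap g t) := by
  suffices totMap g ∘ₗ totD Y = totD Z ∘ₗ totMap g from LinearMap.congr_fun this t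
  refine GrMod.lin_ext fun p y => ?_
  rw [LinearMap.comp_apply, LinearMap.comp_apply, totD_inc, totMap_inc, totMap_inc, totD_inc]
  congr 1
  change (Y.d p (p + 1) ≫ g.f (p + 1)).hom y = (g.f p ≫ Z.d p (p + 1)).hom y
  rw [g.comm]

theorem totMap_totAct {Y Z : BimodCx k A B} (g : Y ⟶ Z) (a : A) (t) :
    totMap g (totAct Y a t) = totAct Z a (totMap g t) := by
  suffices totMap g ∘ₗ totAct Y a = totAct Z a ∘ₗ totMap g from LinearMap.congr_fun this t
  refine GrMod.lin_ext fun p y => ?_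
  rw [LinearMap.comp_apply, LinearMap.comp_apply, totAct_inc, totMap_inc, totMap_inc, totAct_inc]
  congr 1
  exact map_smul (g.f p).hom _ _

theorem conv_actSeq_cons {M : Type*} [AddCommGroup M] (Y : BimodCx k A B)
    (f : List A → M →+ (grUnderlying Y).Tot) (a : A) (l : List A) :
    conv (actSeq Y).fn f (a :: l) = (totD Y).toAddMonoidHom.comp (f (a :: l)) +
      (totAct Y a).toAddMonoidHom.comp (f l) := by
  rw [conv_cons, pre_actSeq, conv_strict_left, actSeq_nil]

/-- The strong homotopy module underlying a complex of bimodules. -/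
def Robj (Y : BimodCx k A B) : ShMod k A B where
  toGrMod := grUnderlying Y
  m := actSeq Y
  deg_m l p y := by
    rw [actSeq_word]
    rcases l with _ | ⟨a, _ | ⟨b, l⟩⟩
    · simp only [actFn, totD_inc, List.length_nil, Nat.cast_zero, sub_zero]
      exact GrMod.inc_mem _ _ _
    · simp only [actFn, totAct_inc, List.length_cons, List.length_nil,
        zero_add, Nat.cast_one, add_sub_cancel_right]
      exact GrMod.inc_mem _ _ _
    · exact Submodule.zero_mem _
  rel l := by
    rw [ShMod.rel_iff]
    rcases l with _ | ⟨a, l⟩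
    · rw [barD_nil, conv_nil, zero_add]
      refine AddMonoidHom.ext fun t => ?_
      simp only [sgn, List.length_nil, pow_zero, one_smul, actSeq_nil]
      exact totD_totD Y t
    · have h1 : conv (sgn (actSeq Y).fn) (actSeq Y).fn (a :: l) =
          (totD Y).toAddMonoidHom.comp ((actSeq Y).fn (a :: l)) -
            (totAct Y a).toAddMonoidHom.comp ((actSeq Y).fn l) := by
        rw [conv_cons, pre_sgn, conv_neg_left, pre_actSeq, sgn_strictFn, conv_strict_left]
        simp only [sgn, List.length_nil, pow_zero, one_smul, actSeq_nil, sub_eq_add_neg]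
      rw [h1]
      rcases l with _ | ⟨b, l⟩
      · rw [barD_single, zero_add]
        refine AddMonoidHom.ext fun t => ?_
        simp only [Seq.fn, actSeq_word, actFn]
        exact sub_eq_zero.2 (totD_totAct Y a t)
      · rw [barD_cons, pre_actSeq, barD_strictFn, sub_zero]
        refine AddMonoidHom.ext fun t => ?_
        rcases l with _ | ⟨c, l⟩
        · simp only [Seq.fn, actSeq_word, actFn]
          change totAct Y (a * b) t + (totD Y 0 - totAct Y a (totAct Y b t)) = 0
          rw [totAct_mul]; simp
        · simp only [Seq.fn, actSeq_word, actFn]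
          change (0 : (grUnderlying Y).Tot) + (totD Y 0 - totAct Y a 0) = 0
          simp

theorem totMap_homogeneous {Y Z : BimodCx k A B} (g : Y ⟶ Z) :
    (Seq.strict (totMap g) : Seq A _ _).IsHomogeneous 0 :=
  Seq.strict_homogeneous fun p y => by
    rw [add_zero, totMap_inc]; exact GrMod.inc_mem _ _ _

theorem totMap_rel {Y Z : BimodCx k A B} (g : Y ⟶ Z) (l : List A) :
    conv (actSeq Z).fn (Seq.strict (totMap g)).fn l = barD (Seq.strict (totMap g)).fn l +
      conv (sgn (Seq.strict (totMap g)).fn) (actSeq Y).fn l := by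
  rw [Seq.strict_fn, sgn_strictFn, conv_strict_left, conv_strict_right, barD_strictFn, zero_add]
  refine AddMonoidHom.ext fun t => ?_
  change actSeq Z (word k l) (totMap g t) = totMap g (actSeq Y (word k l) t)
  rw [actSeq_word, actSeq_word]
  rcases l with _ | ⟨a, _ | ⟨b, l⟩⟩
  · exact (totMap_totD g t).symm
  · exact (totMap_totAct g a t).symm
  · simp [actFn]

/-- A morphism of complexes of bimodules as a morphism of strong homotopy modules. -/
def Rmap {Y Z : BimodCx k A B} (g : Y ⟶ Z) : Robj Y ⟶ Robj Z where
  f := Seq.strict (totMap g)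
  deg_f := totMap_homogeneous g
  rel l := (ShHom.rel_iff _ _ _ _).2 (totMap_rel g l)

variable (k A B) in
/-- The functor `R` from complexes of bimodules to strong homotopy modules. -/
def R : BimodCx k A B ⥤ ShMod k A B where
  obj Y := Robj Y
  map g := Rmap g
  map_id Y := ShMod.hom_ext fun l => by
    rw [ShMod.id_fn]
    change (Seq.strict (totMap (𝟙 Y))).fn l = _
    rw [Seq.strict_fn]
    congr 1
    refine GrMod.hom_ext _ fun p y => ?_
    exact totMap_inc (𝟙 Y) p y
  map_comp g h := ShMod.hom_ext fun l => by
    rw [ShMod.comp_fn]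
    change (Seq.strict (totMap (g ≫ h))).fn l = conv (Seq.strict (totMap h)).fn
      (Seq.strict (totMap g)).fn l
    rw [Seq.strict_fn, Seq.strict_fn, Seq.strict_fn, conv_strict_left]
    rcases l with _ | ⟨a, l⟩
    · refine GrMod.hom_ext _ fun p y => ?_
      change totMap (g ≫ h) (GrMod.inc _ p y) = totMap h (totMap g (GrMod.inc _ p y))
      rw [totMap_inc, totMap_inc, totMap_inc]; rfl
    · simp [strictFn]

variable (k A B) in
/-- Restriction to `B`, on complexes. -/
abbrev resB : BimodCx k A B ⥤ CochainComplex (ModuleCat.{u} Bᵐᵒᵖ) ℤ :=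
  (ModuleCat.restrictScalars (inclB k A B)).mapHomologicalComplex (ComplexShape.up ℤ)

/-- The complex of `B`-modules underlying `R Y` is the restriction of `Y`. -/
def cxRIso (Y : BimodCx k A B) : (R k A B |>.obj Y).cx ≅ (resB k A B).obj Y :=
  HomologicalComplex.Hom.isoOfComponents (fun _ => Iso.refl _) (fun p q h => by
    have h : p + 1 = q := h
    subst h
    simp only [ShMod.cx, Iso.refl_hom]
    ext y
    change (Y.d p (p + 1)).hom y = _
    apply GrMod.inc_injective (grUnderlying Y) (p + 1)
    exact (totD_inc Y p y).symm.trans ((congrArg (fun F => F ((grUnderlying Y).inc p y))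
      (actSeq_word Y ([] : List A)).symm).trans
      (Seq.inc_comp₁ (Robj Y).deg_m rfl y).symm))

theorem restrictScalars_preservesHomology {S T : Type u} [Ring S] [Ring T] (f : S →+* T) :
    (ModuleCat.restrictScalars.{u} f).PreservesHomology := by
  have h := ((CategoryTheory.Functor.exact_tfae (ModuleCat.restrictScalars.{u} f)).out 1 2).mp
    (fun S h => by
      rw [CategoryTheory.ShortComplex.ShortExact.moduleCat_exact_iff_function_exact] at h ⊢
      exact h)
  exact h

theorem isQis_R {Y Z : BimodCx k A B} (g : Y ⟶ Z) [QuasiIso g] :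
    ShMod.IsQis ((R k A B).map g) := by
  have e : ShMod.cxMap ((R k A B).map g) ≫ (cxRIso Z).hom =
      (cxRIso Y).hom ≫ (resB k A B).map g := by
    ext p y
    apply GrMod.inc_injective (grUnderlying Z) p
    refine (Seq.inc_comp₁ ((R k A B).map g).deg_f (add_zero p) y).trans ?_
    refine Eq.trans ?_ (totMap_inc g p y)
    change (Seq.strict (totMap g) : Seq A _ _) (word k []) _ = _
    rw [Seq.strict, ofWords_word]; rfl
  have := restrictScalars_preservesHomology (inclB k A B)
  have h : QuasiIso ((resB k A B).map g) := inferInstance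
  exact (quasiIso_iff_of_arrow_mk_iso (ShMod.cxMap ((R k A B).map g)) ((resB k A B).map g)
    (Arrow.isoMk (cxRIso Y) (cxRIso Z) e.symm)).2 h

variable (k A B) in
theorem R_inverts : (HomologicalComplex.quasiIso (ModuleCat.{u} (A ⊗[k] Bᵐᵒᵖ))
    (ComplexShape.up ℤ)).IsInvertedBy (R k A B ⋙ DShMod.Q k A B) := fun _ _ g hg =>
  have : QuasiIso g := hg
  DShMod.isIso_Q _ (isQis_R g)

variable (k A B) in
/-- The functor induced by `R` between the derived categories. -/
def derivedR [HasDerivedCategory.{w} (ModuleCat.{u} (A ⊗[k] Bᵐᵒᵖ))] :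
    DerivedCategory (ModuleCat.{u} (A ⊗[k] Bᵐᵒᵖ)) ⥤ DShMod k A B :=
  Localization.lift (R k A B ⋙ DShMod.Q k A B) (R_inverts k A B) DerivedCategory.Q

variable (k A B) in
/-- The isomorphism expressing that `derivedR` is induced by `R`. -/
def derivedRIso [HasDerivedCategory.{w} (ModuleCat.{u} (A ⊗[k] Bᵐᵒᵖ))] :
    DerivedCategory.Q ⋙ derivedR k A B ≅ R k A B ⋙ DShMod.Q k A B :=
  Localization.fac (R k A B ⋙ DShMod.Q k A B) (R_inverts k A B) DerivedCategory.Q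

end Restriction

section LeftAdjoint

/-- The module `A ⊗ T(A) ⊗ X`. -/
abbrev LT₀ (A : Type u) [Ring A] [Algebra k A] (X : GrMod k B) : Type u :=
  A ⊗[k] (TensorAlgebra k A ⊗[k] X.Tot)

variable (X Y Z : GrMod k B)

/-- The action of `A` on the left factor. -/
def LT₀.algA : A →ₐ[k] Module.End k (LT₀ A X) :=
  AlgHom.ofLinearMap
    ((LinearMap.rTensorHom (R := k) (N := A) (P := A) (TensorAlgebra k A ⊗[k] X.Tot)) ∘ₗ
      LinearMap.mul k A)
    (TensorProduct.ext' fun a t => by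
      change (1 * a) ⊗ₜ[k] t = a ⊗ₜ[k] t
      rw [one_mul])
    (fun a b => TensorProduct.ext' fun c t => by
      change (a * b * c) ⊗ₜ[k] t = (a * (b * c)) ⊗ₜ[k] t
      rw [mul_assoc])

/-- The right action of `B` on the right factor. -/
def LT₀.algB : Bᵐᵒᵖ →ₐ[k] Module.End k (LT₀ A X) :=
  AlgHom.ofLinearMap
    ((LinearMap.lTensorHom (R := k) (N := TensorAlgebra k A ⊗[k] X.Tot)
        (P := TensorAlgebra k A ⊗[k] X.Tot) A) ∘ₗ
      (LinearMap.lTensorHom (R := k) (N := X.Tot) (P := X.Tot) (TensorAlgebra k A)) ∘ₗ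
      (Algebra.lsmul k k X.Tot : Bᵐᵒᵖ →ₐ[k] Module.End k X.Tot).toLinearMap)
    (by
      simp only [LinearMap.comp_apply, AlgHom.toLinearMap_apply, map_one]
      refine TensorProduct.ext' fun a t => ?_
      change a ⊗ₜ[k] (LinearMap.lTensor _ LinearMap.id t) = a ⊗ₜ[k] t
      rw [LinearMap.lTensor_id, LinearMap.id_apply])
    (fun b c => by
      simp only [LinearMap.comp_apply, AlgHom.toLinearMap_apply, map_mul]
      refine TensorProduct.ext' fun a t => ?_
      change a ⊗ₜ[k] (LinearMap.lTensor _ (_ ∘ₗ _) t) = a ⊗ₜ[k] (LinearMap.lTensor _ _ (LinearMap.lTensor _ _ t))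
      rw [LinearMap.lTensor_comp]; rfl)

theorem LT₀.algA_algB (a : A) (b : Bᵐᵒᵖ) : Commute (LT₀.algA X a) (LT₀.algB X b) :=
  TensorProduct.ext' fun _ _ => rfl

/-- The element `a ⊗ c ⊗ x`. -/
def LT₀.elt : A →ₗ[k] TensorAlgebra k A →ₗ[k] X.Tot →ₗ[k] LT₀ A X :=
  LinearMap.mk₂ k (fun a c => TensorProduct.mk k A (TensorAlgebra k A ⊗[k] X.Tot) a ∘ₗ
      TensorProduct.mk k (TensorAlgebra k A) X.Tot c)
    (fun a b c => by rw [map_add, LinearMap.add_comp])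
    (fun r a c => by rw [map_smul, LinearMap.smul_comp])
    (fun a c d => by rw [map_add, LinearMap.comp_add])
    (fun r a c => by rw [map_smul, LinearMap.comp_smul])

variable (A) in
/-- The module `A ⊗ T(A) ⊗ X`, the `A`-`B`-bimodule underlying `L X`. -/
def LT : Type u := LT₀ A X

instance : AddCommGroup (LT A X) := inferInstanceAs (AddCommGroup (LT₀ A X))

instance : Module k (LT A X) := inferInstanceAs (Module k (LT₀ A X))

/-- The element `a ⊗ c ⊗ x`. -/
def LT.elt : A →ₗ[k] TensorAlgebra k A →ₗ[k] X.Tot →ₗ[k] LT A X := LT₀.elt X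

variable (A) in
/-- The representation of `A ⊗ Bᵒᵖ` on `A ⊗ T(A) ⊗ X`. -/
def LT.alg : A ⊗[k] Bᵐᵒᵖ →ₐ[k] Module.End k (LT A X) :=
  (Algebra.TensorProduct.lift (LT₀.algA X) (LT₀.algB X) (LT₀.algA_algB X) :
    A ⊗[k] Bᵐᵒᵖ →ₐ[k] Module.End k (LT₀ A X))

/-- The bimodule structure of `A ⊗ T(A) ⊗ X`: `A` acts on the first factor and `B` on the
last one. -/
instance : Module (A ⊗[k] Bᵐᵒᵖ) (LT A X) := Module.compHom (LT A X) (LT.alg A X).toRingHom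

variable {X Y Z}

theorem LT.smul_def (s : A ⊗[k] Bᵐᵒᵖ) (t : LT A X) : s • t = LT.alg A X s t := rfl

theorem LT.tmul_smul_elt (a : A) (b : Bᵐᵒᵖ) (a₀ : A) (c : TensorAlgebra k A) (x : X.Tot) :
    (a ⊗ₜ[k] b) • LT.elt X a₀ c x = LT.elt X (a * a₀) c (b • x) := by
  have : LT.alg A X (a ⊗ₜ[k] b) = (LT₀.algA X a * LT₀.algB X b : Module.End k (LT₀ A X)) :=
    Algebra.TensorProduct.lift_tmul _ _ (LT₀.algA_algB X) a b
  rw [LT.smul_def, this]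
  rfl

theorem LT.algebraMap_smul (r : k) (t : LT A X) :
    algebraMap k (A ⊗[k] Bᵐᵒᵖ) r • t = r • t := by
  rw [LT.smul_def, AlgHom.commutes]
  rfl

instance : IsScalarTower k (A ⊗[k] Bᵐᵒᵖ) (LT A X) where
  smul_assoc r s t := by
    rw [← LT.algebraMap_smul r (s • t), ← mul_smul]
    exact congrArg (fun u => u • t) (Algebra.smul_def r s)

/-- Two additive maps on `A ⊗ T(A) ⊗ X` agree if they agree on `a ⊗ (a₁ ⊗ ⋯ ⊗ aₙ) ⊗ x`. -/
theorem LT.add_ext {M : Type*} [AddCommGroup M] {f g : LT A X →+ M}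
    (h : ∀ a l x, f (LT.elt X a (word k l) x) = g (LT.elt X a (word k l) x)) : f = g := by
  have h' : ∀ (c : TensorAlgebra k A), ∀ a x, f (LT.elt X a c x) = g (LT.elt X a c x) := by
    intro c
    have hc : c ∈ Submodule.span k (Set.range (word k : List A → TensorAlgebra k A)) := by
      rw [span_word]; trivial
    induction hc using Submodule.span_induction with
    | mem c hc => obtain ⟨l, rfl⟩ := hc; exact fun a x => h a l x
    | zero => intro a x; simp
    | add c d _ _ hc hd => intro a x; simp [hc a x, hd a x]
    | smul r c _ hc =>
      intro a x
      have := hc a (r • x)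
      simpa using this
  refine AddMonoidHom.ext fun (t : LT₀ A X) => ?_
  induction t using TensorProduct.induction_on with
  | zero => exact (map_zero f).trans (map_zero g).symm
  | add t s ht hs => exact (map_add f t s).trans ((congrArg₂ _ ht hs).trans (map_add g t s).symm)
  | tmul a s =>
    induction s using TensorProduct.induction_on with
    | zero => rw [TensorProduct.tmul_zero]; exact (map_zero f).trans (map_zero g).symm
    | tmul c x => exact h' c a x
    | add t s ht hs =>
      rw [TensorProduct.tmul_add]
      exact (map_add f _ _).trans ((congrArg₂ _ ht hs).trans (map_add g _ _).symm)

/-- `E a (a₁, …, aₙ) x = a ⊗ (a₁ ⊗ ⋯ ⊗ aₙ) ⊗ x`. -/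
def LT.E (X : GrMod k B) (a : A) (l : List A) : X.Tot →+ LT A X :=
  (LT.elt X a (word k l)).toAddMonoidHom

/-- The linear map on `A ⊗ T(A) ⊗ X` given by a multilinear function on words. -/
def LT.ofWords (φ : List A → (A →ₗ[k] X.Tot →ₗ[k] LT A Y)) (h : IsMultilinear k φ) :
    LT A X →ₗ[k] LT A Y :=
  (TensorProduct.lift ((TensorProduct.uncurry (RingHom.id k) (TensorAlgebra k A) X.Tot (LT A Y)) ∘ₗ
    (ShAct.ofWords φ h).flip) : LT₀ A X →ₗ[k] LT A Y)

theorem LT.ofWords_E (φ : List A → (A →ₗ[k] X.Tot →ₗ[k] LT A Y)) (h : IsMultilinear k φ) (a : A)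
    (l : List A) (x : X.Tot) : LT.ofWords φ h (LT.E X a l x) = φ l a x := by
  change ShAct.ofWords φ h (word k l) a x = _
  rw [ShAct.ofWords_word]

end LeftAdjoint

section LeftAdjointFunctor

variable {X Y Z : GrMod k B}

theorem LT.E_apply (a : A) (l : List A) (x : X.Tot) : LT.E X a l x = LT.elt X a (word k l) x := rfl

theorem LT.hom_ext {M : Type*} [AddCommGroup M] {f g : LT A X →+ M}
    (h : ∀ a l, f.comp (LT.E X a l) = g.comp (LT.E X a l)) : f = g :=
  LT.add_ext fun a l x => DFunLike.congr_fun (h a l) x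

variable (A X) in
/-- The function `l ↦ (a ↦ x ↦ a ⊗ l ⊗ x)`. -/
def LT.W (l : List A) : A →ₗ[k] X.Tot →ₗ[k] LT A X := (LT.elt X).flip (word k l)

theorem LT.isMultilinear_W : IsMultilinear k (LT.W A X) where
  add u v a b := by simp only [LT.W]; rw [(isMultilinear_word k).add, map_add]
  smul u v c a := by simp only [LT.W]; rw [(isMultilinear_word k).smul, map_smul]

/-- The function `(a₁, …, aₙ) ↦ (a₀ ↦ x ↦ a₀ a₁ ⊗ (a₂, …, aₙ) ⊗ x)`. -/
def LT.tau : List A → (A →ₗ[k] X.Tot →ₗ[k] LT A X)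
  | [] => 0
  | a :: l => LT.W A X l ∘ₗ LinearMap.mulRight k a

theorem LT.isMultilinear_tau :
    IsMultilinear k (LT.tau : List A → (A →ₗ[k] X.Tot →ₗ[k] LT A X)) where
  add u v a b := by
    rcases u with _ | ⟨c, u⟩
    · refine LinearMap.ext fun a₀ => ?_
      simp [LT.tau, mul_add]
    · simp only [List.cons_append, LT.tau]
      rw [LT.isMultilinear_W.add, LinearMap.add_comp]
  smul u v r a := by
    rcases u with _ | ⟨c, u⟩
    · refine LinearMap.ext fun a₀ => ?_
      simp [LT.tau]
    · simp only [List.cons_append, LT.tau]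
      rw [LT.isMultilinear_W.smul, LinearMap.smul_comp]

variable (A X Y) in
/-- Precomposition with `B`-linear maps, as a bilinear map. -/
def LT.precomp : (A →ₗ[k] Y.Tot →ₗ[k] LT A Y) →ₗ[k] (X.Tot →ₗ[Bᵐᵒᵖ] Y.Tot) →ₗ[k]
    (A →ₗ[k] X.Tot →ₗ[k] LT A Y) :=
  LinearMap.mk₂ k (fun w F => (LinearMap.lcomp k (LT A Y) (F.restrictScalars k)) ∘ₗ w)
    (fun _ _ _ => LinearMap.comp_add ..) (fun _ _ _ => LinearMap.comp_smul ..)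
    (fun w F G => LinearMap.ext fun a => LinearMap.ext fun x => map_add (w a) (F x) (G x))
    (fun r w F => LinearMap.ext fun a => LinearMap.ext fun x => map_smul (w a) r (F x))

theorem LT.precomp_apply (w : A →ₗ[k] Y.Tot →ₗ[k] LT A Y) (F : X.Tot →ₗ[Bᵐᵒᵖ] Y.Tot) (a : A)
    (x : X.Tot) : LT.precomp A X Y w F a x = w a (F x) := rfl

/-- The differential of `L X` as a multilinear function of `(a₁, …, aₙ)`, with values in the maps
`(a₀, x) ↦ d(a₀, a₁, …, aₙ, x)`: the sum of the three terms
`- (a₀a₁, a₂, …, aₙ, x)`, `∑ (-1)^(i-1) (a₀, …, aᵢaᵢ₊₁, …, aₙ, x)` and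
`∑ (-1)^j (a₀, …, aⱼ, m(aⱼ₊₁, …, aₙ, x))`. -/
def LT.dFn (m : Seq A X X) (l : List A) : A →ₗ[k] X.Tot →ₗ[k] LT A X :=
  -LT.tau l + barD (LT.W A X) l +
    ∑ j ∈ Finset.range (l.length + 1),
      LT.precomp A X X (sgn (LT.W A X) (l.take j)) (m (word k (l.drop j)))

theorem LT.isMultilinear_dFn (m : Seq A X X) : IsMultilinear k (LT.dFn m) := by
  have h1 := (multi k A (A →ₗ[k] X.Tot →ₗ[k] LT A X)).neg_mem LT.isMultilinear_tau
  have h2 := isMultilinear_barD (LT.isMultilinear_W (A := A) (X := X))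
  have h3 := isMultilinear_conv (LT.precomp A X X) (isMultilinear_sgn LT.isMultilinear_W)
    (isMultilinear_seq m)
  exact (multi k A _).add_mem ((multi k A _).add_mem h1 h2) h3

/-- The differential of `L X` on `A ⊗ T(A) ⊗ X`, as a `k`-linear map. -/
def LT.d₀ (m : Seq A X X) : LT A X →ₗ[k] LT A X := LT.ofWords (LT.dFn m) (LT.isMultilinear_dFn m)

/-- `(a₁, …, aₙ) ↦ E (a₀ a₁) (a₂, …, aₙ)`. -/
def headMul {M : Type*} [AddCommGroup M] (E : A → List A → M) (a₀ : A) : List A → M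
  | [] => 0
  | a :: l => E (a₀ * a) l

theorem LT.W_apply (l : List A) (a : A) (x : X.Tot) : LT.W A X l a x = LT.E X a l x := rfl

theorem LT.tau_apply (l : List A) (a : A) (x : X.Tot) :
    LT.tau l a x = headMul (LT.E X) a l x := by
  rcases l with _ | ⟨b, l⟩ <;> rfl

theorem LT.barD_W (l : List A) (a : A) (x : X.Tot) :
    barD (LT.W A X) l a x = barD (LT.E X a) l x := by
  simp only [barD, LinearMap.sum_apply, AddMonoidHom.finsetSum_apply]
  rfl

theorem LT.d₀_E (m : Seq A X X) (a : A) (l : List A) :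
    (LT.d₀ m).toAddMonoidHom.comp (LT.E X a l) =
      - headMul (LT.E X) a l + barD (LT.E X a) l + conv (sgn (LT.E X a)) m.fn l := by
  refine AddMonoidHom.ext fun x => ?_
  change LT.d₀ m (LT.E X a l x) = _
  rw [LT.d₀, LT.ofWords_E, LT.dFn]
  simp only [LinearMap.add_apply, LinearMap.neg_apply, LT.tau_apply, LT.barD_W,
    LinearMap.sum_apply, LT.precomp_apply, AddMonoidHom.add_apply, AddMonoidHom.neg_apply, conv,
    AddMonoidHom.finsetSum_apply]
  rfl

/-- The multilinear function `(a₁, …, aₙ) ↦ (a₀ ↦ x ↦ ∑ (a₀, …, aⱼ, f(aⱼ₊₁, …, aₙ, x)))`. -/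
def LT.mapFn (f : Seq A X Y) (l : List A) : A →ₗ[k] X.Tot →ₗ[k] LT A Y :=
  ∑ j ∈ Finset.range (l.length + 1),
    LT.precomp A X Y (LT.W A Y (l.take j)) (f (word k (l.drop j)))

theorem LT.isMultilinear_mapFn (f : Seq A X Y) : IsMultilinear k (LT.mapFn f) := by
  have h := isMultilinear_conv (LT.precomp A X Y) LT.isMultilinear_W (isMultilinear_seq f)
  exact h

/-- The `k`-linear map underlying `LT.map`. -/
def LT.map₀ (f : Seq A X Y) : LT A X →ₗ[k] LT A Y :=
  LT.ofWords (LT.mapFn f) (LT.isMultilinear_mapFn f)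

theorem LT.map₀_E (f : Seq A X Y) (a : A) (l : List A) :
    (LT.map₀ f).toAddMonoidHom.comp (LT.E X a l) = conv (LT.E Y a) f.fn l := by
  refine AddMonoidHom.ext fun x => ?_
  change LT.map₀ f (LT.E X a l x) = _
  rw [LT.map₀, LT.ofWords_E, LT.mapFn]
  simp only [LinearMap.sum_apply, LT.precomp_apply, conv, AddMonoidHom.finsetSum_apply]
  rfl

/-- A `k`-linear map which commutes with the action of `a ⊗ b` on the generators is linear. -/
theorem LT.linear_of (F : LT A X →ₗ[k] LT A Y)
    (h : ∀ (a : A) (b : Bᵐᵒᵖ) (a₀ : A) (l : List A) (x : X.Tot),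
      F (LT.E X (a * a₀) l (b • x)) = (a ⊗ₜ[k] b) • F (LT.E X a₀ l x))
    (s : A ⊗[k] Bᵐᵒᵖ) (t : LT A X) : F (s • t) = s • F t := by
  induction s using TensorProduct.induction_on with
  | zero =>
    exact (congrArg F (zero_smul (A ⊗[k] Bᵐᵒᵖ) t)).trans
      ((map_zero F).trans (zero_smul (A ⊗[k] Bᵐᵒᵖ) (F t)).symm)
  | add s s' hs hs' =>
    exact (congrArg F (add_smul s s' t)).trans ((map_add F _ _).trans
      ((congrArg₂ _ hs hs').trans (add_smul s s' (F t)).symm))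
  | tmul a b =>
    have : (F.toAddMonoidHom.comp (DistribSMul.toAddMonoidHom (LT A X) (a ⊗ₜ[k] b))) =
        (DistribSMul.toAddMonoidHom (LT A Y) (a ⊗ₜ[k] b)).comp F.toAddMonoidHom :=
      LT.add_ext fun a₀ l x => by
        change F ((a ⊗ₜ[k] b) • LT.elt X a₀ (word k l) x) = (a ⊗ₜ[k] b) • F (LT.E X a₀ l x)
        rw [LT.tmul_smul_elt, ← h]; rfl
    exact DFunLike.congr_fun this t

theorem LT.E_smul (a : A) (b : Bᵐᵒᵖ) (a₀ : A) (l : List A) (x : X.Tot) :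
    LT.E X (a * a₀) l (b • x) = (a ⊗ₜ[k] b) • LT.E X a₀ l x :=
  (LT.tmul_smul_elt a b a₀ (word k l) x).symm

theorem Seq.fn_smul (f : Seq A X Y) (l : List A) (b : Bᵐᵒᵖ) (x : X.Tot) :
    f.fn l (b • x) = b • f.fn l x := map_smul (f (word k l)) b x

theorem smul_zsmul_comm {S M : Type*} [Ring S] [AddCommGroup M] [Module S M] (s : S) (n : ℤ)
    (x : M) : s • n • x = n • s • x :=
  map_zsmul (DistribSMul.toAddMonoidHom M s) n x

/-- The differential of `L X` on `A ⊗ T(A) ⊗ X`. -/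
def LT.d (m : Seq A X X) : LT A X →ₗ[A ⊗[k] Bᵐᵒᵖ] LT A X where
  toFun := LT.d₀ m
  map_add' := map_add _
  map_smul' := LT.linear_of _ fun a b a₀ l x => by
    have h := fun a₀ x => DFunLike.congr_fun (LT.d₀_E m a₀ l) x
    simp only [AddMonoidHom.comp_apply, LinearMap.toAddMonoidHom_coe] at h
    rw [h, h]
    simp only [AddMonoidHom.add_apply, AddMonoidHom.neg_apply, smul_add, smul_neg]
    refine congrArg₂ _ (congrArg₂ _ (congrArg _ ?_) ?_) ?_
    · rcases l with _ | ⟨c, l⟩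
      · simp [headMul]
      · simp only [headMul, mul_assoc, LT.E_smul]
    · simp only [barD, AddMonoidHom.finsetSum_apply, AddMonoidHom.smul_apply, Finset.smul_sum,
        LT.E_smul, smul_zsmul_comm]
    · simp only [conv, sgn, AddMonoidHom.finsetSum_apply, AddMonoidHom.smul_apply,
        AddMonoidHom.comp_apply, Finset.smul_sum, Seq.fn_smul, LT.E_smul, smul_zsmul_comm]

/-- The map `A ⊗ T(A) ⊗ X → A ⊗ T(A) ⊗ Y` given by a sequence `f`:
`(a₀, …, aₙ, x) ↦ ∑ (a₀, …, aⱼ, f(aⱼ₊₁, …, aₙ, x))`. -/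
def LT.map (f : Seq A X Y) : LT A X →ₗ[A ⊗[k] Bᵐᵒᵖ] LT A Y where
  toFun := LT.map₀ f
  map_add' := map_add _
  map_smul' := LT.linear_of _ fun a b a₀ l x => by
    have h := fun a₀ x => DFunLike.congr_fun (LT.map₀_E f a₀ l) x
    simp only [AddMonoidHom.comp_apply, LinearMap.toAddMonoidHom_coe] at h
    rw [h, h]
    simp only [conv, AddMonoidHom.finsetSum_apply, AddMonoidHom.comp_apply, Finset.smul_sum,
      Seq.fn_smul, LT.E_smul]

theorem LT.d_comp_E (m : Seq A X X) (a : A) (l : List A) :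
    (LT.d m).toAddMonoidHom.comp (LT.E X a l) =
      - headMul (LT.E X) a l + barD (LT.E X a) l + conv (sgn (LT.E X a)) m.fn l :=
  LT.d₀_E m a l

theorem LT.map_comp_E (f : Seq A X Y) (a : A) (l : List A) :
    (LT.map f).toAddMonoidHom.comp (LT.E X a l) = conv (LT.E Y a) f.fn l :=
  LT.map₀_E f a l

theorem LT.d_E (m : Seq A X X) (a : A) (l : List A) (x : X.Tot) :
    LT.d m (LT.E X a l x) =
      - headMul (LT.E X) a l x + barD (LT.E X a) l x + conv (sgn (LT.E X a)) m.fn l x :=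
  DFunLike.congr_fun (LT.d_comp_E m a l) x

theorem LT.map_E (f : Seq A X Y) (a : A) (l : List A) (x : X.Tot) :
    LT.map f (LT.E X a l x) = conv (LT.E Y a) f.fn l x :=
  DFunLike.congr_fun (LT.map_comp_E f a l) x

/-- `headMul` as a function of the word. -/
theorem pre_headMul {M : Type*} [AddCommGroup M] (E : A → List A → M) (a₀ a : A) :
    pre a (headMul E a₀) = E (a₀ * a) := rfl

theorem headMul_conv {N P M : Type*} [AddCommGroup N] [AddCommGroup P] [AddCommGroup M]
    (E : A → List A → N →+ P) (f : List A → M →+ N) (a₀ : A) (l : List A) :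
    conv (headMul E a₀) f l = headMul (fun a => conv (E a) f) a₀ l := by
  rcases l with _ | ⟨a, l⟩
  · rw [conv_nil]; simp [headMul]
  · rw [conv_cons, pre_headMul]; simp [headMul]

/-- The square of the differential of `A ⊗ T(A) ⊗ X` vanishes. -/
theorem LT.d_d (X : ShMod k A B) (t : LT A X.toGrMod) : LT.d X.m (LT.d X.m t) = 0 := by
  have : (LT.d X.m).toAddMonoidHom.comp (LT.d X.m).toAddMonoidHom = 0 := by
    refine LT.hom_ext fun a l => ?_
    rw [AddMonoidHom.comp_assoc, LT.d_comp_E]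
    set E := LT.E X.toGrMod (A := A) with hE
    set D := (LT.d X.m).toAddMonoidHom with hD
    set m := X.m.fn with hm
    have hd : ∀ a, (fun l => D.comp (E a l)) =
        -headMul E a + barD (E a) + conv (sgn (E a)) m := fun a =>
      funext fun l => LT.d_comp_E X.m a l
    have e1 : D.comp (headMul E a l) = headMul (fun a => fun l => D.comp (E a l)) a l := by
      rcases l with _ | ⟨b, l⟩
      · exact AddMonoidHom.comp_zero _
      · rfl
    have e2 : D.comp (barD (E a) l) = barD (fun l => D.comp (E a l)) l := (barD_comp D _ l).symm
    have e3 : D.comp (conv (sgn (E a)) m l) = conv (sgn (fun l => D.comp (E a l))) m l := by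
      rw [← conv_comp_left]
      congr 1
      funext t
      refine AddMonoidHom.ext fun x => ?_
      simp [sgn]
    have s1 : sgn (barD (E a)) = - barD (sgn (E a)) := by
      funext t; rw [Pi.neg_apply, barD_sgn, neg_neg]
    have s2 : sgn (conv (sgn (E a)) m) = conv (E a) (sgn m) := by
      funext t; rw [sgn_conv, sgn_sgn]
    have s3 : ∀ F G : List A → X.Tot →+ LT A X.toGrMod, sgn (F + G) = sgn F + sgn G := by
      intro F G; funext t; simp [sgn]
    have s4 : ∀ F : List A → X.Tot →+ LT A X.toGrMod, sgn (-F) = -sgn F := by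
      intro F; funext t; simp [sgn]
    have r := fun l => X.rel' l
    have r' : barD m + conv (sgn m) m = 0 := funext r
    have r'' : conv (E a) (barD m) l + conv (E a) (conv (sgn m) m) l = 0 := by
      rw [← conv_add_right, r']; simp [conv]
    rw [AddMonoidHom.comp_add, AddMonoidHom.comp_add, AddMonoidHom.comp_neg, e1, e2, e3]
    have hd' : (fun a l => D.comp (E a l)) = fun a =>
        -headMul E a + barD (E a) + conv (sgn (E a)) m := funext hd
    rw [hd', hd]
    rw [barD_add, barD_add, barD_neg, barD_barD, barD_conv, s3, s3, s4, s1, s2, conv_add_left,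
      conv_add_left, conv_neg_left, conv_neg_left, conv_assoc, sgn_sgn]
    have key : headMul (fun a => -headMul E a + barD (E a) + conv (sgn (E a)) m) a l
        + barD (headMul E a) l + conv (sgn (headMul E a)) m l = 0 := by
      rcases l with _ | ⟨b, _ | ⟨c, l⟩⟩
      · rw [barD_nil, conv_nil]; simp [headMul, sgn]
      · rw [barD_single, conv_cons, pre_sgn, pre_headMul, conv_neg_left]
        simp [headMul, sgn, barD_nil]
      · rw [barD_cons, conv_cons, pre_sgn, pre_headMul, conv_neg_left]
        simp only [headMul, sgn, mul_assoc, Pi.add_apply, Pi.neg_apply, List.length_nil, pow_zero,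
          one_smul, AddMonoidHom.zero_comp, zero_add]
        abel
    rw [AddMonoidHom.zero_comp]
    have h := congrArg₂ (fun u v => u - v) r'' key
    simp only [sub_zero] at h
    refine Eq.trans ?_ h
    abel
  exact DFunLike.congr_fun this t

theorem LT.map_d {X Y : ShMod k A B} (f : X ⟶ Y) (t : LT A X.toGrMod) :
    LT.map f.f (LT.d X.m t) = LT.d Y.m (LT.map f.f t) := by
  have : (LT.map f.f).toAddMonoidHom.comp (LT.d X.m).toAddMonoidHom =
      (LT.d Y.m).toAddMonoidHom.comp (LT.map f.f).toAddMonoidHom := by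
    refine LT.hom_ext fun a l => ?_
    rw [AddMonoidHom.comp_assoc, LT.d_comp_E, AddMonoidHom.comp_assoc, LT.map_comp_E]
    set F := (LT.map f.f).toAddMonoidHom with hF
    set D := (LT.d Y.m).toAddMonoidHom with hD
    have hf : ∀ a, (fun l => F.comp (LT.E X.toGrMod a l)) = conv (LT.E Y.toGrMod a) f.f.fn :=
      fun a => funext fun l => LT.map_comp_E f.f a l
    have hd : ∀ a, (fun l => D.comp (LT.E Y.toGrMod a l)) =
        -headMul (LT.E Y.toGrMod) a + barD (LT.E Y.toGrMod a) +
          conv (sgn (LT.E Y.toGrMod a)) Y.m.fn := fun a =>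
      funext fun l => LT.d_comp_E Y.m a l
    have e1 : F.comp (headMul (LT.E X.toGrMod) a l) =
        headMul (fun a => conv (LT.E Y.toGrMod a) f.f.fn) a l := by
      rcases l with _ | ⟨b, l⟩
      · exact AddMonoidHom.comp_zero _
      · exact LT.map_comp_E f.f _ _
    have e2 : F.comp (barD (LT.E X.toGrMod a) l) = barD (conv (LT.E Y.toGrMod a) f.f.fn) l := by
      rw [← barD_comp, hf]
    have e3 : F.comp (conv (sgn (LT.E X.toGrMod a)) X.m.fn l) =
        conv (sgn (conv (LT.E Y.toGrMod a) f.f.fn)) X.m.fn l := by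
      rw [← conv_comp_left, ← hf]
      congr 1
      funext t
      refine AddMonoidHom.ext fun x => ?_
      simp [sgn]
    have s : sgn (conv (LT.E Y.toGrMod a) f.f.fn) = conv (sgn (LT.E Y.toGrMod a)) (sgn f.f.fn) :=
      funext fun l => sgn_conv _ _ _
    have r : conv Y.m.fn f.f.fn = barD f.f.fn + conv (sgn f.f.fn) X.m.fn :=
      funext fun l => f.rel' l
    rw [AddMonoidHom.comp_add, AddMonoidHom.comp_add, AddMonoidHom.comp_neg, e1, e2, e3,
      ← conv_comp_left, hd, conv_add_left, conv_add_left, conv_neg_left, headMul_conv, barD_conv,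
      s, conv_assoc, conv_assoc, r, conv_add_right]
    abel
  exact DFunLike.congr_fun this t

theorem LT.map_comp (g : Seq A Y Z) (f : Seq A X Y) (t : LT A X) :
    LT.map (g.comp f) t = LT.map g (LT.map f t) := by
  have : (LT.map (g.comp f)).toAddMonoidHom =
      (LT.map g).toAddMonoidHom.comp (LT.map f).toAddMonoidHom := by
    refine LT.hom_ext fun a l => ?_
    rw [AddMonoidHom.comp_assoc, LT.map_comp_E, LT.map_comp_E, ← conv_comp_left, Seq.comp_fn,
      ← conv_assoc]
    congr 1
    exact funext fun l => (LT.map_comp_E g a l).symm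
  exact DFunLike.congr_fun this t

theorem LT.map_id (t : LT A X) : LT.map (Seq.strict LinearMap.id : Seq A X X) t = t := by
  have : (LT.map (Seq.strict LinearMap.id : Seq A X X)).toAddMonoidHom = AddMonoidHom.id _ := by
    refine LT.hom_ext fun a l => ?_
    rw [LT.map_comp_E, Seq.strict_fn, conv_strict_right]
    rfl
  exact DFunLike.congr_fun this t

variable (A X) in
/-- The component of degree `q` of `A ⊗ T(A[1]) ⊗ X`, generated by the elements
`a ⊗ (a₁ ⊗ ⋯ ⊗ aₙ) ⊗ x` with `x` homogeneous of degree `q + n`. -/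
def LT.deg (q : ℤ) : Submodule (A ⊗[k] Bᵐᵒᵖ) (LT A X) :=
  Submodule.span _ {t | ∃ (a : A) (l : List A) (x : X.X (q + l.length)),
    LT.E X a l (X.inc _ x) = t}

theorem LT.E_mem_deg (a : A) (l : List A) {p q : ℤ} {x : X.Tot} (hx : x ∈ X.deg p)
    (h : p = q + l.length) : LT.E X a l x ∈ LT.deg A X q := by
  obtain ⟨x, rfl⟩ := hx
  subst h
  exact Submodule.subset_span ⟨a, l, x, rfl⟩

theorem zsmul_mem_deg (q : ℤ) (n : ℤ) {t : LT A X} (h : t ∈ LT.deg A X q) :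
    n • t ∈ LT.deg A X q := zsmul_mem h n

theorem LT.d_mem_deg {m : Seq A X X} (hm : m.IsHomogeneous 1) {q r : ℤ} (h : q + 1 = r)
    {t : LT A X} (ht : t ∈ LT.deg A X q) : LT.d m t ∈ LT.deg A X r := by
  suffices LT.deg A X q ≤ (LT.deg A X r).comap (LT.d m) from this ht
  refine Submodule.span_le.2 ?_
  rintro _ ⟨a, l, x, rfl⟩
  change LT.d m _ ∈ LT.deg A X r
  rw [LT.d_E]
  refine add_mem (add_mem (neg_mem ?_) ?_) ?_
  · rcases l with _ | ⟨b, l⟩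
    · exact zero_mem _
    · exact LT.E_mem_deg _ _ (X.inc_mem _ x) (by simp; omega)
  · simp only [barD, AddMonoidHom.finsetSum_apply, AddMonoidHom.smul_apply]
    refine sum_mem fun i hi => zsmul_mem (LT.E_mem_deg _ _ (X.inc_mem _ x) ?_) _
    have := merge_length i l (by simpa using hi)
    omega
  · simp only [conv, sgn, AddMonoidHom.finsetSum_apply, AddMonoidHom.smul_apply,
      AddMonoidHom.comp_apply]
    refine sum_mem fun j hj => zsmul_mem (LT.E_mem_deg _ _ (hm _ _ x) ?_) _
    have hj' : j ≤ l.length := by simpa [Nat.lt_succ_iff] using hj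
    simp only [List.length_take, List.length_drop, min_eq_left hj', Nat.cast_sub hj']
    omega

theorem LT.map_mem_deg {f : Seq A X Y} (hf : f.IsHomogeneous 0) {q : ℤ}
    {t : LT A X} (ht : t ∈ LT.deg A X q) : LT.map f t ∈ LT.deg A Y q := by
  suffices LT.deg A X q ≤ (LT.deg A Y q).comap (LT.map f) from this ht
  refine Submodule.span_le.2 ?_
  rintro _ ⟨a, l, x, rfl⟩
  change LT.map f _ ∈ LT.deg A Y q
  rw [LT.map_E]
  simp only [conv, AddMonoidHom.finsetSum_apply, AddMonoidHom.comp_apply]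
  refine sum_mem fun j hj => LT.E_mem_deg _ _ (hf _ _ x) ?_
  have hj' : j ≤ l.length := by simpa [Nat.lt_succ_iff] using hj
  simp only [List.length_take, List.length_drop, min_eq_left hj', Nat.cast_sub hj']
  omega

/-- The complex of bimodules `L X = A ⊗ T(A[1]) ⊗ X`. -/
def Lobj (X : ShMod k A B) : BimodCx k A B where
  X q := ModuleCat.of (A ⊗[k] Bᵐᵒᵖ) (LT.deg A X.toGrMod q)
  d q r := if h : q + 1 = r then
      ModuleCat.ofHom ((LT.d X.m).restrict fun _ ht => LT.d_mem_deg X.deg_m h ht)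
    else 0
  shape q r h := dif_neg h
  d_comp_d' q r s h h' := by
    have h : q + 1 = r := h
    have h' : r + 1 = s := h'
    rw [dif_pos h, dif_pos h']
    ext t
    exact LT.d_d X t.1

theorem Lobj_d (X : ShMod k A B) {q r : ℤ} (h : q + 1 = r) : (Lobj X).d q r =
    ModuleCat.ofHom ((LT.d X.m).restrict fun _ ht => LT.d_mem_deg X.deg_m h ht) := dif_pos h

/-- The morphism of complexes of bimodules `L f`. -/
def Lmap {X Y : ShMod k A B} (f : X ⟶ Y) : Lobj X ⟶ Lobj Y where
  f q := ModuleCat.ofHom ((LT.map f.f).restrict fun _ ht => LT.map_mem_deg f.deg_f ht)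
  comm' q r h := by
    rw [Lobj_d X h, Lobj_d Y h]
    ext t
    exact Subtype.ext (LT.map_d f t.1).symm

variable (k A B) in
/-- The functor `L` from strong homotopy modules to complexes of bimodules. -/
def L : ShMod k A B ⥤ BimodCx k A B where
  obj X := Lobj X
  map f := Lmap f
  map_id X := by
    ext q t
    exact Subtype.ext (LT.map_id t.1)
  map_comp f g := by
    ext q t
    exact Subtype.ext (LT.map_comp g.f f.f t.1)

end LeftAdjointFunctor

section Unit

variable (X : ShMod k A B)

/-- The element of `L X` of degree `q` given by `x ↦ 1 ⊗ (a₁ ⊗ ⋯ ⊗ aₙ) ⊗ x`, for `x` of degree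
`p = q + n`. -/
def unitComp (l : List A) (p q : ℤ) (h : p = q + l.length) :
    X.X p →ₗ[Bᵐᵒᵖ] (grUnderlying (Lobj X)).X q where
  toFun x := (⟨LT.E X.toGrMod 1 l (X.inc p x), LT.E_mem_deg 1 l (X.inc_mem p x) h⟩ :
    LT.deg A X.toGrMod q)
  map_add' x y := Subtype.ext
    ((congrArg (LT.E X.toGrMod 1 l) (map_add (X.inc p) x y)).trans (map_add (LT.E X.toGrMod 1 l) _ _))
  map_smul' b x := Subtype.ext (by
    have := LT.E_smul (1 : A) b 1 l (X.inc p x)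
    rw [one_mul] at this
    exact (congrArg (LT.E X.toGrMod 1 l) (map_smul (X.inc p) b x)).trans this)

/-- The component of the adjunction morphism at `a₁ ⊗ ⋯ ⊗ aₙ`. -/
def unitFn (l : List A) : X.Tot →ₗ[Bᵐᵒᵖ] (grUnderlying (Lobj X)).Tot :=
  DirectSum.toModule Bᵐᵒᵖ ℤ _ fun p =>
    (grUnderlying (Lobj X)).inc (p - l.length) ∘ₗ unitComp X l p (p - l.length) (by omega)

/-- The canonical map from the direct sum of the components of `L X` to `A ⊗ T(A) ⊗ X`. -/
def sumL : (grUnderlying (Lobj X)).Tot →+ LT A X.toGrMod :=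
  DirectSum.toAddMonoid fun q =>
    (LT.deg A X.toGrMod q).subtype.toAddMonoidHom

theorem sumL_inc (q : ℤ) (z : LT.deg A X.toGrMod q) :
    sumL X ((grUnderlying (Lobj X)).inc q z) = z.1 :=
  DirectSum.toAddMonoid_of _ _ _

theorem sumL_inj {q : ℤ} {s t : (grUnderlying (Lobj X)).Tot}
    (hs : s ∈ (grUnderlying (Lobj X)).deg q) (ht : t ∈ (grUnderlying (Lobj X)).deg q)
    (h : sumL X s = sumL X t) : s = t := by
  obtain ⟨s, rfl⟩ := hs
  obtain ⟨t, rfl⟩ := ht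
  congr 1
  have h1 := sumL_inc X q s
  have h2 := sumL_inc X q t
  exact Subtype.ext (h1.symm.trans (h.trans h2))

theorem unitFn_inc (l : List A) (p : ℤ) (x : X.X p) : unitFn X l (X.inc p x) =
    (grUnderlying (Lobj X)).inc (p - l.length) (unitComp X l p (p - l.length) (by omega) x) := by
  simp only [unitFn, GrMod.inc, DirectSum.toModule_lof, LinearMap.comp_apply]

theorem unitFn_mem (l : List A) (p : ℤ) (x : X.X p) {q : ℤ} (h : p = q + l.length) :
    unitFn X l (X.inc p x) ∈ (grUnderlying (Lobj X)).deg q := by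
  obtain rfl : q = p - l.length := by omega
  rw [unitFn_inc]
  exact GrMod.inc_mem _ _ _

theorem sumL_unitFn (l : List A) : (sumL X).comp (unitFn X l).toAddMonoidHom =
    LT.E X.toGrMod 1 l := by
  refine GrMod.hom_ext _ fun p x => ?_
  change sumL X (unitFn X l (X.inc p x)) = _
  rw [unitFn_inc]
  exact sumL_inc X _ _

theorem sumL_totD (t : (grUnderlying (Lobj X)).Tot) :
    sumL X (totD (Lobj X) t) = LT.d X.m (sumL X t) := by
  suffices (sumL X).comp (totD (Lobj X)).toAddMonoidHom =
      (LT.d X.m).toAddMonoidHom.comp (sumL X) from DFunLike.congr_fun this t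
  refine GrMod.hom_ext _ fun q z => ?_
  change sumL X (totD (Lobj X) ((grUnderlying (Lobj X)).inc q z)) =
    LT.d X.m (sumL X ((grUnderlying (Lobj X)).inc q z))
  rw [totD_inc, Lobj_d X rfl]
  refine (sumL_inc X _ _).trans ?_
  exact congrArg (LT.d X.m) (sumL_inc X q z).symm

theorem sumL_totAct (a : A) (t : (grUnderlying (Lobj X)).Tot) :
    sumL X (totAct (Lobj X) a t) = (a ⊗ₜ[k] (1 : Bᵐᵒᵖ)) • sumL X t := by
  suffices (sumL X).comp (totAct (Lobj X) a).toAddMonoidHom =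
      (DistribSMul.toAddMonoidHom (LT A X.toGrMod) (a ⊗ₜ[k] (1 : Bᵐᵒᵖ))).comp (sumL X) from
    DFunLike.congr_fun this t
  refine GrMod.hom_ext _ fun q z => ?_
  change sumL X (totAct (Lobj X) a ((grUnderlying (Lobj X)).inc q z)) =
    (a ⊗ₜ[k] (1 : Bᵐᵒᵖ)) • sumL X ((grUnderlying (Lobj X)).inc q z)
  rw [totAct_inc]
  refine (sumL_inc X _ _).trans ?_
  exact congrArg (fun u => (a ⊗ₜ[k] (1 : Bᵐᵒᵖ)) • u) (sumL_inc X q z).symm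

theorem isMultilinear_unitFn : IsMultilinear k (unitFn X) := by
  have hE : ∀ l p x, sumL X (unitFn X l (X.inc p x)) = LT.elt X.toGrMod 1 (word k l) (X.inc p x) :=
    fun l p x => DFunLike.congr_fun (sumL_unitFn X l) (X.inc p x)
  constructor
  · intro u v a b
    refine GrMod.lin_ext fun p x => ?_
    set q : ℤ := p - (u.length + (v.length + 1)) with hq
    have h : ∀ c : A, p = q + ((u ++ c :: v).length : ℤ) := by
      intro c; simp [hq]
    refine sumL_inj X (unitFn_mem X _ p x (h _))
      (add_mem (unitFn_mem X _ p x (h _)) (unitFn_mem X _ p x (h _))) ?_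
    change _ = sumL X (_ + _)
    rw [map_add, hE, hE, hE, (isMultilinear_word k).add, map_add]
    rfl
  · intro u v r a
    refine GrMod.lin_ext fun p x => ?_
    set q : ℤ := p - (u.length + (v.length + 1)) with hq
    have h : ∀ c : A, p = q + ((u ++ c :: v).length : ℤ) := by
      intro c; simp [hq]
    have e : (r • unitFn X (u ++ a :: v)) (X.inc p x) =
        unitFn X (u ++ a :: v) (X.inc p (r • x)) := by
      rw [LinearMap.smul_apply, ← LinearMap.map_smul_of_tower, ← LinearMap.map_smul_of_tower]
    rw [e]
    refine sumL_inj X (unitFn_mem X _ p x (h _)) (unitFn_mem X _ p _ (h _)) ?_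
    rw [hE, hE, (isMultilinear_word k).smul, map_smul, LinearMap.map_smul_of_tower, map_smul]
    rfl

/-- The adjunction morphism as a sequence. -/
def unitSeq : Seq A X.toGrMod (grUnderlying (Lobj X)) := ofWords (unitFn X) (isMultilinear_unitFn X)

theorem unitSeq_word (l : List A) : unitSeq X (word k l) = unitFn X l := ofWords_word _ _ _

theorem unitSeq_homogeneous : (unitSeq X).IsHomogeneous 0 := by
  intro l p x
  rw [unitSeq_word]
  exact unitFn_mem X l p x (by omega)

theorem sumL_unitSeq (l : List A) (t : X.Tot) :
    sumL X ((unitSeq X).fn l t) = LT.E X.toGrMod 1 l t := by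
  have := DFunLike.congr_fun (sumL_unitFn X l) t
  rw [Seq.fn, unitSeq_word]
  exact this

theorem unitSeq_rel (l : List A) :
    conv (actSeq (Lobj X)).fn (unitSeq X).fn l =
      barD (unitSeq X).fn l + conv (sgn (unitSeq X).fn) X.m.fn l := by
  refine GrMod.hom_ext _ fun p x => ?_
  have m0 := unitSeq_homogeneous X
  have hq : p = (p + 1 - l.length) + l.length - 1 := by omega
  refine sumL_inj X (q := p + 1 - l.length) ?_ (add_mem ?_ ?_) ?_
  · have hm : (actSeq (Lobj X)).IsHomogeneous 1 := (Robj (Lobj X)).deg_m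
    have := hm.comp m0 l p x
    rw [← Seq.comp_fn]
    rw [add_zero] at this
    exact this
  · simp only [barD, AddMonoidHom.finsetSum_apply, AddMonoidHom.smul_apply]
    refine sum_mem fun i hi => zsmul_mem (m0.mem _ (X.inc_mem p x) ?_) _
    have := merge_length i l (by simpa using hi)
    omega
  · simp only [conv, sgn, AddMonoidHom.finsetSum_apply, AddMonoidHom.smul_apply,
      AddMonoidHom.comp_apply]
    refine sum_mem fun j hj => zsmul_mem (m0.mem _ (X.deg_m _ p x) ?_) _
    have hj' : j ≤ l.length := by simpa [Nat.lt_succ_iff] using hj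
    simp only [List.length_take, List.length_drop, min_eq_left hj', Nat.cast_sub hj']
    omega
  · have e1 : sumL X (barD (unitSeq X).fn l (X.inc p x)) = barD (LT.E X.toGrMod 1) l (X.inc p x) := by
      simp only [barD, AddMonoidHom.finsetSum_apply, AddMonoidHom.smul_apply, map_sum, map_zsmul,
        sumL_unitSeq]
    have e2 : sumL X (conv (sgn (unitSeq X).fn) X.m.fn l (X.inc p x)) =
        conv (sgn (LT.E X.toGrMod 1)) X.m.fn l (X.inc p x) := by
      simp only [conv, sgn, AddMonoidHom.finsetSum_apply, AddMonoidHom.smul_apply, map_sum,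
        map_zsmul, AddMonoidHom.comp_apply, sumL_unitSeq]
    have e3 := LT.d_E X.m (1 : A) l (X.inc p x)
    rw [AddMonoidHom.add_apply, map_add, e1, e2]
    rcases l with _ | ⟨a, l⟩
    · rw [conv_nil, actSeq_nil]
      change sumL X (totD (Lobj X) _) = _
      rw [sumL_totD, sumL_unitSeq, e3]
      simp [headMul]
    · rw [conv_actSeq_cons]
      change sumL X (totD (Lobj X) _ + totAct (Lobj X) a _) = _
      rw [map_add, sumL_totD, sumL_totAct, sumL_unitSeq, sumL_unitSeq, e3]
      have e4 := LT.E_smul a (1 : Bᵐᵒᵖ) 1 l (X.inc p x)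
      rw [mul_one, one_smul] at e4
      rw [← e4]
      simp only [headMul, one_mul]
      abel

/-- The adjunction morphism `X → R L X`, with components
`(a₁, …, aₙ, x) ↦ 1 ⊗ (a₁ ⊗ ⋯ ⊗ aₙ) ⊗ x`. -/
def unit : X ⟶ (R k A B).obj ((L k A B).obj X) where
  f := unitSeq X
  deg_f := unitSeq_homogeneous X
  rel l := (ShHom.rel_iff _ _ _ _).2 (unitSeq_rel X l)

variable (k A B) in
/-- `X` is `H`-unital if the adjunction morphism `X → R L X` is a quasi-isomorphism. -/
def HUnital : ObjectProperty (ShMod k A B) := fun X => ShMod.IsQis (unit X)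

variable (k A B) in
/-- The objects of the derived category which are `H`-unital strong homotopy modules. -/
def DHUnital : ObjectProperty (DShMod k A B) := (HUnital k A B).strictMap (DShMod.Q k A B)

end Unit

end Modules

end ShAct

end

/-!
The functor `L` is the bar construction. The adjunction is built from its unit `η` and the
augmentation `ε : L R Y ⟶ Y`, which maps `a ⊗ y` to `a y` and vanishes on `a ⊗ w ⊗ y` for words `w`
of positive length (`counit`, `left_triangle`, `right_triangle`, `adj`).

Three facts transfer it to the derived categories.

* `ε` is a quasi-isomorphism (`quasiIso_counit`): since `A` has a unit, the augmented bar resolution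
  is contracted by `a ⊗ w ⊗ y ↦ 1 ⊗ (a ⊗ w) ⊗ y` up to sign (`LT.d_cons`).
* `L` preserves quasi-isomorphisms (`ShMod.IsQis.quasiIso_L`). Filter `L X` by the length of words.
  On the graded pieces, `L f` is `A ⊗ A^{⊗ n} ⊗ f₁` and the differential is `±A ⊗ A^{⊗ n} ⊗ m₁`, so
  that flatness of `A` and of `T(A)` applies; here projectivity of `A` enters. Induction on the
  length then gives the claim for `L f`. Acyclicity of mapping cones is used throughout in the
  elementwise form `ConeExact`, on ungraded total modules, and degrees are restored by projecting
  in the end.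
* `L` maps homotopic morphisms to homotopic morphisms (`homotopyL`).

Hence `L` induces a functor on the derived categories, and the adjunction descends
(`descendAdjunction`), because natural transformations between functors on a localization are the
same as those between their composites with the localization functor. The derived counit is
invertible, so `R` is fully faithful, and its essential image consists of the objects on which the
derived unit is invertible. As homology factors through the derived category
(`ShMod.isQis_of_isIso_Q`), these are the `H`-unital objects.
-/

noncomputable section

namespace ShAct

set_option linter.unusedSectionVars false

/-! ### Maps on the bar construction and its grading -/

section BarOperators

variable {k : Type u} {A B : Type u} [CommRing k] [Ring A] [Algebra k A] [Ring B] [Algebra k B]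
variable {X Y Z : GrMod k B}

/-- The `k`-linear map on `A ⊗ T(A) ⊗ X` given by a multilinear function on words. -/
def LT.lift {H : Type*} [AddCommGroup H] [Module k H] (φ : List A → (A →ₗ[k] X.Tot →ₗ[k] H))
    (h : IsMultilinear k φ) : LT A X →ₗ[k] H :=
  (TensorProduct.lift ((TensorProduct.uncurry (RingHom.id k) (TensorAlgebra k A) X.Tot H) ∘ₗ
    (ShAct.ofWords φ h).flip) : LT₀ A X →ₗ[k] H)

theorem LT.lift_E {H : Type*} [AddCommGroup H] [Module k H]
    (φ : List A → (A →ₗ[k] X.Tot →ₗ[k] H)) (h : IsMultilinear k φ) (a : A)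
    (l : List A) (x : X.Tot) : LT.lift φ h (LT.E X a l x) = φ l a x := by
  change ShAct.ofWords φ h (word k l) a x = _
  rw [ShAct.ofWords_word]

/-- An additive map which commutes with the action of `a ⊗ b` on the generators is linear. -/
theorem LT.map_smul_of {M : Type*} [AddCommGroup M] [Module (A ⊗[k] Bᵐᵒᵖ) M] (F : LT A X →+ M)
    (h : ∀ (a : A) (b : Bᵐᵒᵖ) (a₀ : A) (l : List A) (x : X.Tot),
      F (LT.E X (a * a₀) l (b • x)) = (a ⊗ₜ[k] b) • F (LT.E X a₀ l x))
    (s : A ⊗[k] Bᵐᵒᵖ) (t : LT A X) : F (s • t) = s • F t := by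
  induction s using TensorProduct.induction_on with
  | zero =>
    exact (congrArg F (zero_smul (A ⊗[k] Bᵐᵒᵖ) t)).trans
      ((map_zero F).trans (zero_smul (A ⊗[k] Bᵐᵒᵖ) (F t)).symm)
  | add s s' hs hs' =>
    exact (congrArg F (add_smul s s' t)).trans ((map_add F _ _).trans
      ((congrArg₂ _ hs hs').trans (add_smul s s' (F t)).symm))
  | tmul a b =>
    have : (F.comp (DistribSMul.toAddMonoidHom (LT A X) (a ⊗ₜ[k] b))) =
        (DistribSMul.toAddMonoidHom M (a ⊗ₜ[k] b)).comp F :=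
      LT.add_ext fun a₀ l x => by
        change F ((a ⊗ₜ[k] b) • LT.elt X a₀ (word k l) x) = (a ⊗ₜ[k] b) • F (LT.E X a₀ l x)
        rw [LT.tmul_smul_elt, ← h]; rfl
    exact DFunLike.congr_fun this t

/-- The multilinear function underlying `LT.byLength`. -/
def LT.byLengthFn (G : ℕ → X.Tot →ₗ[Bᵐᵒᵖ] Y.Tot) (l : List A) : A →ₗ[k] X.Tot →ₗ[k] LT A Y :=
  LT.precomp A X Y (LT.W A Y l) (G l.length)

theorem LT.isMultilinear_byLengthFn (G : ℕ → X.Tot →ₗ[Bᵐᵒᵖ] Y.Tot) :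
    IsMultilinear k (LT.byLengthFn (A := A) G) where
  add u v a b := by
    simp only [LT.byLengthFn, LT.isMultilinear_W.add, List.length_append, List.length_cons,
      map_add, LinearMap.add_apply]
  smul u v r a := by
    simp only [LT.byLengthFn, LT.isMultilinear_W.smul, List.length_append, List.length_cons,
      map_smul, LinearMap.smul_apply]

/-- The bimodule map `a ⊗ w ⊗ x ↦ a ⊗ w ⊗ Gₙ(x)`, for words `w` of length `n`. -/
def LT.byLength (G : ℕ → X.Tot →ₗ[Bᵐᵒᵖ] Y.Tot) : LT A X →ₗ[A ⊗[k] Bᵐᵒᵖ] LT A Y where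
  toFun := LT.lift (LT.byLengthFn G) (LT.isMultilinear_byLengthFn G)
  map_add' := map_add _
  map_smul' := LT.map_smul_of
    (LT.lift (LT.byLengthFn G) (LT.isMultilinear_byLengthFn G)).toAddMonoidHom
    fun a b a₀ l x => by
      simp only [LinearMap.toAddMonoidHom_coe, LT.lift_E]
      change LT.E Y (a * a₀) l (G l.length (b • x)) = (a ⊗ₜ[k] b) • LT.E Y a₀ l (G l.length x)
      rw [map_smul, LT.E_smul]

theorem LT.byLength_E (G : ℕ → X.Tot →ₗ[Bᵐᵒᵖ] Y.Tot) (a : A) (l : List A) (x : X.Tot) :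
    LT.byLength G (LT.E X a l x) = LT.E Y a l (G l.length x) :=
  LT.lift_E _ (LT.isMultilinear_byLengthFn G) a l x

theorem LT.linear_ext {M : Type*} [AddCommGroup M] [Module (A ⊗[k] Bᵐᵒᵖ) M]
    {F G : LT A X →ₗ[A ⊗[k] Bᵐᵒᵖ] M} (h : ∀ a l x, F (LT.E X a l x) = G (LT.E X a l x)) : F = G :=
  LinearMap.toAddMonoidHom_injective (LT.add_ext h)

theorem LT.byLength_byLength (G : ℕ → Y.Tot →ₗ[Bᵐᵒᵖ] Z.Tot) (H : ℕ → X.Tot →ₗ[Bᵐᵒᵖ] Y.Tot)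
    (t : LT A X) : LT.byLength G (LT.byLength H t) = LT.byLength (fun n => G n ∘ₗ H n) t := by
  suffices LT.byLength G ∘ₗ LT.byLength H = LT.byLength (A := A) (fun n => G n ∘ₗ H n) from
    LinearMap.congr_fun this t
  refine LT.linear_ext fun a l x => ?_
  simp only [LinearMap.comp_apply, LT.byLength_E]

theorem LT.byLength_eq_self {G : ℕ → X.Tot →ₗ[Bᵐᵒᵖ] X.Tot} (h : ∀ n, G n = LinearMap.id)
    (t : LT A X) : LT.byLength G t = t := by
  suffices LT.byLength (A := A) G = LinearMap.id from LinearMap.congr_fun this t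
  refine LT.linear_ext fun a l x => ?_
  simp only [LT.byLength_E, h, LinearMap.id_apply]

/-- The additive group `A ⊗ T(A) ⊗ X` is generated by the elements `a ⊗ (a₁ ⊗ ⋯ ⊗ aₙ) ⊗ x`. -/
theorem LT.mem_of_E (S : AddSubgroup (LT A X)) (h : ∀ a l x, LT.E X a l x ∈ S) (t : LT A X) :
    t ∈ S := by
  have : QuotientAddGroup.mk' S = 0 := LT.add_ext fun a l x =>
    (QuotientAddGroup.eq_zero_iff _).2 (h a l x)
  exact (QuotientAddGroup.eq_zero_iff _).1 (DFunLike.congr_fun this t)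

/-- Two additive maps on `A ⊗ T(A) ⊗ X` agree if they agree on homogeneous generators. -/
theorem LT.hom_ext_inc {M : Type*} [AddCommGroup M] {f g : LT A X →+ M}
    (h : ∀ a l p (x : X.X p), f (LT.E X a l (X.inc p x)) = g (LT.E X a l (X.inc p x))) :
    f = g :=
  LT.hom_ext fun a l => X.hom_ext fun p x => h a l p x

theorem LT.hom_ext_deg {M : Type*} [AddCommGroup M] {f g : LT A X →+ M}
    (h : ∀ q, ∀ t ∈ LT.deg A X q, f t = g t) : f = g :=
  LT.hom_ext_inc fun a l p x =>
    h (p - l.length) _ (LT.E_mem_deg a l (X.inc_mem p x) (by omega))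

variable (A X) in
/-- The projection of `A ⊗ T(A[1]) ⊗ X` onto its component of degree `q`. -/
def LT.degProj (q : ℤ) : LT A X →ₗ[A ⊗[k] Bᵐᵒᵖ] LT A X :=
  LT.byLength fun n => X.inc (q + n) ∘ₗ X.proj (q + n)

theorem LT.degProj_mem (q : ℤ) (t : LT A X) : LT.degProj A X q t ∈ LT.deg A X q := by
  refine LT.mem_of_E ((LT.deg A X q).toAddSubgroup.comap (LT.degProj A X q).toAddMonoidHom)
    (fun a l x => ?_) t
  change LT.byLength _ (LT.E X a l x) ∈ LT.deg A X q
  rw [LT.byLength_E]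
  exact LT.E_mem_deg a l (X.inc_mem _ _) rfl

theorem GrMod.proj_inc_ne (X : GrMod k B) {p q : ℤ} (h : p ≠ q) (x : X.X p) :
    X.proj q (X.inc p x) = 0 :=
  (DirectSum.component.of Bᵐᵒᵖ q p x).trans (dif_neg h)

/-- The submodules `LT.deg A X q` are independent: projecting to a different degree gives `0`. -/
theorem LT.degProj_of_mem {q : ℤ} {t : LT A X} (ht : t ∈ LT.deg A X q) (r : ℤ) :
    LT.degProj A X r t = if q = r then t else 0 := by
  suffices h : LT.deg A X q ≤ LinearMap.ker (LT.degProj A X r -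
      if q = r then LinearMap.id else 0) by
    have h' := h ht
    rw [LinearMap.mem_ker, LinearMap.sub_apply, sub_eq_zero] at h'
    rw [h']
    split_ifs <;> rfl
  refine Submodule.span_le.2 ?_
  rintro _ ⟨a, l, x, rfl⟩
  rw [SetLike.mem_coe, LinearMap.mem_ker, LinearMap.sub_apply, sub_eq_zero, LT.degProj,
    LT.byLength_E, LinearMap.comp_apply]
  split_ifs with h
  · subst h
    rw [X.proj_inc, LinearMap.id_apply]
  · rw [X.proj_inc_ne (by omega), map_zero, map_zero, LinearMap.zero_apply]

/-- A homogeneous map commutes with the projections onto the homogeneous components. -/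
theorem LT.degProj_comm (F : LT A X →+ LT A Y) (e : ℤ)
    (hF : ∀ p, ∀ t ∈ LT.deg A X p, F t ∈ LT.deg A Y (p + e)) (q : ℤ) (t : LT A X) :
    LT.degProj A Y (q + e) (F t) = F (LT.degProj A X q t) := by
  suffices (LT.degProj A Y (q + e)).toAddMonoidHom.comp F =
      F.comp (LT.degProj A X q).toAddMonoidHom from DFunLike.congr_fun this t
  refine LT.hom_ext_deg fun p t ht => ?_
  change LT.degProj A Y (q + e) (F t) = F (LT.degProj A X q t)
  rw [LT.degProj_of_mem ht, LT.degProj_of_mem (hF p t ht)]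
  by_cases h : p = q
  · rw [if_pos h, if_pos (by omega)]
  · rw [if_neg h, if_neg (by omega), map_zero]

variable (X : ShMod k A B)

/-- The inclusion of the component of degree `q` of `L X` into `A ⊗ T(A) ⊗ X`. -/
def valL (q : ℤ) : (grUnderlying (Lobj X)).X q →+ LT A X.toGrMod :=
  (LT.deg A X.toGrMod q).subtype.toAddMonoidHom

theorem valL_injective (q : ℤ) : Function.Injective (valL X q) := Subtype.val_injective

theorem valL_mem (q : ℤ) (z : (grUnderlying (Lobj X)).X q) :
    valL X q z ∈ LT.deg A X.toGrMod q :=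
  Subtype.property (p := fun t => t ∈ LT.deg A X.toGrMod q) z

theorem sumL_inc' (q : ℤ) (z : (grUnderlying (Lobj X)).X q) :
    sumL X ((grUnderlying (Lobj X)).inc q z) = valL X q z :=
  sumL_inc X q z

theorem Lobj_d_apply {q r : ℤ} (h : q + 1 = r) (t : LT.deg A X.toGrMod q) :
    (id (((Lobj X).d q r).hom t) : LT.deg A X.toGrMod r).1 = LT.d X.m t.1 := by
  rw [Lobj_d X h]
  rfl

theorem degProj_sumL (q : ℤ) (s : (grUnderlying (Lobj X)).Tot) :
    LT.degProj A X.toGrMod q (sumL X s) = valL X q ((grUnderlying (Lobj X)).proj q s) := by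
  suffices (LT.degProj A X.toGrMod q).toAddMonoidHom.comp (sumL X) =
      (valL X q).comp ((grUnderlying (Lobj X)).proj q).toAddMonoidHom from
    DFunLike.congr_fun this s
  refine GrMod.hom_ext _ fun p z => ?_
  change LT.degProj A X.toGrMod q (sumL X _) =
    valL X q ((grUnderlying (Lobj X)).proj q ((grUnderlying (Lobj X)).inc p z))
  rw [sumL_inc', LT.degProj_of_mem (valL_mem X p z)]
  split_ifs with h
  · subst h
    rw [GrMod.proj_inc]
  · rw [GrMod.proj_inc_ne _ h, map_zero]

/-- The degrees of `L X` are independent, so its total module embeds into `A ⊗ T(A) ⊗ X`. -/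
theorem sumL_injective : Function.Injective (sumL X) := by
  refine (injective_iff_map_eq_zero _).2 fun s hs => DFinsupp.ext fun q => ?_
  have h := degProj_sumL X q s
  rw [hs, map_zero] at h
  exact (valL_injective X q) (h.symm.trans (map_zero _).symm)

end BarOperators

/-! ### The counit and the adjunction between `L` and `R` -/

section Counit

variable {k : Type u} {A B : Type u} [CommRing k] [Ring A] [Algebra k A] [Ring B] [Algebra k B]
variable (Y : BimodCx k A B)

/-- The `k`-bilinear map `(a, y) ↦ a y` on total modules. -/
def totActBilin : A →ₗ[k] (grUnderlying Y).Tot →ₗ[k] (grUnderlying Y).Tot :=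
  LinearMap.mk₂ k (fun a y => totAct Y a y)
    (fun a b y => LinearMap.congr_fun ((isMultilinear_actFn Y).add [] [] a b) y)
    (fun c a y => LinearMap.congr_fun ((isMultilinear_actFn Y).smul [] [] c a) y)
    (fun _ y z => map_add _ y z)
    (fun c _ y => LinearMap.map_smul_of_tower _ c y)

/-- The augmentation `A ⊗ T(A) ⊗ Y → Y` of the bar construction on total modules: `a ⊗ 1 ⊗ y` is
mapped to `a y`, and `a ⊗ w ⊗ y` to `0` if `w` has positive length. -/
def augTot : LT A (grUnderlying Y) →ₗ[k] (grUnderlying Y).Tot :=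
  LT.lift (strictFn (totActBilin Y)) (isMultilinear_strictFn _)

theorem augTot_comp_E (a : A) (l : List A) :
    (augTot Y).toAddMonoidHom.comp (LT.E (grUnderlying Y) a l) =
      strictFn (totAct Y a).toAddMonoidHom l := by
  refine AddMonoidHom.ext fun y => ?_
  refine (LT.lift_E _ (isMultilinear_strictFn (totActBilin Y)) a l y).trans ?_
  rcases l with _ | ⟨b, l⟩ <;> rfl

theorem augTot_E (a : A) (l : List A) (y : (grUnderlying Y).Tot) :
    augTot Y (LT.E (grUnderlying Y) a l y) = strictFn (totAct Y a).toAddMonoidHom l y :=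
  DFunLike.congr_fun (augTot_comp_E Y a l) y

/-- The augmentation is a chain map: on words of length `0` and `1` this is the Leibniz rule and
associativity of the action, and on longer words both sides vanish. -/
theorem augTot_d (t : LT A (grUnderlying Y)) :
    augTot Y (LT.d (actSeq Y) t) = totD Y (augTot Y t) := by
  suffices (augTot Y).toAddMonoidHom.comp (LT.d (actSeq Y)).toAddMonoidHom =
      (totD Y).toAddMonoidHom.comp (augTot Y).toAddMonoidHom from DFunLike.congr_fun this t
  refine LT.hom_ext fun a l => ?_
  rw [AddMonoidHom.comp_assoc, AddMonoidHom.comp_assoc, LT.d_comp_E, augTot_comp_E,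
    AddMonoidHom.comp_add, AddMonoidHom.comp_add, ← barD_comp, ← conv_comp_left]
  have e1 : (fun t => (augTot Y).toAddMonoidHom.comp (LT.E (grUnderlying Y) a t)) =
      strictFn (totAct Y a).toAddMonoidHom := funext fun l => augTot_comp_E Y a l
  have e2 : (fun t => (augTot Y).toAddMonoidHom.comp (sgn (LT.E (grUnderlying Y) a) t)) =
      strictFn (totAct Y a).toAddMonoidHom := by
    rw [← sgn_strictFn, ← e1]
    funext t
    refine AddMonoidHom.ext fun y => ?_
    simp [sgn]
  rw [e1, e2, barD_strictFn, conv_strict_left, add_zero]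
  refine AddMonoidHom.ext fun y => ?_
  change augTot Y (-(headMul (LT.E (grUnderlying Y)) a l y)) + totAct Y a (actSeq Y (word k l) y) =
    totD Y (strictFn (totAct Y a).toAddMonoidHom l y)
  rw [map_neg, actSeq_word]
  rcases l with _ | ⟨b, l⟩
  · simp only [headMul, actFn, strictFn]
    change -augTot Y 0 + totAct Y a (totD Y y) = totD Y (totAct Y a y)
    rw [map_zero, neg_zero, zero_add, totD_totAct]
  · simp only [headMul, augTot_E]
    rcases l with _ | ⟨c, l⟩
    · simp only [strictFn, actFn]
      change -totAct Y (a * b) y + totAct Y a (totAct Y b y) = totD Y 0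
      rw [totAct_mul, map_zero, neg_add_cancel]
    · simp [strictFn, actFn]

theorem augTot_mem {q : ℤ} {t : LT A (grUnderlying Y)} (ht : t ∈ LT.deg A (grUnderlying Y) q) :
    augTot Y t ∈ (grUnderlying Y).deg q := by
  have h : augTot Y (LT.degProj A (grUnderlying Y) q t) ∈ (grUnderlying Y).deg q := by
    refine LT.mem_of_E (((grUnderlying Y).deg q).toAddSubgroup.comap
      ((augTot Y).toAddMonoidHom.comp (LT.degProj A (grUnderlying Y) q).toAddMonoidHom))
      (fun a l y => ?_) t
    change augTot Y (LT.byLength _ (LT.E _ a l y)) ∈ (grUnderlying Y).deg q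
    rw [LT.byLength_E, augTot_E]
    rcases l with _ | ⟨b, l⟩
    · change totAct Y a ((grUnderlying Y).inc _ _) ∈ _
      have h0 : (grUnderlying Y).deg q = (grUnderlying Y).deg (q + (([] : List A).length : ℤ)) :=
        congrArg _ (by simp)
      rw [totAct_inc, h0]
      exact GrMod.inc_mem _ _ _
    · exact zero_mem _
  rwa [LT.degProj_of_mem ht, if_pos rfl] at h

theorem proj_totAct (a : A) (q : ℤ) (t : (grUnderlying Y).Tot) :
    (grUnderlying Y).proj q (totAct Y a t) = actLin Y q a ((grUnderlying Y).proj q t) := by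
  suffices (grUnderlying Y).proj q ∘ₗ totAct Y a = actLin Y q a ∘ₗ (grUnderlying Y).proj q from
    LinearMap.congr_fun this t
  refine LinearMap.toAddMonoidHom_injective (GrMod.hom_ext _ fun p y => ?_)
  change (grUnderlying Y).proj q (totAct Y a ((grUnderlying Y).inc p y)) =
    actLin Y q a ((grUnderlying Y).proj q ((grUnderlying Y).inc p y))
  rw [totAct_inc]
  by_cases h : p = q
  · subst h
    rw [GrMod.proj_inc, GrMod.proj_inc]
  · rw [GrMod.proj_inc_ne _ h, GrMod.proj_inc_ne _ h, map_zero]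

theorem totAct_one : (totAct Y 1).toAddMonoidHom = AddMonoidHom.id (grUnderlying Y).Tot :=
  GrMod.hom_ext _ fun p y => by
    change totAct Y 1 ((grUnderlying Y).inc p y) = (grUnderlying Y).inc p y
    rw [totAct_inc]
    exact congrArg _ (one_smul (A ⊗[k] Bᵐᵒᵖ) (id y : Y.X p))

/-- The component of degree `q` of the augmentation. -/
def augAdd (q : ℤ) : LT A (grUnderlying Y) →+ Y.X q :=
  AddMonoidHom.comp (N := (grUnderlying Y).X q)
    (AddMonoidHom.id ((grUnderlying Y).X q) : (grUnderlying Y).X q →+ Y.X q)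
    (((grUnderlying Y).proj q).toAddMonoidHom.comp (augTot Y).toAddMonoidHom)

theorem augAdd_apply (q : ℤ) (t : LT A (grUnderlying Y)) :
    augAdd Y q t = (grUnderlying Y).proj q (augTot Y t) := rfl

/-- The component of degree `q` of the augmentation, as a morphism of bimodules. -/
def aug (q : ℤ) : LT A (grUnderlying Y) →ₗ[A ⊗[k] Bᵐᵒᵖ] Y.X q where
  toFun := augAdd Y q
  map_add' := map_add _
  map_smul' := LT.map_smul_of (augAdd Y q) fun a b a₀ l y => by
    rw [augAdd_apply, augAdd_apply, augTot_E, augTot_E]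
    rcases l with _ | ⟨c, l⟩
    · change (grUnderlying Y).proj q (totAct Y (a * a₀) (b • y)) =
        (a ⊗ₜ[k] b) • (id ((grUnderlying Y).proj q (totAct Y a₀ y)) : Y.X q)
      rw [proj_totAct, proj_totAct, map_smul]
      change ((a * a₀) ⊗ₜ[k] (1 : Bᵐᵒᵖ)) • ((1 : A) ⊗ₜ[k] b) •
          (id ((grUnderlying Y).proj q y) : Y.X q) =
        (a ⊗ₜ[k] b) • (a₀ ⊗ₜ[k] (1 : Bᵐᵒᵖ)) • (id ((grUnderlying Y).proj q y) : Y.X q)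
      rw [smul_smul, smul_smul]
      simp
    · change (grUnderlying Y).proj q 0 = (a ⊗ₜ[k] b) • (id ((grUnderlying Y).proj q 0) : Y.X q)
      rw [map_zero]
      exact (smul_zero (A := Y.X q) _).symm

theorem inc_aug {q : ℤ} {t : LT A (grUnderlying Y)} (ht : t ∈ LT.deg A (grUnderlying Y) q) :
    (grUnderlying Y).inc q (aug Y q t) = augTot Y t :=
  GrMod.inc_proj _ _ _ (augTot_mem Y ht)

/-- The counit `L R Y → Y`: the augmentation of the bar resolution of `Y`. -/
def counit : (L k A B).obj ((R k A B).obj Y) ⟶ Y where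
  f q := ModuleCat.ofHom (aug Y q ∘ₗ (LT.deg A (grUnderlying Y) q).subtype)
  comm' q r h := by
    have h : q + 1 = r := h
    subst h
    change _ = (Lobj (Robj Y)).d q (q + 1) ≫ _
    rw [Lobj_d _ rfl]
    ext t
    apply GrMod.inc_injective (grUnderlying Y) (q + 1)
    refine (totD_inc Y q _).symm.trans ?_
    refine (congrArg (totD Y) (inc_aug Y t.2)).trans ?_
    refine ((augTot_d Y t.1).symm).trans ?_
    exact (inc_aug Y (LT.d_mem_deg (Robj Y).deg_m rfl t.2)).symm

theorem totMap_counit (t : (grUnderlying (Lobj (Robj Y))).Tot) :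
    totMap (counit Y) t = augTot Y (sumL (Robj Y) t) := by
  suffices (totMap (counit Y)).toAddMonoidHom =
      (augTot Y).toAddMonoidHom.comp (sumL (Robj Y)) from DFunLike.congr_fun this t
  refine GrMod.hom_ext _ fun q z => ?_
  refine (totMap_inc (counit Y) q z).trans ?_
  refine (inc_aug Y (valL_mem (Robj Y) q z)).trans ?_
  exact congrArg (augTot Y) (sumL_inc' (Robj Y) q z).symm

theorem augTot_map {Y Z : BimodCx k A B} (g : Y ⟶ Z) (t : LT A (grUnderlying Y)) :
    augTot Z (LT.map (Seq.strict (totMap g)) t) = totMap g (augTot Y t) := by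
  suffices (augTot Z).toAddMonoidHom.comp (LT.map (Seq.strict (totMap g))).toAddMonoidHom =
      (totMap g).toAddMonoidHom.comp (augTot Y).toAddMonoidHom from DFunLike.congr_fun this t
  refine LT.hom_ext fun a l => ?_
  rw [AddMonoidHom.comp_assoc, AddMonoidHom.comp_assoc, LT.map_comp_E, augTot_comp_E,
    Seq.strict_fn, conv_strict_right, ← AddMonoidHom.comp_assoc, augTot_comp_E]
  refine AddMonoidHom.ext fun y => ?_
  rcases l with _ | ⟨b, l⟩
  · exact (totMap_totAct g a y).symm
  · exact (map_zero (totMap g)).symm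

theorem counit_naturality {Y Z : BimodCx k A B} (g : Y ⟶ Z) :
    (L k A B).map ((R k A B).map g) ≫ counit Z = counit Y ≫ g := by
  ext q t
  apply GrMod.inc_injective (grUnderlying Z) q
  refine (inc_aug Z (LT.map_mem_deg (Rmap g).deg_f t.2)).trans ?_
  refine (augTot_map g t.1).trans ?_
  refine (congrArg (totMap g) (inc_aug Y t.2)).symm.trans ?_
  exact totMap_inc g q _

end Counit

section Adjunction

variable {k : Type u} {A B : Type u} [CommRing k] [Ring A] [Algebra k A] [Ring B] [Algebra k B]

theorem sumL_totMap {X Y : ShMod k A B} (f : X ⟶ Y) (t : (grUnderlying (Lobj X)).Tot) :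
    sumL Y (totMap (Lmap f) t) = LT.map f.f (sumL X t) := by
  suffices (sumL Y).comp (totMap (Lmap f)).toAddMonoidHom =
      (LT.map f.f).toAddMonoidHom.comp (sumL X) from DFunLike.congr_fun this t
  refine GrMod.hom_ext _ fun q z => ?_
  change sumL Y (totMap (Lmap f) ((grUnderlying (Lobj X)).inc q z)) =
    LT.map f.f (sumL X ((grUnderlying (Lobj X)).inc q z))
  rw [totMap_inc, sumL_inc', sumL_inc']
  rfl

theorem sumL_comp_unitSeq (X : ShMod k A B) (l : List A) :
    (sumL X).comp ((unitSeq X).fn l) = LT.E X.toGrMod 1 l :=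
  AddMonoidHom.ext fun t => sumL_unitSeq X l t

theorem unit_naturality {X Y : ShMod k A B} (f : X ⟶ Y) :
    f ≫ unit Y = unit X ≫ (R k A B).map ((L k A B).map f) := by
  refine ShMod.hom_ext fun l => ?_
  rw [ShMod.comp_fn, ShMod.comp_fn]
  refine AddMonoidHom.ext fun x => sumL_injective Y ?_
  have e1 : (sumL Y).comp (conv (unitSeq Y).fn f.f.fn l) = conv (LT.E Y.toGrMod 1) f.f.fn l := by
    rw [← conv_comp_left]
    congr 1
    exact funext fun l => sumL_comp_unitSeq Y l
  have e2 : conv ((R k A B).map ((L k A B).map f)).f.fn (unit X).f.fn l x =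
      totMap (Lmap f) ((unitSeq X).fn l x) := by
    change conv (Seq.strict (totMap (Lmap f))).fn (unitSeq X).fn l x = _
    rw [Seq.strict_fn, conv_strict_left]
    rfl
  rw [e2]
  refine (DFunLike.congr_fun e1 x).trans ?_
  rw [sumL_totMap, sumL_unitSeq, LT.map_E]

/-- On generators, this triangle identity is `a · η(w, x) = a ⊗ w ⊗ x`. -/
theorem left_triangle (X : ShMod k A B) :
    (L k A B).map (unit X) ≫ counit ((L k A B).obj X) = 𝟙 _ := by
  ext q t
  apply GrMod.inc_injective (grUnderlying (Lobj X)) q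
  refine (inc_aug (Lobj X) (LT.map_mem_deg (unit X).deg_f t.2)).trans ?_
  apply sumL_injective X
  refine Eq.trans ?_ (sumL_inc' X q t).symm
  suffices ((sumL X).comp (augTot (Lobj X)).toAddMonoidHom).comp
      (LT.map (unitSeq X)).toAddMonoidHom = AddMonoidHom.id _ from DFunLike.congr_fun this t.1
  refine LT.hom_ext fun a l => ?_
  rw [AddMonoidHom.comp_assoc, LT.map_comp_E, ← conv_comp_left]
  have e : (fun l => ((sumL X).comp (augTot (Lobj X)).toAddMonoidHom).comp
      (LT.E (grUnderlying (Lobj X)) a l)) =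
      strictFn ((sumL X).comp (totAct (Lobj X) a).toAddMonoidHom) := by
    funext l
    rw [AddMonoidHom.comp_assoc, augTot_comp_E]
    rcases l with _ | ⟨b, l⟩
    · rfl
    · exact AddMonoidHom.comp_zero _
  rw [e, conv_strict_left]
  refine AddMonoidHom.ext fun x => ?_
  change sumL X (totAct (Lobj X) a ((unitSeq X).fn l x)) = LT.E X.toGrMod a l x
  rw [sumL_totAct, sumL_unitSeq]
  have := LT.E_smul a (1 : Bᵐᵒᵖ) 1 l x
  rw [mul_one, one_smul] at this
  exact this.symm

theorem right_triangle (Y : BimodCx k A B) :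
    unit ((R k A B).obj Y) ≫ (R k A B).map (counit Y) = 𝟙 _ := by
  refine ShMod.hom_ext fun l => ?_
  rw [ShMod.comp_fn, ShMod.id_fn]
  change conv (Seq.strict (totMap (counit Y))).fn (unitSeq (Robj Y)).fn l = _
  rw [Seq.strict_fn]
  refine (conv_strict_left (totMap (counit Y)).toAddMonoidHom (unitSeq (Robj Y)).fn l).trans ?_
  refine AddMonoidHom.ext fun y => ?_
  refine (totMap_counit Y _).trans ?_
  refine (congrArg (augTot Y) (sumL_unitSeq (Robj Y) l y)).trans ?_
  refine (augTot_E Y 1 l y).trans ?_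
  rw [totAct_one]
  rfl

variable (k A B) in
/-- The adjunction between `L` and `R`. -/
def adj : L k A B ⊣ R k A B :=
  Adjunction.mkOfUnitCounit
    { unit := { app := unit, naturality := fun _ _ f => unit_naturality f }
      counit := { app := counit, naturality := fun _ _ g => counit_naturality g }
      left_triangle := by
        ext X : 2
        refine Eq.trans ?_ (left_triangle X)
        change _ ≫ 𝟙 _ ≫ _ = _
        rw [Category.id_comp]
        rfl
      right_triangle := by
        ext Y : 2
        refine Eq.trans ?_ (right_triangle Y)
        change _ ≫ 𝟙 _ ≫ _ = _
        rw [Category.id_comp]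
        rfl }

end Adjunction

/-! ### Mapping cones in terms of elements, and exactness of the bar resolution -/

section Lifting

/-- The elementwise form of "the mapping cone of `φ` is acyclic", for an additive map `φ` between
additive groups with endomorphisms `d` and `d'`. The equation `φ w = d' z` says that `(w, z)` is a
cycle of the cone up to the sign of `z`, and the conclusion that it is a boundary. -/
def ConeExact {M N : Type*} [AddCommGroup M] [AddCommGroup N] (φ : M →+ N) (d : M →+ M)
    (d' : N →+ N) : Prop :=
  ∀ (w : M) (z : N), d w = 0 → φ w = d' z → ∃ (y : M) (v : N), d y = w ∧ z = φ y + d' v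

variable {S : Type u} [Ring S] {C D : CochainComplex (ModuleCat.{u} S) ℤ}

/-- A morphism of complexes of modules is a quasi-isomorphism if and only if its mapping cone
is acyclic, in terms of elements. -/
theorem quasiIso_iff_coneExact (φ : C ⟶ D) :
    QuasiIso φ ↔ ∀ (q : ℤ) (w : C.X (q + 1)) (z : D.X q), (C.d (q + 1) (q + 1 + 1)).hom w = 0 →
      (φ.f (q + 1)).hom w = (D.d q (q + 1)).hom z →
      ∃ (y : C.X q) (v : D.X (q - 1)), (C.d q (q + 1)).hom y = w ∧
        z = (φ.f q).hom y + (D.d (q - 1) q).hom v := by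
  have hp : ∀ j : ℤ, (ComplexShape.up ℤ).prev j = j - 1 := fun j =>
    (ComplexShape.up ℤ).prev_eq' (by simp)
  have hn : ∀ j : ℤ, (ComplexShape.up ℤ).next j = j + 1 := fun j =>
    (ComplexShape.up ℤ).next_eq' (by simp)
  have hp' : ∀ j : ℤ, (ComplexShape.up ℤ).prev (j + 1) = j := fun j =>
    (ComplexShape.up ℤ).prev_eq' (by simp)
  constructor
  · intro hφ q w z hw hwz
    have hm : Mono (HomologicalComplex.homologyMap φ (q + 1)) := inferInstance
    have he : Epi (HomologicalComplex.homologyMap φ q) := inferInstance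
    rw [HomologicalComplex.mono_homologyMap_iff_up_to_refinements φ q (q + 1) (q + 1 + 1)
      (hp' q) (hn _)] at hm
    rw [HomologicalComplex.epi_homologyMap_iff_up_to_refinements φ (q - 1) q (q + 1)
      (hp q) (hn _)] at he
    -- Elements are morphisms from `S`; a refinement `π` of `S` is surjective, so evaluating at a
    -- preimage of `1` turns each lifting property into one for elements.
    obtain ⟨A', π, hπ, y₁, hy₁⟩ := hm (A := ModuleCat.of S S)
      (ModuleCat.ofHom (LinearMap.toSpanSingleton S _ w))
      (by ext; simpa using hw) (ModuleCat.ofHom (LinearMap.toSpanSingleton S _ z))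
      (by ext; simpa using hwz)
    obtain ⟨a, ha⟩ := (ModuleCat.epi_iff_surjective π).1 hπ (1 : S)
    have h1 : (C.d q (q + 1)).hom (y₁.hom a) = w := by
      have := congrArg (fun f => f.hom a) hy₁
      simp only [ModuleCat.hom_comp, LinearMap.comp_apply, ModuleCat.hom_ofHom] at this
      rw [← this]
      erw [ha]
      simp
    obtain ⟨A'', π', hπ', x, hx, v, hv⟩ := he (A := ModuleCat.of S S)
      (ModuleCat.ofHom (LinearMap.toSpanSingleton S _ (z - (φ.f q).hom (y₁.hom a)))) (by
        ext
        have h2 : (D.d q (q + 1)).hom ((φ.f q).hom (y₁.hom a)) =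
            (φ.f (q + 1)).hom ((C.d q (q + 1)).hom (y₁.hom a)) :=
          congrArg (fun f => f.hom (y₁.hom a)) (φ.comm q (q + 1))
        simp [h2, h1, hwz])
    obtain ⟨b, hb⟩ := (ModuleCat.epi_iff_surjective π').1 hπ' (1 : S)
    refine ⟨y₁.hom a + x.hom b, v.hom b, ?_, ?_⟩
    · have := congrArg (fun f => f.hom b) hx
      simp only [ModuleCat.hom_comp, LinearMap.comp_apply] at this
      rw [map_add, h1, this]
      simp
    · have := congrArg (fun f => f.hom b) hv
      simp only [ModuleCat.hom_comp, LinearMap.comp_apply, ModuleCat.hom_ofHom,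
        ModuleCat.hom_add, LinearMap.add_apply] at this
      erw [hb] at this
      rw [LinearMap.toSpanSingleton_apply, one_smul, sub_eq_iff_eq_add] at this
      rw [this, map_add]
      abel
  · intro h
    refine ⟨fun j => ?_⟩
    rw [quasiIsoAt_iff_isIso_homologyMap]
    have hm : Mono (HomologicalComplex.homologyMap φ j) := by
      obtain ⟨i, rfl⟩ : ∃ i, j = i + 1 := ⟨j - 1, by omega⟩
      rw [HomologicalComplex.mono_homologyMap_iff_up_to_refinements φ i (i + 1) (i + 1 + 1)
        (hp' i) (hn _)]
      intro A x hx y hxy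
      -- The refinement is the module of all pairs of a point and a lift of its image.
      let P : Submodule S (A × C.X i) := LinearMap.ker
        (x.hom ∘ₗ LinearMap.fst S A (C.X i) - (C.d i (i + 1)).hom ∘ₗ LinearMap.snd S A (C.X i))
      refine ⟨ModuleCat.of S P, ModuleCat.ofHom (LinearMap.fst S A (C.X i) ∘ₗ P.subtype),
        (ModuleCat.epi_iff_surjective _).2 fun a => ?_,
        ModuleCat.ofHom (LinearMap.snd S A (C.X i) ∘ₗ P.subtype), ?_⟩
      · obtain ⟨u, -, hu, -⟩ := h i (x.hom a) (y.hom a) (congrArg (fun f => f.hom a) hx)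
          (congrArg (fun f => f.hom a) hxy)
        exact ⟨⟨(a, u), by simp [P, hu]⟩, rfl⟩
      · ext p
        have := p.2
        simp only [P, LinearMap.mem_ker, LinearMap.sub_apply, sub_eq_zero] at this
        exact this
    have he : Epi (HomologicalComplex.homologyMap φ j) := by
      rw [HomologicalComplex.epi_homologyMap_iff_up_to_refinements φ (j - 1) j (j + 1)
        (hp j) (hn _)]
      intro A z hz
      let F : A × C.X j × D.X (j - 1) →ₗ[S] D.X j :=
        z.hom ∘ₗ LinearMap.fst S _ _ - (φ.f j).hom ∘ₗ LinearMap.fst S _ _ ∘ₗ LinearMap.snd S _ _ -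
          (D.d (j - 1) j).hom ∘ₗ LinearMap.snd S _ _ ∘ₗ LinearMap.snd S _ _
      let G : A × C.X j × D.X (j - 1) →ₗ[S] C.X (j + 1) :=
        (C.d j (j + 1)).hom ∘ₗ LinearMap.fst S _ _ ∘ₗ LinearMap.snd S _ _
      let P := LinearMap.ker F ⊓ LinearMap.ker G
      refine ⟨ModuleCat.of S P, ModuleCat.ofHom (LinearMap.fst S _ _ ∘ₗ P.subtype),
        (ModuleCat.epi_iff_surjective _).2 fun a => ?_,
        ModuleCat.ofHom (LinearMap.fst S _ _ ∘ₗ LinearMap.snd S _ _ ∘ₗ P.subtype), ?_,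
        ModuleCat.ofHom (LinearMap.snd S _ _ ∘ₗ LinearMap.snd S _ _ ∘ₗ P.subtype), ?_⟩
      · obtain ⟨u, v, hu, hv⟩ := h j 0 (z.hom a) (map_zero _)
          ((map_zero _).trans (congrArg (fun f => f.hom a) hz).symm)
        exact ⟨⟨(a, u, v), by simp [P, F, G, hu, hv]⟩, rfl⟩
      · ext p
        exact p.2.2
      · ext p
        have := LinearMap.mem_ker.1 p.2.1
        simp only [F, LinearMap.sub_apply, sub_sub, sub_eq_zero] at this
        exact this
    exact isIso_of_mono_of_epi _

end Lifting

section BarResolution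

variable {k : Type u} {A B : Type u} [CommRing k] [Ring A] [Algebra k A] [Ring B] [Algebra k B]

/-- The multilinear function underlying `LT.cons`. -/
def LT.consFn (X : GrMod k B) (l : List A) : A →ₗ[k] X.Tot →ₗ[k] LT A X :=
  LT.elt X 1 ∘ₗ LinearMap.mulRight k (word k l) ∘ₗ TensorAlgebra.ι k

theorem LT.isMultilinear_consFn (X : GrMod k B) : IsMultilinear k (LT.consFn (A := A) X) where
  add u v a b := by
    refine LinearMap.ext fun c => ?_
    simp [LT.consFn, (isMultilinear_word k).add, mul_add]
  smul u v r a := by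
    refine LinearMap.ext fun c => ?_
    simp [LT.consFn, (isMultilinear_word k).smul]

/-- The map `a ⊗ (a₁ ⊗ ⋯ ⊗ aₙ) ⊗ x ↦ 1 ⊗ (a ⊗ a₁ ⊗ ⋯ ⊗ aₙ) ⊗ x`. -/
def LT.cons (X : GrMod k B) : LT A X →ₗ[k] LT A X :=
  LT.lift (LT.consFn X) (LT.isMultilinear_consFn X)

theorem LT.cons_comp_E (X : GrMod k B) (a : A) (l : List A) :
    (LT.cons X).toAddMonoidHom.comp (LT.E X a l) = LT.E X 1 (a :: l) := by
  refine AddMonoidHom.ext fun x => ?_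
  refine (LT.lift_E _ (LT.isMultilinear_consFn X) a l x).trans ?_
  rw [LT.E_apply, word_cons]
  rfl

theorem LT.cons_mem {X : GrMod k B} {q r : ℤ} (h : r + 1 = q) {t : LT A X}
    (ht : t ∈ LT.deg A X q) : LT.cons X t ∈ LT.deg A X r := by
  have h' : LT.cons X (LT.degProj A X q t) ∈ LT.deg A X r := by
    refine LT.mem_of_E ((LT.deg A X r).toAddSubgroup.comap
      ((LT.cons X).toAddMonoidHom.comp (LT.degProj A X q).toAddMonoidHom)) (fun a l x => ?_) t
    change LT.cons X (LT.byLength _ (LT.E X a l x)) ∈ LT.deg A X r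
    rw [LT.byLength_E]
    change (LT.cons X).toAddMonoidHom.comp (LT.E X a l) _ ∈ _
    rw [LT.cons_comp_E]
    exact LT.E_mem_deg _ _ (X.inc_mem _ _) (by simp; omega)
  rwa [LT.degProj_of_mem ht, if_pos rfl] at h'

/-- The map `LT.cons` is, up to sign, a contracting homotopy of the augmented bar resolution
of a complex of bimodules. -/
theorem LT.d_cons (Y : BimodCx k A B) (t : LT A (grUnderlying Y)) :
    LT.d (actSeq Y) (LT.cons _ t) + LT.cons _ (LT.d (actSeq Y) t) =
      LT.E (grUnderlying Y) 1 [] (augTot Y t) - t := by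
  suffices (LT.d (actSeq Y)).toAddMonoidHom.comp (LT.cons (grUnderlying Y)).toAddMonoidHom +
      (LT.cons (grUnderlying Y)).toAddMonoidHom.comp (LT.d (actSeq Y)).toAddMonoidHom =
      (LT.E (grUnderlying Y) 1 []).comp (augTot Y).toAddMonoidHom -
        AddMonoidHom.id (LT A (grUnderlying Y)) from
    DFunLike.congr_fun this t
  refine LT.hom_ext fun a l => ?_
  set D := (LT.d (actSeq Y)).toAddMonoidHom with hD
  set H := (LT.cons (A := A) (grUnderlying Y)).toAddMonoidHom with hH
  set m := (actSeq Y).fn with hm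
  have hc : (fun l => H.comp (LT.E (grUnderlying Y) a l)) = pre a (LT.E (grUnderlying Y) 1) :=
    funext fun l => LT.cons_comp_E (grUnderlying Y) a l
  -- `e3` and `e4` split off the terms of the differential of `1 ⊗ (a, l) ⊗ x` which involve the
  -- first letter `a`; the remaining ones are cancelled by `cons (d (a ⊗ l ⊗ x))`.
  have e1 : D.comp (H.comp (LT.E (grUnderlying Y) a l)) =
      -LT.E (grUnderlying Y) a l + barD (LT.E (grUnderlying Y) 1) (a :: l) +
        conv (sgn (LT.E (grUnderlying Y) 1)) m (a :: l) := by
    rw [hH, LT.cons_comp_E, hD, LT.d_comp_E]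
    simp only [headMul, one_mul]
    rfl
  have e2 : H.comp (D.comp (LT.E (grUnderlying Y) a l)) =
      -(H.comp (headMul (LT.E (grUnderlying Y)) a l)) + barD (pre a (LT.E (grUnderlying Y) 1)) l +
        conv (sgn (pre a (LT.E (grUnderlying Y) 1))) m l := by
    have s : (fun l => H.comp (sgn (LT.E (grUnderlying Y) a) l)) =
        sgn (pre a (LT.E (grUnderlying Y) 1)) := by
      rw [← hc]
      funext l
      refine AddMonoidHom.ext fun x => ?_
      simp [sgn]
    rw [hD, LT.d_comp_E, AddMonoidHom.comp_add, AddMonoidHom.comp_add, AddMonoidHom.comp_neg,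
      ← barD_comp, ← conv_comp_left, hc, s]
  have e3 : barD (LT.E (grUnderlying Y) 1) (a :: l) = H.comp (headMul (LT.E (grUnderlying Y)) a l) -
      barD (pre a (LT.E (grUnderlying Y) 1)) l := by
    rcases l with _ | ⟨b, l⟩
    · rw [barD_single, barD_nil, sub_zero]
      exact (AddMonoidHom.comp_zero _).symm
    · rw [barD_cons]
      exact congrArg (fun u => u - _) (LT.cons_comp_E (grUnderlying Y) (a * b) l).symm
  have e4 : conv (sgn (LT.E (grUnderlying Y) 1)) m (a :: l) =
      (LT.E (grUnderlying Y) 1 []).comp (strictFn (totAct Y a).toAddMonoidHom l) -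
        conv (sgn (pre a (LT.E (grUnderlying Y) 1))) m l := by
    rw [conv_cons, pre_sgn, conv_neg_left, ← sub_eq_add_neg, ← pre_actSeq]
    simp [sgn, pre, hm]
  rw [AddMonoidHom.add_comp, AddMonoidHom.comp_assoc, AddMonoidHom.comp_assoc, e1, e2, e3, e4,
    AddMonoidHom.sub_comp, AddMonoidHom.comp_assoc, augTot_comp_E, AddMonoidHom.id_comp]
  abel

/-- The augmented bar resolution is exact. -/
theorem quasiIso_counit (Y : BimodCx k A B) : QuasiIso (counit Y) := by
  refine (quasiIso_iff_coneExact _).2 fun q w z hw hwz => ?_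
  obtain ⟨w, hwd⟩ : ∃ w' : LT.deg A (grUnderlying Y) (q + 1), w' = w := ⟨w, rfl⟩
  obtain ⟨z, hzd⟩ : ∃ z' : (grUnderlying Y).X q, z' = z := ⟨z, rfl⟩
  subst hwd hzd
  have hw' : LT.d (actSeq Y) w.1 = 0 :=
    (Lobj_d_apply (Robj Y) rfl w).symm.trans (congrArg Subtype.val hw)
  have haug : augTot Y w.1 = totD Y ((grUnderlying Y).inc q z) := by
    rw [totD_inc, ← inc_aug Y w.2]
    exact congrArg ((grUnderlying Y).inc (q + 1)) hwz
  -- The lift of `z` along the augmentation given by `1 ⊗ 1 ⊗ z` is corrected by the value of the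
  -- contracting homotopy on `w` to have the prescribed differential; no error term `v` remains.
  have key := LT.d_cons Y w.1
  have hs : ∀ z', LT.d (actSeq Y) (LT.E (grUnderlying Y) 1 [] z') =
      LT.E (grUnderlying Y) 1 [] (totD Y z') := by
    intro z'
    rw [LT.d_E]
    simp only [headMul, barD_nil, conv_nil, sgn, List.length_nil, pow_zero, one_smul, actSeq_nil]
    simp
  let y : LT A (grUnderlying Y) :=
    LT.E (grUnderlying Y) 1 [] ((grUnderlying Y).inc q z) - LT.cons _ w.1
  have hy : y ∈ LT.deg A (grUnderlying Y) q :=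
    sub_mem (LT.E_mem_deg _ _ (GrMod.inc_mem _ q z) (by simp)) (LT.cons_mem rfl w.2)
  have hdy : LT.d (actSeq Y) y = w.1 := by
    rw [hw', map_zero, add_zero, haug] at key
    simp only [y]
    rw [map_sub, hs, key]
    abel
  have hay : augTot Y y = (grUnderlying Y).inc q z := by
    have h1 : ∀ t, augTot Y (LT.cons _ t) = 0 := fun t => by
      suffices (augTot Y).toAddMonoidHom.comp (LT.cons _).toAddMonoidHom = 0 from
        DFunLike.congr_fun this t
      refine LT.hom_ext fun a l => ?_
      rw [AddMonoidHom.comp_assoc, LT.cons_comp_E, augTot_comp_E]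
      rfl
    have h2 : (totAct Y 1).toAddMonoidHom = AddMonoidHom.id _ := totAct_one Y
    simp only [y]
    rw [map_sub, h1, sub_zero, augTot_E, strictFn, h2, AddMonoidHom.id_apply]
  refine ⟨(⟨y, hy⟩ : LT.deg A (grUnderlying Y) q), 0, ?_, ?_⟩
  · exact Subtype.ext ((Lobj_d_apply (Robj Y) rfl ⟨y, hy⟩).trans hdy)
  · rw [map_zero, add_zero]
    apply GrMod.inc_injective (grUnderlying Y) q
    exact hay.symm.trans (inc_aug Y hy).symm

end BarResolution

/-! ### Flatness and cones on total modules -/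

section Flatness

variable {k : Type u} [CommRing k]

/-- The tensor algebra of a projective module is projective, being a retract of the tensor
algebra of a free module. -/
theorem projective_tensorAlgebra (M : Type u) [AddCommGroup M] [Module k M]
    [Module.Projective k M] : Module.Projective k (TensorAlgebra k M) := by
  obtain ⟨s, hs⟩ := Module.Projective.out (R := k) (P := M)
  let p : (M →₀ k) →ₗ[k] M := Finsupp.linearCombination k id
  let i := TensorAlgebra.lift k (TensorAlgebra.ι k ∘ₗ s)
  let r := TensorAlgebra.lift k (TensorAlgebra.ι k ∘ₗ p)
  have h : r.comp i = AlgHom.id k (TensorAlgebra k M) := by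
    ext x
    simp [i, r, p, hs x]
  exact Module.Projective.of_split i.toLinearMap r.toLinearMap
    (LinearMap.ext fun x => DFunLike.congr_fun h x)

/-- Tensoring with a flat module preserves acyclicity of mapping cones. -/
theorem ConeExact.lTensor {P M N : Type u} [AddCommGroup P] [Module k P] [Module.Flat k P]
    [AddCommGroup M] [Module k M] [AddCommGroup N] [Module k N]
    {φ : M →ₗ[k] N} {d : M →ₗ[k] M} {d' : N →ₗ[k] N} (hd : d ∘ₗ d = 0) (hd' : d' ∘ₗ d' = 0)
    (hφ : φ ∘ₗ d = d' ∘ₗ φ)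
    (h : ConeExact φ.toAddMonoidHom d.toAddMonoidHom d'.toAddMonoidHom) :
    ConeExact (φ.lTensor P).toAddMonoidHom (d.lTensor P).toAddMonoidHom
      (d'.lTensor P).toAddMonoidHom := by
  -- `α` and `β` are the differential of the cone in two sign conventions; with `β` after `α` the
  -- hypothesis becomes exactness of one pair, which is what flatness preserves.
  let α : M × N →ₗ[k] M × N :=
    (d ∘ₗ LinearMap.fst k M N).prod (φ ∘ₗ LinearMap.fst k M N + d' ∘ₗ LinearMap.snd k M N)
  let β : M × N →ₗ[k] M × N :=
    (d ∘ₗ LinearMap.fst k M N).prod (φ ∘ₗ LinearMap.fst k M N - d' ∘ₗ LinearMap.snd k M N)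
  have hαβ : Function.Exact α β := by
    rintro ⟨w, z⟩
    constructor
    · intro hwz
      obtain ⟨y, v, hy, hz⟩ := h w z (congrArg Prod.fst hwz)
        (sub_eq_zero.1 (congrArg Prod.snd hwz))
      exact ⟨(y, v), Prod.ext hy hz.symm⟩
    · rintro ⟨⟨y, v⟩, hyv⟩
      have h1 := LinearMap.congr_fun hd y
      have h2 := LinearMap.congr_fun hd' v
      have h3 := LinearMap.congr_fun hφ y
      simp only [LinearMap.comp_apply, LinearMap.zero_apply] at h1 h2 h3
      rw [← hyv]
      simp [α, β, h1, h2, h3]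
  have hα : ∀ s, TensorProduct.prodRight k k P M N (α.lTensor P s) =
      (d.lTensor P (TensorProduct.prodRight k k P M N s).1,
        φ.lTensor P (TensorProduct.prodRight k k P M N s).1 +
          d'.lTensor P (TensorProduct.prodRight k k P M N s).2) := by
    intro s
    induction s using TensorProduct.induction_on with
    | zero => simp only [map_zero, Prod.fst_zero, Prod.snd_zero, add_zero]; rfl
    | tmul p x => simp [α, TensorProduct.tmul_add]
    | add s t hs ht =>
      simp only [map_add, hs, ht, Prod.fst_add, Prod.snd_add, Prod.mk_add_mk]
      congr 1
      abel
  have hβ : ∀ s, TensorProduct.prodRight k k P M N (β.lTensor P s) =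
      (d.lTensor P (TensorProduct.prodRight k k P M N s).1,
        φ.lTensor P (TensorProduct.prodRight k k P M N s).1 -
          d'.lTensor P (TensorProduct.prodRight k k P M N s).2) := by
    intro s
    induction s using TensorProduct.induction_on with
    | zero => simp only [map_zero, Prod.fst_zero, Prod.snd_zero, sub_zero]; rfl
    | tmul p x => simp [β, TensorProduct.tmul_sub]
    | add s t hs ht =>
      simp only [map_add, hs, ht, Prod.fst_add, Prod.snd_add, Prod.mk_add_mk]
      congr 1
      abel
  intro w z hw hwz
  let t := (TensorProduct.prodRight k k P M N).symm (w, z)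
  have ht : TensorProduct.prodRight k k P M N t = (w, z) := LinearEquiv.apply_symm_apply _ _
  have hβt : β.lTensor P t = 0 := by
    apply (TensorProduct.prodRight k k P M N).injective
    rw [hβ, ht, map_zero]
    exact Prod.ext hw (sub_eq_zero.2 hwz)
  obtain ⟨s, hs⟩ := (Module.Flat.lTensor_exact P hαβ t).1 hβt
  have h1 := hα s
  rw [hs, ht] at h1
  exact ⟨_, _, (congrArg Prod.fst h1).symm, congrArg Prod.snd h1⟩

end Flatness

section TotalCone

variable {k : Type u} {A B : Type u} [CommRing k] [Ring A] [Algebra k A] [Ring B] [Algebra k B]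

theorem GrMod.sum_inc_proj (X : GrMod k B) (t : X.Tot) (c : ℤ) (s : Finset ℤ)
    (hs : ∀ p, X.proj (p + c) t ≠ 0 → p ∈ s) :
    ∑ p ∈ s, X.inc (p + c) (X.proj (p + c) t) = t := by
  refine DFinsupp.ext fun q => ?_
  change X.proj q (∑ p ∈ s, X.inc (p + c) (X.proj (p + c) t)) = X.proj q t
  rw [map_sum]
  obtain ⟨r, rfl⟩ : ∃ r, q = r + c := ⟨q - c, by omega⟩
  rw [Finset.sum_eq_single r]
  · exact X.proj_inc _ _
  · exact fun p _ hp => X.proj_inc_ne (by omega) _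
  · intro hr
    rw [X.proj_inc]
    exact not_not.1 fun h => hr (hs r h)

theorem Seq.proj_apply_nil {X Y : GrMod k B} {f : Seq A X Y} {e : ℤ} (h : f.IsHomogeneous e)
    {p q : ℤ} (hq : p + e = q) (t : X.Tot) :
    Y.proj q (f (word k []) t) = f.comp₁ p q (X.proj p t) := by
  suffices Y.proj q ∘ₗ f (word k []) = f.comp₁ p q ∘ₗ X.proj p from LinearMap.congr_fun this t
  refine LinearMap.toAddMonoidHom_injective (X.hom_ext fun r x => ?_)
  change Y.proj q (f (word k []) (X.inc r x)) = f.comp₁ p q (X.proj p (X.inc r x))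
  rw [← Seq.inc_comp₁ h rfl]
  by_cases hr : r = p
  · subst hr
    subst hq
    rw [Y.proj_inc, X.proj_inc]
  · rw [X.proj_inc_ne hr, Y.proj_inc_ne (by omega), map_zero]

theorem ShMod.cx_d (X : ShMod k A B) {p q : ℤ} (h : p + 1 = q) :
    X.cx.d p q = ModuleCat.ofHom (X.m.comp₁ p q) := if_pos h

/-- If `f` is a quasi-isomorphism, then the cone of `f₁` on total modules is acyclic. -/
theorem ShMod.IsQis.coneExact {X Y : ShMod k A B} {f : X ⟶ Y} (hf : ShMod.IsQis f) :
    ConeExact (f.f.fn []) (X.m.fn []) (Y.m.fn []) := by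
  classical
  intro w z hw hwz
  have hw : X.m (word k []) w = 0 := hw
  have hwz : f.f (word k []) w = Y.m (word k []) z := hwz
  have key : ∀ q : ℤ, ∃ (y : X.X q) (v : Y.X (q - 1)),
      X.m.comp₁ q (q + 1) y = X.proj (q + 1) w ∧
        Y.proj q z = f.f.comp₁ q q y + Y.m.comp₁ (q - 1) q v := by
    intro q
    obtain ⟨y, v, hy, hv⟩ := (quasiIso_iff_coneExact _).1 hf q (X.proj (q + 1) w) (Y.proj q z)
      (by
        rw [ShMod.cx_d X rfl]
        refine (Seq.proj_apply_nil X.deg_m rfl w).symm.trans ?_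
        rw [hw, map_zero]
        rfl)
      (by
        rw [ShMod.cx_d Y rfl]
        refine (Seq.proj_apply_nil f.deg_f (add_zero (q + 1)) w).symm.trans ?_
        rw [hwz]
        exact Seq.proj_apply_nil Y.deg_m rfl z)
    rw [ShMod.cx_d X rfl] at hy
    rw [ShMod.cx_d Y (by omega)] at hv
    exact ⟨y, v, hy, hv⟩
  choose y v hy hv using key
  -- The degreewise solutions `y q` and `v q` need not vanish for almost all `q`, so they are only
  -- summed over the finitely many degrees in which `(w, z)` does not vanish.
  let s : Finset ℤ := (DFinsupp.support w).image (fun p => p - 1) ∪ DFinsupp.support z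
  refine ⟨∑ q ∈ s, X.inc q (y q), ∑ q ∈ s, Y.inc (q - 1) (v q), ?_, ?_⟩
  · refine (map_sum _ _ _).trans ?_
    refine Eq.trans (Finset.sum_congr rfl fun q _ => ?_) (X.sum_inc_proj w 1 s fun p hp =>
      Finset.mem_union_left _ (Finset.mem_image.2 ⟨p + 1, DFinsupp.mem_support_iff.2 hp, by simp⟩))
    refine (Seq.inc_comp₁ X.deg_m rfl (y q)).symm.trans ?_
    rw [hy]
  · refine (Y.sum_inc_proj z 0 s fun p hp => Finset.mem_union_right _
      (DFinsupp.mem_support_iff.2 ?_)).symm.trans ?_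
    · rwa [add_zero] at hp
    rw [map_sum, map_sum, ← Finset.sum_add_distrib]
    refine Finset.sum_congr rfl fun q _ => ?_
    have h1 : Y.inc (q + 0) (Y.proj (q + 0) z) = Y.inc q (Y.proj q z) := by rw [add_zero]
    rw [h1, hv, map_add, Seq.inc_comp₁ f.deg_f (add_zero q), Seq.inc_comp₁ Y.deg_m (by omega)]
    rfl

variable [Module.Projective k A]

/-- The cone of `A ⊗ T(A) ⊗ f₁` is acyclic if `f` is a quasi-isomorphism. -/
theorem ShMod.IsQis.coneExact_tensor {X Y : ShMod k A B} {f : X ⟶ Y} (hf : ShMod.IsQis f) :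
    ConeExact (LT.byLength (A := A) fun _ => f.f (word k [])).toAddMonoidHom
      (LT.byLength fun _ => X.m (word k [])).toAddMonoidHom
      (LT.byLength fun _ => Y.m (word k [])).toAddMonoidHom := by
  have := projective_tensorAlgebra (k := k) A
  have e : ∀ {X Y : GrMod k B} (F : X.Tot →ₗ[Bᵐᵒᵖ] Y.Tot),
      (LT.byLength (A := A) fun _ => F).toAddMonoidHom =
        (((F.restrictScalars k).lTensor (TensorAlgebra k A)).lTensor A :
          LT₀ A X →ₗ[k] LT₀ A Y).toAddMonoidHom := by
    intro X Y F
    refine LT.add_ext fun a l x => ?_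
    exact LT.byLength_E (fun _ => F) a l x
  have hX : (X.m (word k [])).restrictScalars k ∘ₗ (X.m (word k [])).restrictScalars k = 0 :=
    LinearMap.ext fun t => X.m_m t
  have hY : (Y.m (word k [])).restrictScalars k ∘ₗ (Y.m (word k [])).restrictScalars k = 0 :=
    LinearMap.ext fun t => Y.m_m t
  have hc : (f.f (word k [])).restrictScalars k ∘ₗ (X.m (word k [])).restrictScalars k =
      (Y.m (word k [])).restrictScalars k ∘ₗ (f.f (word k [])).restrictScalars k :=
    LinearMap.ext fun t => (ShMod.m_f f t).symm
  rw [e, e, e]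
  refine ConeExact.lTensor ?_ ?_ ?_ (ConeExact.lTensor hX hY hc hf.coneExact)
  · rw [← LinearMap.lTensor_comp, hX, LinearMap.lTensor_zero]
  · rw [← LinearMap.lTensor_comp, hY, LinearMap.lTensor_zero]
  · rw [← LinearMap.lTensor_comp, ← LinearMap.lTensor_comp, hc]

end TotalCone

/-! ### The filtration by word length: `L` preserves quasi-isomorphisms -/

section WordLength

variable {k : Type u} {A B : Type u} [CommRing k] [Ring A] [Algebra k A] [Ring B] [Algebra k B]
variable {X Y : GrMod k B}

variable (A X) in
/-- The subgroup of `A ⊗ T(A) ⊗ X` spanned by the words of length less than `n`. -/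
def LT.filt (n : ℕ) : AddSubgroup (LT A X) :=
  AddSubgroup.closure {t | ∃ (a : A) (l : List A) (x : X.Tot), l.length < n ∧ LT.E X a l x = t}

theorem LT.E_mem_filt {n : ℕ} (a : A) {l : List A} (h : l.length < n) (x : X.Tot) :
    LT.E X a l x ∈ LT.filt A X n :=
  AddSubgroup.subset_closure ⟨a, l, x, h, rfl⟩

theorem LT.filt_le {n : ℕ} {S : AddSubgroup (LT A X)}
    (h : ∀ a (l : List A) x, l.length < n → LT.E X a l x ∈ S) : LT.filt A X n ≤ S := by
  refine (AddSubgroup.closure_le _).2 ?_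
  rintro _ ⟨a, l, x, hl, rfl⟩
  exact h a l x hl

theorem LT.filt_mono : Monotone (LT.filt A X) := fun _ _ h =>
  LT.filt_le fun a _ x hl => LT.E_mem_filt a (hl.trans_le h) x

theorem LT.eq_zero_of_mem_filt_zero {t : LT A X} (h : t ∈ LT.filt A X 0) : t = 0 :=
  (AddSubgroup.mem_bot).1 (LT.filt_le (S := ⊥) (fun _ _ _ hl => absurd hl (Nat.not_lt_zero _)) h)

theorem LT.exists_mem_filt (t : LT A X) : ∃ n, t ∈ LT.filt A X n :=
  (AddSubgroup.mem_iSup_of_directed LT.filt_mono.directed_le).1 <|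
    LT.mem_of_E (⨆ n, LT.filt A X n) (fun a l x =>
      (le_iSup (LT.filt A X) (l.length + 1)) (LT.E_mem_filt a (Nat.lt_succ_self _) x)) t

theorem LT.byLength_mem_filt {n : ℕ} (G : ℕ → X.Tot →ₗ[Bᵐᵒᵖ] Y.Tot) (hG : ∀ i, n ≤ i → G i = 0)
    (t : LT A X) : LT.byLength G t ∈ LT.filt A Y n := by
  refine LT.mem_of_E ((LT.filt A Y n).comap (LT.byLength G).toAddMonoidHom) (fun a l x => ?_) t
  change LT.byLength G (LT.E X a l x) ∈ LT.filt A Y n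
  rw [LT.byLength_E]
  by_cases h : l.length < n
  · exact LT.E_mem_filt a h _
  · rw [hG _ (not_lt.1 h), LinearMap.zero_apply, map_zero]
    exact zero_mem _

variable (A X) in
/-- The projection of `A ⊗ T(A) ⊗ X` onto the part spanned by the words of length `n`. -/
def LT.lenProj (n : ℕ) : LT A X →ₗ[A ⊗[k] Bᵐᵒᵖ] LT A X :=
  LT.byLength fun i => if i = n then LinearMap.id else 0

theorem LT.lenProj_mem (n : ℕ) (t : LT A X) : LT.lenProj A X n t ∈ LT.filt A X (n + 1) :=
  LT.byLength_mem_filt _ (fun _ hi => if_neg (by omega)) t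

theorem LT.lenProj_eq_zero {n : ℕ} {t : LT A X} (ht : t ∈ LT.filt A X n) :
    LT.lenProj A X n t = 0 := by
  refine LT.filt_le (S := (LT.lenProj A X n).toAddMonoidHom.ker) (fun a l x hl => ?_) ht
  refine AddMonoidHom.mem_ker.2 ((LT.byLength_E _ a l x).trans ?_)
  rw [if_neg (by omega), LinearMap.zero_apply, map_zero]

theorem LT.sub_lenProj_mem {n : ℕ} {t : LT A X} (ht : t ∈ LT.filt A X (n + 1)) :
    t - LT.lenProj A X n t ∈ LT.filt A X n := by
  refine LT.filt_le (S := (LT.filt A X n).comap (AddMonoidHom.id _ -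
    (LT.lenProj A X n).toAddMonoidHom)) (fun a l x hl => ?_) ht
  change LT.E X a l x - LT.byLength _ (LT.E X a l x) ∈ LT.filt A X n
  rw [LT.byLength_E]
  by_cases h : l.length = n
  · rw [if_pos h, LinearMap.id_apply, sub_self]
    exact zero_mem _
  · rw [if_neg h, LinearMap.zero_apply, map_zero, sub_zero]
    exact LT.E_mem_filt a (by omega) x

theorem LT.lenProj_byLength (G : ℕ → X.Tot →ₗ[Bᵐᵒᵖ] Y.Tot) (n : ℕ) (t : LT A X) :
    LT.lenProj A Y n (LT.byLength G t) = LT.byLength G (LT.lenProj A X n t) := by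
  rw [LT.lenProj, LT.lenProj, LT.byLength_byLength, LT.byLength_byLength]
  congr 2
  funext i
  split_ifs <;> simp

theorem LT.lenProj_lenProj (n : ℕ) (t : LT A X) :
    LT.lenProj A X n (LT.lenProj A X n t) = LT.lenProj A X n t := by
  rw [LT.lenProj, LT.byLength_byLength]
  congr 2
  funext i
  split_ifs <;> simp

/-- The part of the differential of `A ⊗ T(A[1]) ⊗ X` which preserves the length of words. -/
def LT.gradedD (m : Seq A X X) : LT A X →ₗ[A ⊗[k] Bᵐᵒᵖ] LT A X :=
  LT.byLength fun n => (-1 : ℤ) ^ n • m (word k [])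

/-- The convolution product, with the term in which `f` has no letters split off. -/
theorem conv_eq_add_last {M N P : Type*} [AddCommGroup M] [AddCommGroup N] [AddCommGroup P]
    (g : List A → N →+ P) (f : List A → M →+ N) (l : List A) :
    conv g f l = ∑ j ∈ Finset.range l.length, (g (l.take j)).comp (f (l.drop j)) +
      (g l).comp (f []) := by
  rw [conv, Finset.sum_range_succ]
  simp

/-- The remaining part of the differential decreases the length of words. -/
theorem LT.d_sub_gradedD_mem (m : Seq A X X) {n : ℕ} {t : LT A X}
    (ht : t ∈ LT.filt A X (n + 1)) : LT.d m t - LT.gradedD m t ∈ LT.filt A X n := by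
  refine LT.filt_le (S := (LT.filt A X n).comap ((LT.d m).toAddMonoidHom -
    (LT.gradedD m).toAddMonoidHom)) (fun a l x hl => ?_) ht
  change LT.d m (LT.E X a l x) - LT.byLength _ (LT.E X a l x) ∈ LT.filt A X n
  have e : sgn (LT.E X a) l (m.fn [] x) =
      LT.E X a l (((-1 : ℤ) ^ l.length • m (word k [])) x) := by
    exact (map_zsmul (LT.E X a l) ((-1 : ℤ) ^ l.length) (m (word k []) x)).symm
  rw [LT.d_E, LT.byLength_E, conv_eq_add_last, AddMonoidHom.add_apply, AddMonoidHom.comp_apply, e,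
    ← add_assoc, add_sub_cancel_right]
  refine add_mem (add_mem (neg_mem ?_) ?_) ?_
  · rcases l with _ | ⟨b, l⟩
    · exact zero_mem _
    · exact LT.E_mem_filt _ (by simpa using hl) x
  · simp only [barD, AddMonoidHom.finsetSum_apply, AddMonoidHom.smul_apply]
    refine sum_mem fun i hi => zsmul_mem (LT.E_mem_filt _ ?_ _) _
    have := merge_length i l (by simpa using hi)
    omega
  · simp only [sgn, AddMonoidHom.finsetSum_apply, AddMonoidHom.smul_apply,
      AddMonoidHom.comp_apply]
    refine sum_mem fun j hj => zsmul_mem (LT.E_mem_filt _ ?_ _) _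
    have := Finset.mem_range.1 hj
    rw [List.length_take]
    omega

/-- The part of `L f` other than `A ⊗ T(A) ⊗ f₁` decreases the length of words. -/
theorem LT.map_sub_byLength_mem (f : Seq A X Y) {n : ℕ} {t : LT A X}
    (ht : t ∈ LT.filt A X (n + 1)) :
    LT.map f t - LT.byLength (fun _ => f (word k [])) t ∈ LT.filt A Y n := by
  refine LT.filt_le (S := (LT.filt A Y n).comap ((LT.map f).toAddMonoidHom -
    (LT.byLength fun _ => f (word k [])).toAddMonoidHom)) (fun a l x hl => ?_) ht
  change LT.map f (LT.E X a l x) - LT.byLength _ (LT.E X a l x) ∈ LT.filt A Y n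
  have e : LT.E Y a l (f.fn [] x) = LT.E Y a l (f (word k []) x) := rfl
  rw [LT.map_E, LT.byLength_E, conv_eq_add_last, AddMonoidHom.add_apply, AddMonoidHom.comp_apply,
    e, add_sub_cancel_right]
  simp only [AddMonoidHom.finsetSum_apply, AddMonoidHom.comp_apply]
  refine sum_mem fun j hj => LT.E_mem_filt _ ?_ _
  have := Finset.mem_range.1 hj
  rw [List.length_take]
  omega

variable [Module.Projective k A]

/-- The cone of the leading part of `L f` is acyclic. -/
theorem ShMod.IsQis.coneExact_graded {X Y : ShMod k A B} {f : X ⟶ Y} (hf : ShMod.IsQis f) :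
    ConeExact (LT.byLength (A := A) fun _ => f.f (word k [])).toAddMonoidHom
      (LT.gradedD X.m).toAddMonoidHom (LT.gradedD Y.m).toAddMonoidHom := by
  -- The graded differential is `σ ∘ (A ⊗ T(A) ⊗ m₁)`, where `σ` is the sign involution
  -- `(-1)^n` on words of length `n`. Transporting along `σ` removes the signs.
  let σ (X : GrMod k B) : LT A X →ₗ[A ⊗[k] Bᵐᵒᵖ] LT A X :=
    LT.byLength fun n => (-1 : ℤ) ^ n • LinearMap.id
  have hσσ : ∀ (X : GrMod k B) (t : LT A X), σ X (σ X t) = t := fun X t => by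
    rw [LT.byLength_byLength]
    refine LT.byLength_eq_self (fun n => ?_) t
    refine LinearMap.ext fun x => ?_
    change (-1 : ℤ) ^ n • (-1 : ℤ) ^ n • x = x
    rw [smul_smul, ← mul_pow]
    simp
  have hσ : ∀ {X Y : GrMod k B} (F : X.Tot →ₗ[Bᵐᵒᵖ] Y.Tot) (t : LT A X),
      σ Y (LT.byLength (fun _ => F) t) = LT.byLength (fun _ => F) (σ X t) := fun F t => by
    rw [LT.byLength_byLength, LT.byLength_byLength]
    congr 2
    funext n
    exact LinearMap.ext fun x => (map_zsmul F ((-1 : ℤ) ^ n) x).symm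
  have hd : ∀ (X : ShMod k A B) (t : LT A X.toGrMod), LT.gradedD X.m t =
      σ X.toGrMod (LT.byLength (fun _ => X.m (word k [])) t) := fun X t => by
    rw [LT.gradedD, LT.byLength_byLength]
    congr 2
  intro w z hw hwz
  change LT.gradedD X.m w = 0 at hw
  change LT.byLength (fun _ => f.f (word k [])) w = LT.gradedD Y.m z at hwz
  obtain ⟨y, v, hy, hz⟩ := hf.coneExact_tensor w (σ _ z)
    (by
      have := congrArg (σ X.toGrMod) ((hd X w).symm.trans hw)
      rwa [hσσ, map_zero] at this)
    (hwz.trans ((hd Y z).trans (hσ _ z)))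
  refine ⟨σ _ y, v, ?_, ?_⟩
  · exact (hd X _).trans ((congrArg _ (hσ _ y).symm).trans ((hσσ _ _).trans hy))
  · have := congrArg (σ Y.toGrMod) hz
    rw [hσσ, map_add] at this
    exact this.trans (congrArg₂ _ (hσ _ y) (hd Y v).symm)

/-- If `f` is a quasi-isomorphism, then the cone of `L f` is acyclic: the filtration by the
length of words reduces this to the leading part. -/
theorem ShMod.IsQis.coneExact_map {X Y : ShMod k A B} {f : X ⟶ Y} (hf : ShMod.IsQis f) :
    ConeExact (LT.map f.f).toAddMonoidHom (LT.d X.m).toAddMonoidHom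
      (LT.d Y.m).toAddMonoidHom := by
  suffices h : ∀ (n : ℕ) (w : LT A X.toGrMod) (z : LT A Y.toGrMod), w ∈ LT.filt A X.toGrMod n →
      z ∈ LT.filt A Y.toGrMod n → LT.d X.m w = 0 → LT.map f.f w = LT.d Y.m z →
      ∃ (y : LT A X.toGrMod) (v : LT A Y.toGrMod), LT.d X.m y = w ∧
        z = LT.map f.f y + LT.d Y.m v by
    intro w z hw hwz
    obtain ⟨n, hn⟩ := LT.exists_mem_filt w
    obtain ⟨n', hn'⟩ := LT.exists_mem_filt z
    exact h (max n n') w z (LT.filt_mono (le_max_left _ _) hn)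
      (LT.filt_mono (le_max_right _ _) hn') hw hwz
  intro n
  induction n with
  | zero =>
    intro w z hw hz _ _
    rw [LT.eq_zero_of_mem_filt_zero hw, LT.eq_zero_of_mem_filt_zero hz]
    exact ⟨0, 0, by simp, by simp⟩
  | succ n ih =>
    intro w z hwF hzF hw hwz
    have h1 : LT.gradedD X.m (LT.lenProj A _ n w) = 0 := by
      have := LT.lenProj_eq_zero (LT.d_sub_gradedD_mem X.m hwF)
      rw [hw, zero_sub, map_neg, neg_eq_zero] at this
      exact (LT.lenProj_byLength _ n w).symm.trans this
    have h2 : LT.byLength (fun _ => f.f (word k [])) (LT.lenProj A _ n w) =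
        LT.gradedD Y.m (LT.lenProj A _ n z) := by
      have e1 := LT.lenProj_eq_zero (LT.map_sub_byLength_mem f.f hwF)
      have e2 := LT.lenProj_eq_zero (LT.d_sub_gradedD_mem Y.m hzF)
      rw [map_sub, sub_eq_zero] at e1 e2
      rw [hwz] at e1
      rw [← LT.lenProj_byLength, ← e1, e2]
      exact LT.lenProj_byLength _ n z
    obtain ⟨y, v, hy, hz⟩ := hf.coneExact_graded _ _ h1 h2
    change LT.gradedD X.m y = _ at hy
    change _ = LT.byLength (fun _ => f.f (word k [])) y + LT.gradedD Y.m v at hz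
    -- Projecting to words of length `n` solves the problem modulo shorter words, to which the
    -- induction hypothesis applies.
    set y' := LT.lenProj A _ n y
    set v' := LT.lenProj A _ n v
    have hy' : LT.gradedD X.m y' = LT.lenProj A _ n w := by
      rw [← LT.lenProj_lenProj, ← hy]
      exact (LT.lenProj_byLength _ n y).symm
    have hz' : LT.lenProj A _ n z =
        LT.byLength (fun _ => f.f (word k [])) y' + LT.gradedD Y.m v' := by
      rw [← LT.lenProj_lenProj, hz, map_add, LT.lenProj_byLength]
      exact congrArg _ (LT.lenProj_byLength _ n v)
    obtain ⟨y₁, v₁, hy₁, hz₁⟩ := ih (w - LT.d X.m y') (z - LT.map f.f y' - LT.d Y.m v')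
      (by
        have := sub_mem (LT.sub_lenProj_mem hwF) (LT.d_sub_gradedD_mem X.m (LT.lenProj_mem n y))
        rw [hy'] at this
        convert this using 1
        abel)
      (by
        have := sub_mem (sub_mem (LT.sub_lenProj_mem hzF)
          (LT.map_sub_byLength_mem f.f (LT.lenProj_mem n y)))
          (LT.d_sub_gradedD_mem Y.m (LT.lenProj_mem n v))
        rw [hz'] at this
        convert this using 1
        abel)
      (by rw [map_sub, hw, LT.d_d, sub_zero])
      (by rw [map_sub, map_sub, map_sub, LT.d_d, hwz, LT.map_d, sub_zero])
    refine ⟨y' + y₁, v' + v₁, ?_, ?_⟩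
    · rw [map_add, hy₁]
      abel
    · rw [map_add, map_add, add_add_add_comm, ← hz₁]
      abel

/-- The functor `L` preserves quasi-isomorphisms. -/
theorem ShMod.IsQis.quasiIso_L {X Y : ShMod k A B} {f : X ⟶ Y} (hf : ShMod.IsQis f) :
    QuasiIso ((L k A B).map f) := by
  refine (quasiIso_iff_coneExact _).2 fun q w z hw hwz => ?_
  obtain ⟨w, hwd⟩ : ∃ w' : LT.deg A X.toGrMod (q + 1), w' = w := ⟨w, rfl⟩
  obtain ⟨z, hzd⟩ : ∃ z' : LT.deg A Y.toGrMod q, z' = z := ⟨z, rfl⟩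
  subst hwd hzd
  have hw' : LT.d X.m w.1 = 0 :=
    (Lobj_d_apply X rfl w).symm.trans (congrArg Subtype.val hw)
  have hwz' : LT.map f.f w.1 = LT.d Y.m z.1 :=
    Eq.trans (congrArg Subtype.val hwz) (Lobj_d_apply Y rfl z)
  obtain ⟨y, v, hy, hz⟩ := hf.coneExact_map w.1 z.1 hw' hwz'
  change LT.d X.m y = w.1 at hy
  change z.1 = LT.map f.f y + LT.d Y.m v at hz
  -- The solution on the total module need not be homogeneous; its components of degree `q` and
  -- `q - 1` solve the problem in degree `q`.
  refine ⟨(⟨_, LT.degProj_mem q y⟩ : LT.deg A X.toGrMod q),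
    (⟨_, LT.degProj_mem (q - 1) v⟩ : LT.deg A Y.toGrMod (q - 1)), ?_, ?_⟩
  · refine Subtype.ext ((Lobj_d_apply X rfl _).trans ?_)
    refine (LT.degProj_comm (LT.d X.m).toAddMonoidHom 1
      (fun p t ht => LT.d_mem_deg X.deg_m rfl ht) q y).symm.trans ?_
    refine (congrArg (LT.degProj A _ (q + 1)) hy).trans ?_
    rw [LT.degProj_of_mem w.2, if_pos rfl]
  · have e1 := LT.degProj_comm (LT.map f.f).toAddMonoidHom 0
      (fun p t ht => by rw [add_zero]; exact LT.map_mem_deg f.deg_f ht) q y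
    have e2 := LT.degProj_comm (LT.d Y.m).toAddMonoidHom 1
      (fun p t ht => LT.d_mem_deg Y.deg_m rfl ht) (q - 1) v
    rw [add_zero] at e1
    rw [sub_add_cancel] at e2
    have e3 := congrArg (LT.degProj A _ q) hz
    rw [LT.degProj_of_mem z.2, if_pos rfl, map_add] at e3
    refine Subtype.ext (e3.trans (congrArg₂ _ e1 (e2.trans ?_)))
    exact (Lobj_d_apply Y (sub_add_cancel q 1) ⟨_, LT.degProj_mem (q - 1) v⟩).symm

end WordLength

/-! ### Homotopies -/

section Homotopies

variable {k : Type u} {A B : Type u} [CommRing k] [Ring A] [Algebra k A] [Ring B] [Algebra k B]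

theorem IsNullHomotopy.eq' {X Y : ShMod k A B} {f h : Seq A X.toGrMod Y.toGrMod}
    (H : IsNullHomotopy f h) (l : List A) :
    f.fn l = conv (sgn Y.m.fn) h.fn l + barD h.fn l + conv (sgn h.fn) X.m.fn l := by
  rw [conv_sgn_fn, conv_sgn_fn, barD_fn, Seq.fn, H.eq l]
  rfl

/-- The map `(a₀, …, aₙ, x) ↦ ∑ (-1)^j (a₀, …, aⱼ, h(aⱼ₊₁, …, aₙ, x))` induced by a
homotopy `h`. -/
def LT.htp {X Y : GrMod k B} (h : Seq A X Y) : LT A X →ₗ[A ⊗[k] Bᵐᵒᵖ] LT A Y :=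
  LT.byLength (fun n => (-1 : ℤ) ^ n • LinearMap.id) ∘ₗ LT.map h

theorem LT.htp_comp_E {X Y : GrMod k B} (h : Seq A X Y) (a : A) (l : List A) :
    (LT.htp h).toAddMonoidHom.comp (LT.E X a l) = conv (sgn (LT.E Y a)) h.fn l := by
  have : (fun l => (LT.byLength (A := A) (X := Y)
      (fun n => (-1 : ℤ) ^ n • LinearMap.id)).toAddMonoidHom.comp (LT.E Y a l)) =
      sgn (LT.E Y a) := by
    funext l
    refine AddMonoidHom.ext fun x => ?_
    exact (LT.byLength_E _ a l x).trans (map_zsmul (LT.E Y a l) _ x)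
  rw [← this, conv_comp_left, ← LT.map_comp_E]
  rfl

theorem LT.htp_mem_deg {X Y : GrMod k B} {h : Seq A X Y} (hh : h.IsHomogeneous (-1)) {q r : ℤ}
    (hr : r + 1 = q) {t : LT A X} (ht : t ∈ LT.deg A X q) : LT.htp h t ∈ LT.deg A Y r := by
  suffices LT.deg A X q ≤ (LT.deg A Y r).comap (LT.htp h) from this ht
  refine Submodule.span_le.2 ?_
  rintro _ ⟨a, l, x, rfl⟩
  change (LT.htp h).toAddMonoidHom.comp (LT.E X a l) _ ∈ LT.deg A Y r
  rw [LT.htp_comp_E]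
  simp only [conv, sgn, AddMonoidHom.finsetSum_apply, AddMonoidHom.smul_apply,
    AddMonoidHom.comp_apply]
  refine sum_mem fun j hj => zsmul_mem (LT.E_mem_deg _ _ (hh _ _ x) ?_) _
  have hj' : j ≤ l.length := by simpa [Nat.lt_succ_iff] using hj
  simp only [List.length_take, List.length_drop, min_eq_left hj', Nat.cast_sub hj']
  omega

theorem sgn_headMul {M : Type*} [AddCommGroup M] (E : A → List A → M) (a : A) :
    sgn (headMul E a) = -headMul (fun a => sgn (E a)) a := by
  funext l
  rcases l with _ | ⟨b, l⟩
  · simp [sgn, headMul]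
  · simp [sgn, headMul, pow_succ]

/-- The bimodule map `LT.htp h` is a chain homotopy from `L f` to `L g`. -/
theorem LT.d_htp {X Y : ShMod k A B} {f g : X ⟶ Y} {h : Seq A X.toGrMod Y.toGrMod}
    (H : IsNullHomotopy (f.f - g.f) h) (t : LT A X.toGrMod) :
    LT.d Y.m (LT.htp h t) + LT.htp h (LT.d X.m t) = LT.map f.f t - LT.map g.f t := by
  suffices (LT.d Y.m).toAddMonoidHom.comp (LT.htp h).toAddMonoidHom +
      (LT.htp h).toAddMonoidHom.comp (LT.d X.m).toAddMonoidHom =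
      (LT.map f.f).toAddMonoidHom - (LT.map g.f).toAddMonoidHom from DFunLike.congr_fun this t
  refine LT.hom_ext fun a l => ?_
  set D := (LT.d Y.m).toAddMonoidHom with hD
  set K := (LT.htp h).toAddMonoidHom with hK
  set E := LT.E Y.toGrMod (A := A) with hE
  set E' := LT.E X.toGrMod (A := A) with hE'
  have hKE : ∀ a, (fun l => K.comp (E' a l)) = conv (sgn (E a)) h.fn :=
    fun a => funext fun l => LT.htp_comp_E h a l
  have hDE : ∀ a, (fun l => D.comp (E a l)) =
      -headMul E a + barD (E a) + conv (sgn (E a)) Y.m.fn :=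
    fun a => funext fun l => LT.d_comp_E Y.m a l
  have s0 : (fun l => D.comp (sgn (E a) l)) = sgn (fun l => D.comp (E a l)) := by
    funext l
    refine AddMonoidHom.ext fun x => ?_
    simp [sgn]
  have s0' : (fun l => K.comp (sgn (E' a) l)) = sgn (fun l => K.comp (E' a l)) := by
    funext l
    refine AddMonoidHom.ext fun x => ?_
    simp [sgn]
  have s1 : sgn (barD (E a)) = - barD (sgn (E a)) := by
    funext t; rw [Pi.neg_apply, barD_sgn, neg_neg]
  have s2 : sgn (conv (sgn (E a)) Y.m.fn) = conv (E a) (sgn Y.m.fn) := by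
    funext t; rw [sgn_conv, sgn_sgn]
  have s3 : sgn (conv (sgn (E a)) h.fn) = conv (E a) (sgn h.fn) := by
    funext t; rw [sgn_conv, sgn_sgn]
  have s4 : sgn (-headMul E a + barD (E a) + conv (sgn (E a)) Y.m.fn) =
      headMul (fun a => sgn (E a)) a + -barD (sgn (E a)) + conv (E a) (sgn Y.m.fn) := by
    rw [← s1, ← s2]
    have := sgn_headMul E a
    funext t
    have := congrFun this t
    simp only [sgn, Pi.add_apply, Pi.neg_apply, smul_add, smul_neg] at this ⊢
    rw [this, neg_neg]
  have e1 : D.comp (K.comp (E' a l)) = headMul (fun a => conv (sgn (E a)) h.fn) a l +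
      -conv (barD (sgn (E a))) h.fn l + conv (E a) (conv (sgn Y.m.fn) h.fn) l := by
    rw [hK, LT.htp_comp_E, ← conv_comp_left, s0, hDE, s4, conv_add_left, conv_add_left,
      conv_neg_left, headMul_conv, conv_assoc]
  have e0 : K.comp (headMul E' a l) = headMul (fun a => conv (sgn (E a)) h.fn) a l := by
    rcases l with _ | ⟨b, l⟩
    · exact AddMonoidHom.comp_zero _
    · exact LT.htp_comp_E h (a * b) l
  have e2 : K.comp (((LT.d X.m).toAddMonoidHom).comp (E' a l)) =
      -headMul (fun a => conv (sgn (E a)) h.fn) a l + (conv (barD (sgn (E a))) h.fn l +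
        conv (E a) (barD h.fn) l) + conv (E a) (conv (sgn h.fn) X.m.fn) l := by
    rw [hE', LT.d_comp_E, ← hE', AddMonoidHom.comp_add, AddMonoidHom.comp_add,
      AddMonoidHom.comp_neg, e0, ← barD_comp, ← conv_comp_left, s0', hKE, barD_conv, sgn_sgn, s3,
      conv_assoc]
  have e3 : conv (E a) (f.f - g.f).fn l = conv (E a) (conv (sgn Y.m.fn) h.fn) l +
      conv (E a) (barD h.fn) l + conv (E a) (conv (sgn h.fn) X.m.fn) l := by
    rw [← conv_add_right, ← conv_add_right]
    congr 1
    exact funext fun l => H.eq' l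
  have e4 : conv (E a) (f.f - g.f).fn l = conv (E a) f.f.fn l - conv (E a) g.f.fn l := by
    rw [eq_sub_iff_add_eq, ← conv_add_right]
    congr 1
    funext l
    refine AddMonoidHom.ext fun x => ?_
    simp [Seq.fn]
  rw [AddMonoidHom.add_comp, AddMonoidHom.sub_comp, AddMonoidHom.comp_assoc,
    AddMonoidHom.comp_assoc, e1, e2, LT.map_comp_E, LT.map_comp_E, ← e4, e3]
  abel

/-- The components of the chain homotopy induced by a homotopy `h`. -/
def htpHom {X Y : ShMod k A B} {h : Seq A X.toGrMod Y.toGrMod} (hh : h.IsHomogeneous (-1))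
    (p q : ℤ) : (Lobj X).X p ⟶ (Lobj Y).X q :=
  if hpq : q + 1 = p then
    ModuleCat.ofHom ((LT.htp h).restrict fun _ ht => LT.htp_mem_deg hh hpq ht)
  else 0

theorem htpHom_eq {X Y : ShMod k A B} {h : Seq A X.toGrMod Y.toGrMod}
    (hh : h.IsHomogeneous (-1)) {p q : ℤ} (hpq : q + 1 = p) : htpHom hh p q =
      ModuleCat.ofHom ((LT.htp h).restrict fun _ ht => LT.htp_mem_deg hh hpq ht) := dif_pos hpq

theorem htpHom_apply {X Y : ShMod k A B} {h : Seq A X.toGrMod Y.toGrMod}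
    (hh : h.IsHomogeneous (-1)) {p q : ℤ} (hpq : q + 1 = p) (t : LT.deg A X.toGrMod p) :
    (id ((htpHom hh p q).hom t) : LT.deg A Y.toGrMod q).1 = LT.htp h t.1 := by
  rw [htpHom_eq hh hpq]
  rfl

/-- Homotopic morphisms of strong homotopy modules induce homotopic morphisms of complexes of
bimodules. -/
def homotopyL {X Y : ShMod k A B} {f g : X ⟶ Y} {h : Seq A X.toGrMod Y.toGrMod}
    (H : IsNullHomotopy (f.f - g.f) h) : Homotopy (Lmap f) (Lmap g) where
  hom p q := htpHom H.deg_h p q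
  zero p q hpq := dif_neg hpq
  comm q := by
    obtain ⟨r, rfl⟩ : ∃ r, q = r + 1 := ⟨q - 1, by omega⟩
    rw [dNext_eq _ (show (ComplexShape.up ℤ).Rel (r + 1) (r + 1 + 1) from rfl),
      prevD_eq _ (show (ComplexShape.up ℤ).Rel r (r + 1) from rfl)]
    refine ModuleCat.hom_ext (LinearMap.ext fun (t : LT.deg A X.toGrMod (r + 1)) => ?_)
    have key := LT.d_htp H t.1
    have e1 := (htpHom_apply H.deg_h rfl _).trans
      (congrArg (LT.htp h) (Lobj_d_apply X (r := r + 1 + 1) rfl t))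
    have e2 := (Lobj_d_apply Y (r := r + 1) rfl _).trans
      (congrArg (LT.d Y.m) (htpHom_apply H.deg_h (q := r) rfl t))
    rw [← e1, ← e2, eq_sub_iff_add_eq] at key
    refine Subtype.ext (key.symm.trans ?_)
    exact congrArg (fun u => u + LT.map g.f t.1) (add_comm _ _)

/-- The first of the equations satisfied by a homotopy. -/
theorem ShMod.cx_hom {X Y : ShMod k A B} {f g : X ⟶ Y} {h : Seq A X.toGrMod Y.toGrMod}
    (H : IsNullHomotopy (f.f - g.f) h) (t : X.Tot) :
    f.f (word k []) t = h (word k []) (X.m (word k []) t) + Y.m (word k []) (h (word k []) t) +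
      g.f (word k []) t := by
  have := LinearMap.congr_fun (H.eq []) t
  simp at this
  rw [eq_add_of_sub_eq this]
  abel

/-- The components of the chain homotopy between the underlying complexes given by the first
component of a homotopy. -/
def htpCxHom {X Y : ShMod k A B} (h : Seq A X.toGrMod Y.toGrMod) (p q : ℤ) :
    X.cx.X p ⟶ Y.cx.X q :=
  if q + 1 = p then ModuleCat.ofHom (h.comp₁ p q) else 0

theorem htpCxHom_eq {X Y : ShMod k A B} (h : Seq A X.toGrMod Y.toGrMod) {p q : ℤ}
    (hpq : q + 1 = p) : htpCxHom h p q = ModuleCat.ofHom (h.comp₁ p q) := if_pos hpq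

/-- Homotopic morphisms of strong homotopy modules induce homotopic morphisms between the
underlying complexes. -/
def homotopyCx {X Y : ShMod k A B} {f g : X ⟶ Y} {h : Seq A X.toGrMod Y.toGrMod}
    (H : IsNullHomotopy (f.f - g.f) h) : Homotopy (ShMod.cxMap f) (ShMod.cxMap g) where
  hom p q := htpCxHom h p q
  zero p q hpq := if_neg hpq
  comm q := by
    obtain ⟨r, rfl⟩ : ∃ r, q = r + 1 := ⟨q - 1, by omega⟩
    rw [dNext_eq _ (show (ComplexShape.up ℤ).Rel (r + 1) (r + 1 + 1) from rfl),
      prevD_eq _ (show (ComplexShape.up ℤ).Rel r (r + 1) from rfl), htpCxHom_eq h rfl,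
      htpCxHom_eq h rfl, ShMod.cx_d X rfl, ShMod.cx_d Y rfl]
    refine ModuleCat.hom_ext (LinearMap.ext fun (x : X.X (r + 1)) => ?_)
    apply Y.inc_injective (r + 1)
    change Y.inc (r + 1) (f.f.comp₁ (r + 1) (r + 1) x) = Y.inc (r + 1)
      (h.comp₁ (r + 1 + 1) (r + 1) (X.m.comp₁ (r + 1) (r + 1 + 1) x) +
        Y.m.comp₁ r (r + 1) (h.comp₁ (r + 1) r x) + g.f.comp₁ (r + 1) (r + 1) x)
    rw [map_add, map_add, Seq.inc_comp₁ f.deg_f (add_zero _), Seq.inc_comp₁ g.deg_f (add_zero _),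
      Seq.inc_comp₁ H.deg_h (by omega), Seq.inc_comp₁ X.deg_m rfl, Seq.inc_comp₁ Y.deg_m rfl,
      Seq.inc_comp₁ H.deg_h (by omega)]
    exact ShMod.cx_hom H _

end Homotopies

/-! ### The adjunction on derived categories -/

section DescendedAdjunction

variable {C₁ C₂ D₁ D₂ : Type*} [Category* C₁] [Category* C₂] [Category* D₁] [Category* D₂]
  {G : C₁ ⥤ C₂} {F : C₂ ⥤ C₁} (adj : G ⊣ F) (Q₁ : C₁ ⥤ D₁) (Q₂ : C₂ ⥤ D₂)
  {G' : D₁ ⥤ D₂} {F' : D₂ ⥤ D₁} (iG : Q₁ ⋙ G' ≅ G ⋙ Q₂) (iF : Q₂ ⋙ F' ≅ F ⋙ Q₁)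
  [((Functor.whiskeringLeft C₁ D₁ D₁).obj Q₁).Full]
  [((Functor.whiskeringLeft C₁ D₁ D₁).obj Q₁).Faithful]
  [((Functor.whiskeringLeft C₁ D₁ D₂).obj Q₁).Faithful]
  [((Functor.whiskeringLeft C₂ D₂ D₂).obj Q₂).Full]
  [((Functor.whiskeringLeft C₂ D₂ D₂).obj Q₂).Faithful]
  [((Functor.whiskeringLeft C₂ D₂ D₁).obj Q₂).Faithful]

theorem natTrans_ext_of_faithful {E : Type*} [Category* E]
    [((Functor.whiskeringLeft C₁ D₁ E).obj Q₁).Faithful] {H K : D₁ ⥤ E} {σ τ : H ⟶ K}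
    (h : ∀ X, σ.app (Q₁.obj X) = τ.app (Q₁.obj X)) : σ = τ :=
  ((Functor.whiskeringLeft C₁ D₁ E).obj Q₁).map_injective (NatTrans.ext (funext h))

/-- The unit of the descended adjunction. -/
def descendUnit : 𝟭 D₁ ⟶ G' ⋙ F' :=
  ((Functor.whiskeringLeft C₁ D₁ D₁).obj Q₁).preimage
    { app := fun X => Q₁.map (adj.unit.app X) ≫ iF.inv.app (G.obj X) ≫ F'.map (iG.inv.app X)
      naturality := fun X Y f => by
        have h1 := adj.unit.naturality f
        have h2 := iF.inv.naturality (G.map f)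
        have h3 := iG.inv.naturality f
        simp only [Functor.id_obj, Functor.comp_obj, Functor.id_map, Functor.comp_map] at h1 h2 h3
        simp only [Functor.whiskeringLeft_obj_obj, Functor.comp_obj, Functor.id_obj,
          Functor.comp_map, Functor.id_map, Category.assoc]
        rw [← Functor.map_comp_assoc, h1, Functor.map_comp_assoc, reassoc_of% h2,
          ← F'.map_comp, h3, F'.map_comp] }

theorem descendUnit_app (X : C₁) : (descendUnit adj Q₁ Q₂ iG iF).app (Q₁.obj X) =
    Q₁.map (adj.unit.app X) ≫ iF.inv.app (G.obj X) ≫ F'.map (iG.inv.app X) :=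
  congr_app (((Functor.whiskeringLeft C₁ D₁ D₁).obj Q₁).map_preimage _) X

/-- The counit of the descended adjunction. -/
def descendCounit : F' ⋙ G' ⟶ 𝟭 D₂ :=
  ((Functor.whiskeringLeft C₂ D₂ D₂).obj Q₂).preimage
    { app := fun Y => G'.map (iF.hom.app Y) ≫ iG.hom.app (F.obj Y) ≫ Q₂.map (adj.counit.app Y)
      naturality := fun X Y f => by
        have h1 := adj.counit.naturality f
        have h2 := iF.hom.naturality f
        have h3 := iG.hom.naturality (F.map f)
        simp only [Functor.id_obj, Functor.comp_obj, Functor.id_map, Functor.comp_map] at h1 h2 h3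
        simp only [Functor.whiskeringLeft_obj_obj, Functor.comp_obj, Functor.id_obj,
          Functor.comp_map, Functor.id_map, Category.assoc]
        rw [← Functor.map_comp_assoc, h2, Functor.map_comp_assoc, reassoc_of% h3,
          ← Q₂.map_comp, h1, Q₂.map_comp] }

theorem descendCounit_app (Y : C₂) : (descendCounit adj Q₁ Q₂ iG iF).app (Q₂.obj Y) =
    G'.map (iF.hom.app Y) ≫ iG.hom.app (F.obj Y) ≫ Q₂.map (adj.counit.app Y) :=
  congr_app (((Functor.whiskeringLeft C₂ D₂ D₂).obj Q₂).map_preimage _) Y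

/-- An adjunction `G ⊣ F` descends along functors `Q₁` and `Q₂` with the property that natural
transformations between functors on the targets are the same as natural transformations between
the composites with `Q₁` and `Q₂` respectively. -/
def descendAdjunction : G' ⊣ F' :=
  Adjunction.mkOfUnitCounit
    { unit := descendUnit adj Q₁ Q₂ iG iF
      counit := descendCounit adj Q₁ Q₂ iG iF
      left_triangle := natTrans_ext_of_faithful Q₁ fun X => by
        have h1 := (descendCounit adj Q₁ Q₂ iG iF).naturality (iG.inv.app X)
        have h2 := iG.hom.naturality (adj.unit.app X)
        have h3 := adj.left_triangle_components X
        simp only [Functor.id_obj, Functor.comp_obj, Functor.id_map, Functor.comp_map] at h1 h2 h3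
        simp only [NatTrans.comp_app, Functor.whiskerRight_app, Functor.whiskerLeft_app,
          Functor.associator_hom_app, Category.id_comp, descendUnit_app, Functor.map_comp,
          Category.assoc, Functor.comp_obj, Functor.id_obj]
        rw [h1, descendCounit_app]
        simp only [Category.assoc]
        have h4 : G'.map (iF.inv.app (G.obj X)) ≫ G'.map (iF.hom.app (G.obj X)) = 𝟙 _ := by
          rw [← G'.map_comp, Iso.inv_hom_id_app]
          exact G'.map_id _
        rw [reassoc_of% h4, reassoc_of% h2, ← Q₂.map_comp_assoc, h3, Q₂.map_id, Category.id_comp,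
          Iso.hom_inv_id_app]
        rfl
      right_triangle := natTrans_ext_of_faithful Q₂ fun Y => by
        have h1 := (descendUnit adj Q₁ Q₂ iG iF).naturality (iF.hom.app Y)
        have h2 := iF.inv.naturality (adj.counit.app Y)
        have h3 := adj.right_triangle_components Y
        simp only [Functor.id_obj, Functor.comp_obj, Functor.id_map, Functor.comp_map] at h1 h2 h3
        simp only [NatTrans.comp_app, Functor.whiskerRight_app, Functor.whiskerLeft_app,
          Functor.associator_inv_app, Category.id_comp, descendCounit_app, Functor.map_comp,
          Functor.comp_obj, Functor.id_obj]
        rw [← reassoc_of% h1, descendUnit_app]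
        simp only [Category.assoc]
        have h4 : F'.map (iG.inv.app (F.obj Y)) ≫ F'.map (iG.hom.app (F.obj Y)) = 𝟙 _ := by
          rw [← F'.map_comp, Iso.inv_hom_id_app]
          exact F'.map_id _
        have h5 : Q₁.map (adj.unit.app (F.obj Y)) ≫ Q₁.map (F.map (adj.counit.app Y)) = 𝟙 _ := by
          rw [← Q₁.map_comp, h3]
          exact Q₁.map_id _
        rw [reassoc_of% h4, ← h2, reassoc_of% h5, Iso.hom_inv_id_app]
        rfl }

end DescendedAdjunction

section Derived

variable (k A B : Type u) [CommRing k] [Ring A] [Algebra k A] [Ring B] [Algebra k B]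

instance (E : Type*) [Category* E] :
    ((Functor.whiskeringLeft _ _ E).obj (DShMod.Q k A B)).Full :=
  have := Localization.full_whiskeringLeft (HShMod.qis k A B).Q (HShMod.qis k A B) E
  inferInstanceAs ((Functor.whiskeringLeft _ _ E).obj (HShMod.qis k A B).Q ⋙
    (Functor.whiskeringLeft _ _ E).obj (CategoryTheory.Quotient.functor (homotopic k A B))).Full

instance (E : Type*) [Category* E] :
    ((Functor.whiskeringLeft _ _ E).obj (DShMod.Q k A B)).Faithful :=
  have := Localization.faithful_whiskeringLeft (HShMod.qis k A B).Q (HShMod.qis k A B) E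
  inferInstanceAs ((Functor.whiskeringLeft _ _ E).obj (HShMod.qis k A B).Q ⋙
    (Functor.whiskeringLeft _ _ E).obj (CategoryTheory.Quotient.functor (homotopic k A B))).Faithful

/-- Every object of the derived category is the image of a strong homotopy module. -/
theorem DShMod.exists_eq_obj (Z : DShMod k A B) : ∃ X, (DShMod.Q k A B).obj X = Z := by
  obtain ⟨⟨X⟩, rfl⟩ := (Localization.Construction.objEquiv (HShMod.qis k A B)).surjective Z
  exact ⟨X, rfl⟩

section Lift

variable {k A B} {E : Type*} [Category* E] (F : ShMod k A B ⥤ E)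
  (hF : ∀ (X Y : ShMod k A B) (f g : X ⟶ Y), homotopic k A B f g → F.map f = F.map g)

theorem HShMod.qis_isInvertedBy_lift
    (hF' : ∀ (X Y : ShMod k A B) (f : X ⟶ Y), ShMod.IsQis f → IsIso (F.map f)) :
    (HShMod.qis k A B).IsInvertedBy
      (CategoryTheory.Quotient.lift (homotopic k A B) F hF) := by
  rintro X Y _ ⟨f, hf, rfl⟩
  exact hF' _ _ f hf

variable (hF' : ∀ (X Y : ShMod k A B) (f : X ⟶ Y), ShMod.IsQis f → IsIso (F.map f))

/-- The functor on the derived category induced by a functor on strong homotopy modules which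
identifies homotopic morphisms and inverts quasi-isomorphisms. -/
def DShMod.lift : DShMod k A B ⥤ E :=
  Localization.lift (CategoryTheory.Quotient.lift (homotopic k A B) F hF)
    (HShMod.qis_isInvertedBy_lift F hF hF') (HShMod.qis k A B).Q

/-- `DShMod.lift F` is induced by `F`. -/
def DShMod.liftIso : DShMod.Q k A B ⋙ DShMod.lift F hF hF' ≅ F :=
  Functor.isoWhiskerLeft (CategoryTheory.Quotient.functor (homotopic k A B))
    (Localization.fac (CategoryTheory.Quotient.lift (homotopic k A B) F hF)
      (HShMod.qis_isInvertedBy_lift F hF hF') (HShMod.qis k A B).Q)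

end Lift

/-- The functor from strong homotopy modules to their underlying complexes. -/
def ShMod.cxFunctor : ShMod k A B ⥤ CochainComplex (ModuleCat.{u} Bᵐᵒᵖ) ℤ where
  obj X := X.cx
  map f := ShMod.cxMap f
  map_id X := by
    ext p x
    apply X.inc_injective p
    refine (Seq.inc_comp₁ (𝟙 X : X ⟶ X).deg_f (add_zero p) x).trans ?_
    exact DFunLike.congr_fun (congrFun (ShMod.id_fn X) []) (X.inc p x)
  map_comp {X Y Z} f g := by
    ext p x
    apply Z.inc_injective p
    refine (Seq.inc_comp₁ (f ≫ g).deg_f (add_zero p) x).trans ?_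
    refine (DFunLike.congr_fun ((congrFun (ShMod.comp_fn f g) []).trans (conv_nil _ _))
      (X.inc p x)).trans ?_
    refine (congrArg (g.f (word k [])) (Seq.inc_comp₁ f.deg_f (add_zero p) x).symm).trans ?_
    exact (Seq.inc_comp₁ g.deg_f (add_zero p) _).symm

/-- A morphism of strong homotopy modules which becomes invertible in the derived category is a
quasi-isomorphism, because homology factors through the derived category. -/
theorem ShMod.isQis_of_isIso_Q {X Y : ShMod k A B} (f : X ⟶ Y)
    [IsIso ((DShMod.Q k A B).map f)] : ShMod.IsQis f := by
  refine ⟨fun n => ?_⟩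
  rw [quasiIsoAt_iff_isIso_homologyMap]
  let F : ShMod k A B ⥤ ModuleCat.{u} Bᵐᵒᵖ := ShMod.cxFunctor k A B ⋙
    HomologicalComplex.homologyFunctor (ModuleCat.{u} Bᵐᵒᵖ) (ComplexShape.up ℤ) n
  let i := DShMod.liftIso F (fun X Y f g ⟨_, H⟩ => (homotopyCx H).homologyMap_eq n)
    (fun X Y f hf => by
      have : QuasiIso (ShMod.cxMap f) := hf
      exact inferInstanceAs (IsIso (HomologicalComplex.homologyMap (ShMod.cxMap f) n)))
  exact (NatIso.isIso_map_iff i f).1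
    (inferInstanceAs (IsIso (CategoryTheory.Functor.map _ ((DShMod.Q k A B).map f))))

variable [Module.Projective k A] [HasDerivedCategory.{w} (ModuleCat.{u} (A ⊗[k] Bᵐᵒᵖ))]

theorem Q_map_L_eq {X Y : ShMod k A B} (f g : X ⟶ Y) (h : homotopic k A B f g) :
    (L k A B ⋙ DerivedCategory.Q).map f = (L k A B ⋙ DerivedCategory.Q).map g := by
  obtain ⟨h, H⟩ := h
  exact DerivedCategory.Q_map_eq_of_homotopy _ (homotopyL H)

theorem isIso_Q_map_L {X Y : ShMod k A B} (f : X ⟶ Y) (h : ShMod.IsQis f) :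
    IsIso ((L k A B ⋙ DerivedCategory.Q).map f) :=
  (DerivedCategory.isIso_Q_map_iff_quasiIso _ _).2 h.quasiIso_L

/-- The functor induced by `L` between the derived categories. -/
def derivedL : DShMod k A B ⥤ DerivedCategory (ModuleCat.{u} (A ⊗[k] Bᵐᵒᵖ)) :=
  DShMod.lift (L k A B ⋙ DerivedCategory.Q) (fun _ _ => Q_map_L_eq k A B)
    (fun _ _ => isIso_Q_map_L k A B)

/-- The isomorphism expressing that `derivedL` is induced by `L`. -/
def derivedLIso : DShMod.Q k A B ⋙ derivedL k A B ≅ L k A B ⋙ DerivedCategory.Q :=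
  DShMod.liftIso _ _ _

instance (E : Type*) [Category* E] : ((Functor.whiskeringLeft _ _ E).obj
    (DerivedCategory.Q (C := ModuleCat.{u} (A ⊗[k] Bᵐᵒᵖ)))).Full :=
  Localization.full_whiskeringLeft _
    (HomologicalComplex.quasiIso (ModuleCat.{u} (A ⊗[k] Bᵐᵒᵖ)) (ComplexShape.up ℤ)) E

instance (E : Type*) [Category* E] : ((Functor.whiskeringLeft _ _ E).obj
    (DerivedCategory.Q (C := ModuleCat.{u} (A ⊗[k] Bᵐᵒᵖ)))).Faithful :=
  Localization.faithful_whiskeringLeft _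
    (HomologicalComplex.quasiIso (ModuleCat.{u} (A ⊗[k] Bᵐᵒᵖ)) (ComplexShape.up ℤ)) E

/-- The adjunction between the derived categories induced by `adj`. -/
def derivedAdj : derivedL k A B ⊣ derivedR k A B :=
  descendAdjunction (adj k A B) (DShMod.Q k A B) DerivedCategory.Q (derivedLIso k A B)
    (derivedRIso k A B)

theorem derivedAdj_unit_app (X : ShMod k A B) :
    (derivedAdj k A B).unit.app ((DShMod.Q k A B).obj X) =
      (DShMod.Q k A B).map (unit X) ≫ (derivedRIso k A B).inv.app ((L k A B).obj X) ≫
        (derivedR k A B).map ((derivedLIso k A B).inv.app X) :=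
  descendUnit_app (adj k A B) (DShMod.Q k A B) DerivedCategory.Q (derivedLIso k A B)
    (derivedRIso k A B) X

theorem derivedAdj_counit_app (Y : BimodCx k A B) :
    (derivedAdj k A B).counit.app (DerivedCategory.Q.obj Y) =
      (derivedL k A B).map ((derivedRIso k A B).hom.app Y) ≫
        (derivedLIso k A B).hom.app ((R k A B).obj Y) ≫ DerivedCategory.Q.map (counit Y) :=
  descendCounit_app (adj k A B) (DShMod.Q k A B) DerivedCategory.Q (derivedLIso k A B)
    (derivedRIso k A B) Y

/-- The derived counit is invertible since the augmented bar resolution is exact. -/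
instance : IsIso (derivedAdj k A B).counit := by
  rw [NatTrans.isIso_iff_isIso_app]
  intro Z
  have := Localization.essSurj (DerivedCategory.Q (C := ModuleCat.{u} (A ⊗[k] Bᵐᵒᵖ)))
    (HomologicalComplex.quasiIso (ModuleCat.{u} (A ⊗[k] Bᵐᵒᵖ)) (ComplexShape.up ℤ))
  rw [← NatTrans.isIso_app_iff_of_iso _ (DerivedCategory.Q.objObjPreimageIso Z),
    derivedAdj_counit_app]
  have := quasiIso_counit (DerivedCategory.Q.objPreimage Z : BimodCx k A B)
  infer_instance

instance : (derivedR k A B).Full := (derivedAdj k A B).fullyFaithfulROfIsIsoCounit.full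

instance : (derivedR k A B).Faithful := (derivedAdj k A B).fullyFaithfulROfIsIsoCounit.faithful

/-- A strong homotopy module is `H`-unital if and only if the derived unit is invertible on it. -/
theorem isIso_derivedAdj_unit_app_iff (X : ShMod k A B) :
    IsIso ((derivedAdj k A B).unit.app ((DShMod.Q k A B).obj X)) ↔ HUnital k A B X := by
  rw [derivedAdj_unit_app, isIso_comp_right_iff]
  exact ⟨fun _ => ShMod.isQis_of_isIso_Q k A B (unit X), fun h => DShMod.isIso_Q (unit X) h⟩

theorem DHUnital_iff (Z : DShMod k A B) :
    DHUnital k A B Z ↔ IsIso ((derivedAdj k A B).unit.app Z) := by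
  constructor
  · rintro ⟨X, hX⟩
    exact (isIso_derivedAdj_unit_app_iff k A B X).2 hX
  · intro h
    obtain ⟨X, rfl⟩ := DShMod.exists_eq_obj k A B Z
    exact ⟨X, (isIso_derivedAdj_unit_app_iff k A B X).1 h⟩

theorem essImage_derivedR : (derivedR k A B).essImage = DHUnital k A B := by
  ext Z
  rw [DHUnital_iff, (derivedAdj k A B).isIso_unit_app_iff_mem_essImage]

theorem DHUnital_derivedR (Y : DerivedCategory (ModuleCat.{u} (A ⊗[k] Bᵐᵒᵖ))) :
    DHUnital k A B ((derivedR k A B).obj Y) := by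
  rw [← essImage_derivedR]
  exact (derivedR k A B).obj_mem_essImage Y

/-- The equivalence between the derived category of bimodules and the derived category of
`H`-unital strong homotopy modules. -/
def derivedEquivalence : DerivedCategory (ModuleCat.{u} (A ⊗[k] Bᵐᵒᵖ)) ≌
    (DHUnital k A B).FullSubcategory :=
  CategoryTheory.Equivalence.mk
    ((DHUnital k A B).lift (derivedR k A B) (DHUnital_derivedR k A B))
    ((DHUnital k A B).ι ⋙ derivedL k A B)
    (asIso (derivedAdj k A B).counit).symm
    (NatIso.ofComponents
      (fun Z =>
        have := (DHUnital_iff k A B Z.obj).1 Z.property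
        (DHUnital k A B).isoMk (asIso ((derivedAdj k A B).unit.app Z.obj)).symm)
      (fun {Z Z'} f => by
        have := (DHUnital_iff k A B Z.obj).1 Z.property
        have := (DHUnital_iff k A B Z'.obj).1 Z'.property
        apply (DHUnital k A B).ι.map_injective
        change (derivedR k A B).map ((derivedL k A B).map f.hom) ≫
            inv ((derivedAdj k A B).unit.app Z'.obj) =
          inv ((derivedAdj k A B).unit.app Z.obj) ≫ f.hom
        rw [IsIso.comp_inv_eq, Category.assoc, IsIso.eq_inv_comp]
        exact ((derivedAdj k A B).unit.naturality f.hom).symm))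

end Derived

end ShAct

end

theorem proposition6p4 (k A B : Type u) [CommRing k] [Ring A] [Algebra k A]
    [Ring B] [Algebra k B] [Module.Projective k A]
    [HasDerivedCategory.{w} (ModuleCat.{u} (A ⊗[k] Bᵐᵒᵖ))] :
    (ShAct.derivedR k A B).Full ∧ (ShAct.derivedR k A B).Faithful ∧
    (ShAct.derivedR k A B).essImage = ShAct.DHUnital k A B ∧
    ∃ (adj : ShAct.L k A B ⊣ ShAct.R k A B)
      (LD : ShAct.DShMod k A B ⥤ DerivedCategory (ModuleCat.{u} (A ⊗[k] Bᵐᵒᵖ)))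
      (iL : ShAct.DShMod.Q k A B ⋙ LD ≅ ShAct.L k A B ⋙ DerivedCategory.Q)
      (dadj : LD ⊣ ShAct.derivedR k A B)
      (hR : ∀ Y, ShAct.DHUnital k A B ((ShAct.derivedR k A B).obj Y))
      (e : DerivedCategory (ModuleCat.{u} (A ⊗[k] Bᵐᵒᵖ)) ≌ (ShAct.DHUnital k A B).FullSubcategory),
      (∀ X, adj.unit.app X = ShAct.unit X) ∧
      (∀ X, dadj.unit.app ((ShAct.DShMod.Q k A B).obj X) =
        (ShAct.DShMod.Q k A B).map (ShAct.unit X) ≫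
          (ShAct.derivedRIso k A B).inv.app ((ShAct.L k A B).obj X) ≫ (ShAct.derivedR k A B).map (iL.inv.app X)) ∧
      e.functor = (ShAct.DHUnital k A B).lift (ShAct.derivedR k A B) hR ∧
      e.inverse = (ShAct.DHUnital k A B).ι ⋙ LD := by
  refine ⟨inferInstance, inferInstance, ShAct.essImage_derivedR k A B, ShAct.adj k A B,
    ShAct.derivedL k A B, ShAct.derivedLIso k A B, ShAct.derivedAdj k A B,
    ShAct.DHUnital_derivedR k A B, ShAct.derivedEquivalence k A B, fun _ => rfl,
    fun X => ShAct.derivedAdj_unit_app k A B X, rfl, rfl⟩
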